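/- **Setting.** Latin indices run from 1 to 3 and repeated indices are summed. Let $\mathfrak g$ be a three-dimensional real Lie algebra of Bianchi type I–VIII (that is, not isomorphic to $\mathfrak{so}(3)$), with a basis $(e_i)$ and structure constants $[e_i,e_j]=C^k_{ij}e_k$; let $m>0$ and $\Lambda\in\mathbb R$. The unknowns are functions of $t$: a positive definite symmetric matrix $g_{ij}$ with inverse $g^{ij}$ (used to raise and lower indices), a symmetric matrix $k_{ij}$, vectors $E^i$, $u^i$, an antisymmetric matrix $F_{ij}$, and scalars $\Phi$, $U\ge 0$, $\rho\neq 0$, $e$. Put $$u^0=\sqrt{1+g_{ij}u^iu^j},\quad u_0=-u^0,\quad H=g^{ij}k_{ij},\quad \sigma_{ij}=k_{ij}-\tfrac H3 g_{ij},$$ $$\gamma^l_{ij}=\tfrac12 g^{lk}\big(-C^m_{jk}g_{im}+C^m_{ki}g_{jm}+C^m_{ij}g_{km}\big),\quad R_{ij}=\gamma^l_{lm}\gamma^m_{ji}-\gamma^m_{jl}\gamma^l_{mi}-C^l_{mj}\gamma^m_{li},\quad R=g^{ij}R_{ij},$$ $$T_{00}=U+\tfrac12m^2\Phi^2,\quad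 T_{0i}=0,\quad T_{ij}=g_{ij}\big(U-\tfrac12m^2\Phi^2\big),$$ $$\tau_{00}=\tfrac12E^iE_i+\tfrac14F^{ij}F_{ij},\quad \tau_{0j}=-E^kF_{jk},\quad \tau_{ij}=\tfrac12g_{ij}E^kE_k-E_iE_j-\tfrac14g_{ij}F^{kl}F_{kl}+g^{kl}F_{ik}F_{jl},$$ $$Q=H^2-24\pi T_{00}-3\Lambda .$$ The *evolution system* of the Einstein–Maxwell–massive scalar field equations is $$\dot g_{ij}=-2k_{ij},$$ $$\dot k_{ij}=R_{ij}+Hk_{ij}-2k^l_jk_{il}-8\pi(T_{ij}+\tau_{ij}+\rho u_iu_j)+4\pi\big[-T_{00}-\rho u_0^2+g^{lm}(T_{lm}+\rho u_lu_m)\big]g_{ij}-\Lambda g_{ij},$$ $$\dot E^i=HE^i-\big(C^j_{jk}g^{kl}g^{im}+\tfrac12C^i_{jk}g^{jl}g^{km}\big)F_{lm}+4\pi e u^i,\qquad \dot F_{ij}=C^k_{ij}g_{kl}E^l,$$ $$\dot u^i=2k^i_ju^j-\gamma^i_{jk}\frac{u^ju^k}{u^0}-4\pi\frac e\rho E^i+4\pi\frac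 e\rho\frac{g^{il}F_{jl}u^j}{u^0},\qquad \dot\Phi=\sqrt{2U},\qquad \dot U=2HU-m^2\Phi\sqrt{2U},$$ $$\dot\rho=-\Big[\frac{k_{ij}u^iu^j}{(u^0)^2}+\frac{C^i_{ij}u^j}{u^0}-H\Big]\rho+4\pi e\frac{g_{ij}E^ju^i}{(u^0)^2},\qquad \dot e=-\Big[\frac{k_{ij}u^iu^j}{(u^0)^2}+\frac{C^i_{ij}u^j}{u^0}-H\Big]e+4\pi\frac{g_{ij}E^ju^i}{(u^0)^2}\frac{e^2}{\rho},$$ and the *constraints* are $$R-k_{ij}k^{ij}+H^2=16\pi(T_{00}+\tau_{00}+\rho u_0^2)+2\Lambda,\qquad \nabla^ik_{ij}=-8\pi(T_{0j}+\tau_{0j}+\rho u_0u_j),$$ $$C^l_{ij}F_{kl}+C^l_{ki}F_{jl}+C^l_{jk}F_{il}=0,\qquad C^i_{ik}E^k+4\pi e u^0=0,$$ where $\nabla_lk_{ij}=-\gamma^n_{li}k_{nj}-\gamma^n_{lj}k_{in}$. **Theorem.** Consider a global solution on $[0,\infty)$ of the evolution system whose initial values satisfy the constraints and $\Phi^0:=\Phi(0)>0$,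 $U(0)>0$, $\rho(0)>0$, $e(0)\ge0$, $H(0)<0$, and let $\Lambda>-4\pi m^2(\Phi^0)^2$. Put $\gamma=\big[\tfrac13(\Lambda+4\pi m^2(\Phi^0)^2)\big]^{1/2}$. Then there are $L>0$ and a symmetric positive definite constant matrix $(G_{ij})$, with inverse $(G^{ij})$, such that with $$C_0=\Lambda+4\pi m^2L,\qquad \delta=\big[\tfrac13(\Lambda+4\pi m^2L)\big]^{1/2},\qquad \nu=3\delta-\gamma$$ the following hold. 1. As $t\to\infty$, each of $Q$, $\sigma_{ij}\sigma^{ij}$, $|R|$, $\tau_{00}$, $\rho$, $\dot\Phi^2$, $F^{ij}F_{ij}$, $E^iE_i$ is $\mathcal O(e^{-2\gamma t})$. 2. $\|\sigma(t)\|\le Ce^{-\gamma t}\|g(t)\|$ for all $t\ge 0$, where $\|\cdot\|$ is the Euclidean operator norm of matrices. 3. As $t\to\infty$, $\Phi^2\to L$, $T_{00}\to\tfrac{m^2}2L$, and $H=-(3C_0)^{1/2}+\mathcal O(e^{-2\delta t})$. 4. $|e^{-2\delta t}g_{ij}|\le C$ and $|e^{2\delta t}g^{ij}|\le C$ for all $t\ge0$;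 and as $t\to\infty$, $g_{ij}(t)=e^{2\delta t}\big(G_{ij}+\mathcal O(e^{-\gamma t})\big)$ and $g^{ij}(t)=e^{-2\delta t}\big(G^{ij}+\mathcal O(e^{-\gamma t})\big)$. 5. For all $t\ge0$: $|k_{ij}|\le Ce^{2\delta t}$, $|E^i|\le Ce^{\nu t}$, $|F_{ij}|\le Ce^{(2\delta+\nu)t}$, $|F^{ij}|\le Ce^{(\delta-\gamma)t}$, $|e|\le Ce^{\nu t}$. Here $C>0$ denotes constants, possibly different in each estimate, that do not depend on $t$. -/

import Mathlib

open Filter Asymptotics Topology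

noncomputable section

namespace EMSF

/-- `3 × 3` real matrices, the components of a tensor with two spatial indices. -/
abbrev Mat3 := Matrix (Fin 3) (Fin 3) ℝ

/-! ### The Lie algebra of the spatial sections -/

/-- The structure constants of a Lie algebra in a basis (left invariant frame) `b`:
`[e_i, e_j] = C^k_{ij} e_k`, and `structureConstants b k i j = C^k_{ij}`. -/
def structureConstants {L : Type*} [LieRing L] [LieAlgebra ℝ L] (b : Module.Basis (Fin 3) ℝ L)
    (k i j : Fin 3) : ℝ :=
  b.repr ⁅b i, b j⁆ k

/-- A real Lie algebra is of Bianchi type IX if it is isomorphic to `so(3)`, that is, to `ℝ³` with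
the cross product as bracket. The three dimensional real Lie algebras of the types I to VIII are
all the others. -/
def IsBianchiIX (L : Type*) [LieRing L] [LieAlgebra ℝ L] : Prop :=
  ∃ f : L ≃ₗ[ℝ] (Fin 3 → ℝ), ∀ x y : L, f ⁅x, y⁆ = crossProduct (f x) (f y)

/-! ### The unknowns and the tensors built from them

Everywhere `C k i j` stands for the structure constant `C^k_{ij}`. Components refer to the frame
`(∂_t, e_1, e_2, e_3)` of the metric `-dt² + g_ij e^i ⊗ e^j`. -/

/-- The values, at one instant, of the unknowns of the system: the metric `g_ij`, the second
fundamental form `k_ij`, the electric field `E^i = F^{0i}`, the magnetic part `F_ij` of the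
electromagnetic field, the spatial velocity `u^i`, the scalar field `Φ`, the variable
`U = (dΦ/dt)²/2`, the matter density `ρ`, the charge density `e`. -/
structure State where
  g : Mat3
  k : Mat3
  E : Fin 3 → ℝ
  F : Mat3
  u : Fin 3 → ℝ
  Φ : ℝ
  U : ℝ
  ρ : ℝ
  e : ℝ

namespace State

variable (C : Fin 3 → Fin 3 → Fin 3 → ℝ) (m Λ : ℝ) (s : State)

/-- The inverse metric `g^{ij}`. -/
def gi : Mat3 := s.g⁻¹

/-- Raising both indices: `a^{ij} = g^{il} g^{jm} a_{lm}`. -/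
def raise (a : Mat3) (i j : Fin 3) : ℝ := ∑ l, ∑ n, s.gi i l * s.gi j n * a l n

/-- The full contraction `a_{ij} a^{ij}`. -/
def normSq (a : Mat3) : ℝ := ∑ i, ∑ j, a i j * s.raise a i j

/-- `k^i_j = g^{il} k_{lj}`. -/
def kMixed (i j : Fin 3) : ℝ := ∑ l, s.gi i l * s.k l j

/-- The mean curvature `H = g^{ij} k_{ij}`. -/
def H : ℝ := ∑ i, ∑ j, s.gi i j * s.k i j

/-- The trace-free part of the second fundamental form: `σ_ij = k_ij - (H/3) g_ij`. -/
def σ : Mat3 := s.k - (s.H / 3) • s.g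

/-- `u^0 = √(1 + g_ij u^i u^j)`. -/
def u0 : ℝ := √(1 + ∑ i, ∑ j, s.g i j * s.u i * s.u j)

/-- `u_i = g_ij u^j`; moreover `u_0 = -u^0`. -/
def uLow (i : Fin 3) : ℝ := ∑ j, s.g i j * s.u j

/-- `E_i = g_ij E^j`. -/
def ELow (i : Fin 3) : ℝ := ∑ j, s.g i j * s.E j

/-- `E^i E_i`. -/
def ESq : ℝ := ∑ i, s.E i * s.ELow i

/-- The Ricci rotation coefficients, `γ^l_{ij} = conn C s l i j`:
`γ^l_{ij} = ½ g^{lk} (-C^m_{jk} g_{im} + C^m_{ki} g_{jm} + C^m_{ij} g_{km})`. -/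
def conn (l i j : Fin 3) : ℝ :=
  (1 / 2) * ∑ k, s.gi l k *
    ∑ n, (-(C n j k) * s.g i n + C n k i * s.g j n + C n i j * s.g k n)

/-- The Ricci tensor of `g`:
`R_ij = γ^l_{lm} γ^m_{ji} - γ^m_{jl} γ^l_{mi} - C^l_{mj} γ^m_{li}`. -/
def Ric (i j : Fin 3) : ℝ :=
  ∑ l, ∑ n, (s.conn C l l n * s.conn C n j i - s.conn C n j l * s.conn C l n i
    - C l n j * s.conn C n l i)

/-- The scalar curvature of `g`: `R = g^{ij} R_ij`. -/
def R : ℝ := ∑ i, ∑ j, s.gi i j * s.Ric C i j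

/-- `T_00 = ½ (dΦ/dt)² + ½ m² Φ²`, where `(dΦ/dt)² = 2 U`. -/
def T00 : ℝ := s.U + (1 / 2) * m ^ 2 * s.Φ ^ 2

/-- `T_ij = ½ g_ij ((dΦ/dt)² - m² Φ²)`, where `(dΦ/dt)² = 2 U`. The components `T_0i` vanish. -/
def T (i j : Fin 3) : ℝ := s.g i j * (s.U - (1 / 2) * m ^ 2 * s.Φ ^ 2)

/-- `τ_00 = ½ g_ij E^i E^j + ¼ F^{ij} F_ij`. -/
def τ00 : ℝ := (1 / 2) * s.ESq + (1 / 4) * s.normSq s.F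

/-- `τ_0j = -E^k F_jk`. -/
def τ0 (j : Fin 3) : ℝ := -∑ k, s.E k * s.F j k

/-- `τ_ij = ½ g_ij E^k E_k - E_i E_j - ¼ g_ij F^{kl} F_kl + g^{kl} F_ik F_jl`. -/
def τ (i j : Fin 3) : ℝ :=
  (1 / 2) * s.g i j * s.ESq - s.ELow i * s.ELow j - (1 / 4) * s.g i j * s.normSq s.F
    + ∑ k, ∑ l, s.gi k l * s.F i k * s.F j l

/-- `∇^i k_ij = g^{il} ∇_l k_ij`; the components of `k` are constant on the spatial sections, so
`∇_l k_ij = -γ^n_{li} k_nj - γ^n_{lj} k_in`. -/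
def divk (j : Fin 3) : ℝ :=
  ∑ i, ∑ l, s.gi i l * ∑ n, (-(s.conn C n l i * s.k n j) - s.conn C n l j * s.k i n)

/-- `Q = H² - 24 π T_00 - 3 Λ`. -/
def Q : ℝ := s.H ^ 2 - 24 * Real.pi * s.T00 m - 3 * Λ

/-! ### The right-hand sides of the evolution system -/

/-- `dk_ij/dt = R_ij + H k_ij - 2 k^l_j k_il - 8π (T_ij + τ_ij + ρ u_i u_j)
+ 4π [-T_00 - ρ u_0² + g^{lm} (T_lm + ρ u_l u_m)] g_ij - Λ g_ij`. -/
def kRate (i j : Fin 3) : ℝ :=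
  s.Ric C i j + s.H * s.k i j - 2 * ∑ l, s.kMixed l j * s.k i l
    - 8 * Real.pi * (s.T m i j + s.τ i j + s.ρ * s.uLow i * s.uLow j)
    + 4 * Real.pi * (-s.T00 m - s.ρ * s.u0 ^ 2
        + ∑ l, ∑ n, s.gi l n * (s.T m l n + s.ρ * s.uLow l * s.uLow n)) * s.g i j
    - Λ * s.g i j

/-- `dE^i/dt = H E^i - (C^j_{jk} g^{kl} g^{im} + ½ C^i_{jk} g^{jl} g^{km}) F_lm + 4π e u^i`. -/
def ERate (i : Fin 3) : ℝ :=
  s.H * s.E i - (∑ j, ∑ k, C j j k * s.raise s.F k i)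
    - (1 / 2) * (∑ j, ∑ k, C i j k * s.raise s.F j k) + 4 * Real.pi * s.e * s.u i

/-- `dF_ij/dt = C^k_{ij} g_kl E^l`. -/
def FRate (i j : Fin 3) : ℝ := ∑ k, C k i j * s.ELow k

/-- `du^i/dt = 2 k^i_j u^j - γ^i_{jk} u^j u^k / u^0 - 4π (e/ρ) E^i
+ 4π (e/ρ) g^{il} F_jl u^j / u^0`. -/
def uRate (i : Fin 3) : ℝ :=
  2 * (∑ j, s.kMixed i j * s.u j) - (∑ j, ∑ k, s.conn C i j k * s.u j * s.u k) / s.u0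
    - 4 * Real.pi * (s.e / s.ρ) * s.E i
    + 4 * Real.pi * (s.e / s.ρ) * ((∑ j, ∑ l, s.gi i l * s.F j l * s.u j) / s.u0)

/-- `dU/dt = 2 H U - m² Φ √(2U)`. -/
def URate : ℝ := 2 * s.H * s.U - m ^ 2 * s.Φ * √(2 * s.U)

/-- The bracket `k_ij u^i u^j / (u^0)² + C^i_{ij} u^j / u^0 - k^i_i` in the equations for the two
densities. -/
def densityCoeff : ℝ :=
  (∑ i, ∑ j, s.k i j * s.u i * s.u j) / s.u0 ^ 2 + (∑ i, ∑ j, C i i j * s.u j) / s.u0 - s.H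

/-- `dρ/dt`. -/
def ρRate : ℝ :=
  -(s.densityCoeff C) * s.ρ
    + 4 * Real.pi * s.e * ((∑ i, s.ELow i * s.u i) / s.u0 ^ 2)

/-- `de/dt`. -/
def eRate : ℝ :=
  -(s.densityCoeff C) * s.e
    + 4 * Real.pi * ((∑ i, s.ELow i * s.u i) / s.u0 ^ 2) * (s.e ^ 2 / s.ρ)

/-- The constraint equations. In the second one, `u_0 = -u^0` and `T_0j = 0`. -/
structure Constraints : Prop where
  hamiltonian : s.R C - s.normSq s.k + s.H ^ 2
    = 16 * Real.pi * (s.T00 m + s.τ00 + s.ρ * s.u0 ^ 2) + 2 * Λ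
  momentum : ∀ j, s.divk C j = -(8 * Real.pi) * (s.τ0 j + s.ρ * (-s.u0) * s.uLow j)
  magnetic : ∀ i j k, ∑ l, (C l i j * s.F k l + C l k i * s.F j l + C l j k * s.F i l) = 0
  electric : (∑ i, ∑ k, C i i k * s.E k) + 4 * Real.pi * s.e * s.u0 = 0

/-- Admissible initial data. -/
structure IsInitialData : Prop where
  g_posDef : s.g.PosDef
  k_symm : s.k.IsSymm
  F_antisymm : s.F.transpose = -s.F
  Φ_pos : 0 < s.Φ
  U_pos : 0 < s.U
  ρ_pos : 0 < s.ρ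
  e_nonneg : 0 ≤ s.e
  constraints : s.Constraints C m Λ

end State

/-- `v` is a solution on `[0, ∞)` of the evolution system of the Einstein-Maxwell-massive scalar
field equations with mass `m` and cosmological constant `Λ`. The first three fields say that `v`
takes its values where the system makes sense: `g` is a Riemannian metric, `√(2U)` and the
quotient `e / ρ` are defined. At `t = 0` the derivatives are one-sided. -/
structure IsGlobalSolution (C : Fin 3 → Fin 3 → Fin 3 → ℝ) (m Λ : ℝ) (v : ℝ → State) :
    Prop where
  g_posDef : ∀ t, 0 ≤ t → (v t).g.PosDef
  U_nonneg : ∀ t, 0 ≤ t → 0 ≤ (v t).U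
  ρ_ne_zero : ∀ t, 0 ≤ t → (v t).ρ ≠ 0
  g_eq : ∀ t, 0 ≤ t → ∀ i j,
    HasDerivWithinAt (fun r => (v r).g i j) (-2 * (v t).k i j) (Set.Ici 0) t
  k_eq : ∀ t, 0 ≤ t → ∀ i j,
    HasDerivWithinAt (fun r => (v r).k i j) ((v t).kRate C m Λ i j) (Set.Ici 0) t
  E_eq : ∀ t, 0 ≤ t → ∀ i,
    HasDerivWithinAt (fun r => (v r).E i) ((v t).ERate C i) (Set.Ici 0) t
  F_eq : ∀ t, 0 ≤ t → ∀ i j,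
    HasDerivWithinAt (fun r => (v r).F i j) ((v t).FRate C i j) (Set.Ici 0) t
  u_eq : ∀ t, 0 ≤ t → ∀ i,
    HasDerivWithinAt (fun r => (v r).u i) ((v t).uRate C i) (Set.Ici 0) t
  Φ_eq : ∀ t, 0 ≤ t →
    HasDerivWithinAt (fun r => (v r).Φ) (√(2 * (v t).U)) (Set.Ici 0) t
  U_eq : ∀ t, 0 ≤ t →
    HasDerivWithinAt (fun r => (v r).U) ((v t).URate m) (Set.Ici 0) t
  ρ_eq : ∀ t, 0 ≤ t →
    HasDerivWithinAt (fun r => (v r).ρ) ((v t).ρRate C) (Set.Ici 0) t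
  e_eq : ∀ t, 0 ≤ t →
    HasDerivWithinAt (fun r => (v r).e) ((v t).eRate C) (Set.Ici 0) t

/-- The operator norm `sup ‖A x‖ / ‖x‖` of a matrix for the Euclidean norm. -/
def opNorm (A : Mat3) : ℝ := ‖Matrix.toEuclideanCLM (n := Fin 3) (𝕜 := ℝ) A‖

end EMSF

end

/-!
The constraints are preserved by the evolution. Outside type IX the scalar curvature of a left
invariant metric is nonpositive, so the Hamiltonian constraint writes `Q` as a sum of nonnegative
multiples of `σ_{ij} σ^{ij}`, `-R`, `τ₀₀` and `ρ (u⁰)²`. Since `Φ` is nondecreasing, `H ≤ -3γ`, and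
`Q` satisfies `Q' ≤ -2γ Q`; hence `Q` and each of these terms decay like `e^{-2γt}`.

While `U > 0`, the derivative of `√(2U)` is at most `-m² Φ⁰`, so `U` vanishes after a finite time.
From then on `Φ² = L` is constant and `H² = Q + 9δ²` determines the limit of `H`. The metric
`e^{-2δt} g` and its inverse have relative derivatives of size `e^{-γt}`, hence converge at that
rate, and the decay of the `g`-norms of the fields turns into bounds on their components.
-/

open scoped Matrix

noncomputable section

namespace EMSF

section LieConstants

variable {ι : Type*} {C : ι → ι → ι → ℝ}

section StructureConstants

/-- The matrix of the `k`-th component of the bracket, a skew-symmetric bilinear form. -/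
def bracketMatrix (C : ι → ι → ι → ℝ) (k : ι) : Matrix ι ι ℝ := Matrix.of (C k)

theorem transpose_bracketMatrix (hC : ∀ k i j, C k i j = -C k j i) (k : ι) :
    (bracketMatrix C k)ᵀ = -bracketMatrix C k := by
  ext i j
  exact hC k j i

/-- The matrix of `ad e_j`. -/
def adMatrix (C : ι → ι → ι → ℝ) (j : ι) : Matrix ι ι ℝ := Matrix.of fun k l => C k j l

variable [Fintype ι]

/-- The two laws satisfied by the structure constants of a Lie algebra, with the index convention
`[e_i, e_j] = C k i j • e_k` of `structureConstants`. -/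
structure IsLieConstants (C : ι → ι → ι → ℝ) : Prop where
  skew : ∀ k i j, C k i j = -C k j i
  jacobi : ∀ n i j k, ∑ l, (C l i j * C n k l + C l k i * C n j l + C l j k * C n i l) = 0

/-- The covector `C^i_{ij}`, the negative of the trace of `ad e_j`. It vanishes precisely when the
Lie algebra is unimodular. -/
def traceForm (C : ι → ι → ι → ℝ) (j : ι) : ℝ := ∑ i, C i i j

theorem traceForm_eq_neg_trace (hC : ∀ k i j, C k i j = -C k j i) (j : ι) :
    traceForm C j = -(adMatrix C j).trace := by
  rw [Matrix.trace, ← Finset.sum_neg_distrib]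
  exact Finset.sum_congr rfl fun i _ => hC i i j

theorem isLieConstants_iff_commutator (hC : ∀ k i j, C k i j = -C k j i) :
    IsLieConstants C ↔ ∀ i j, adMatrix C i * adMatrix C j - adMatrix C j * adMatrix C i
      = ∑ l, C l i j • adMatrix C l := by
  have key (n i j k) : ∑ l, (C l i j * C n k l + C l k i * C n j l + C l j k * C n i l)
      = (adMatrix C i * adMatrix C j - adMatrix C j * adMatrix C i
        - ∑ l, C l i j • adMatrix C l) n k := by
    simp only [Matrix.sub_apply, Matrix.mul_apply, Matrix.sum_apply, Matrix.smul_apply, adMatrix,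
      Matrix.of_apply, smul_eq_mul, ← Finset.sum_sub_distrib]
    refine Finset.sum_congr rfl fun l _ => ?_
    rw [hC n k l, hC l k i]
    ring
  constructor
  · intro h i j
    refine sub_eq_zero.1 (Matrix.ext fun n k => ?_)
    rw [← key, h.jacobi, Matrix.zero_apply]
  · exact fun h => ⟨hC, fun n i j k => by rw [key, h, sub_self, Matrix.zero_apply]⟩

end StructureConstants

section Basis

variable {L : Type*} [LieRing L] [LieAlgebra ℝ L] (b : Module.Basis (Fin 3) ℝ L)

theorem repr_lie_eq_sum (x y : L) (k : Fin 3) :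
    b.repr ⁅x, y⁆ k = ∑ i, ∑ j, b.repr x i * b.repr y j * structureConstants b k i j := by
  conv_lhs => rw [← b.sum_repr x, ← b.sum_repr y]
  simp only [sum_lie, lie_sum, smul_lie, lie_smul, map_sum, map_smul, Finsupp.finsetSum_apply,
    Finsupp.smul_apply, smul_eq_mul, structureConstants, Finset.mul_sum, mul_assoc]
  rw [Finset.sum_comm]
  exact Finset.sum_congr rfl fun i _ => Finset.sum_congr rfl fun j _ => mul_left_comm _ _ _

theorem isLieConstants_structureConstants : IsLieConstants (structureConstants b) where
  skew k i j := by
    rw [structureConstants, ← lie_skew, map_neg]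
    rfl
  jacobi n i j k := by
    have repr_double (x y z : Fin 3) : b.repr ⁅b x, ⁅b y, b z⁆⁆ n
        = ∑ l, structureConstants b l y z * structureConstants b n x l := by
      rw [repr_lie_eq_sum]
      simp [Finsupp.single_apply, structureConstants]
    have h := congrArg (b.repr · n) (lie_jacobi (b i) (b j) (b k))
    simp only [map_add, Finsupp.add_apply, map_zero, Finsupp.zero_apply, repr_double] at h
    simp only [Finset.sum_add_distrib]
    linarith

end Basis

section Conjugation

variable [Fintype ι] [DecidableEq ι] {P Q : Matrix ι ι ℝ}

theorem conj_mul_conj (hPQ : P * Q = 1) (A B : Matrix ι ι ℝ) :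
    Q * A * P * (Q * B * P) = Q * (A * B) * P := by
  simp only [Matrix.mul_assoc]
  rw [← Matrix.mul_assoc P Q, hPQ, Matrix.one_mul]

theorem trace_conj (hPQ : P * Q = 1) (A : Matrix ι ι ℝ) : (Q * A * P).trace = A.trace := by
  rw [Matrix.trace_mul_cycle, hPQ, Matrix.one_mul]

end Conjugation

section ChangeFrame

variable [Fintype ι] {P Q : Matrix ι ι ℝ}

/-- The structure constants in the frame given by the columns of `P`, for which the rows of `Q`
form the dual frame. -/
def changeFrame (C : ι → ι → ι → ℝ) (P Q : Matrix ι ι ℝ) (a b d : ι) : ℝ :=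
  ∑ l, Q a l * (Pᵀ * bracketMatrix C l * P) b d

theorem bracketMatrix_changeFrame (a : ι) :
    bracketMatrix (changeFrame C P Q) a = ∑ l, Q a l • (Pᵀ * bracketMatrix C l * P) := by
  ext b d
  simp [bracketMatrix, changeFrame, Matrix.sum_apply]

theorem changeFrame_skew (hC : ∀ k i j, C k i j = -C k j i) (P Q : Matrix ι ι ℝ) (a b d : ι) :
    changeFrame C P Q a b d = -changeFrame C P Q a d b := by
  have h (l) : (Pᵀ * bracketMatrix C l * P)ᵀ = -(Pᵀ * bracketMatrix C l * P) := by
    simp [Matrix.transpose_mul, transpose_bracketMatrix hC, Matrix.mul_assoc]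
  simp only [changeFrame, ← Finset.sum_neg_distrib]
  refine Finset.sum_congr rfl fun l _ => ?_
  rw [← mul_neg, ← Matrix.neg_apply, ← h, Matrix.transpose_apply]

theorem adMatrix_changeFrame (P Q : Matrix ι ι ℝ) (b : ι) :
    adMatrix (changeFrame C P Q) b = ∑ j, P j b • (Q * adMatrix C j * P) := by
  ext a d
  simp only [adMatrix, changeFrame, bracketMatrix, Matrix.of_apply, Matrix.sum_apply,
    Matrix.smul_apply, smul_eq_mul, Matrix.mul_assoc]
  simp only [Matrix.mul_apply, Matrix.transpose_apply, Matrix.of_apply, Finset.mul_sum]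
  rw [Finset.sum_comm]
  exact Finset.sum_congr rfl fun j _ => Finset.sum_congr rfl fun l _ =>
    Finset.sum_congr rfl fun n _ => by ring

/-- The matrix of `ad x` for the vector `x` with components `x i`. -/
def adVec (C : ι → ι → ι → ℝ) (x : ι → ℝ) : Matrix ι ι ℝ := ∑ i, x i • adMatrix C i

theorem IsLieConstants.adVec_commutator (hC : IsLieConstants C) (x y : ι → ℝ) :
    adVec C x * adVec C y - adVec C y * adVec C x
      = ∑ l, (x ⬝ᵥ bracketMatrix C l *ᵥ y) • adMatrix C l := by
  have h := (isLieConstants_iff_commutator hC.skew).1 hC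
  calc adVec C x * adVec C y - adVec C y * adVec C x
      = ∑ i, ∑ j, (x i * y j) • (adMatrix C i * adMatrix C j - adMatrix C j * adMatrix C i) := by
        simp only [adVec, Finset.sum_mul_sum, smul_mul_smul_comm, smul_sub,
          Finset.sum_sub_distrib]
        rw [Finset.sum_comm (f := fun i j => (y i * x j) • (adMatrix C i * adMatrix C j))]
        simp only [mul_comm]
    _ = ∑ l, (x ⬝ᵥ bracketMatrix C l *ᵥ y) • adMatrix C l := by
        simp only [h, dotProduct, Matrix.mulVec, bracketMatrix, Matrix.of_apply, Finset.mul_sum,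
          Finset.sum_smul, Finset.smul_sum, smul_smul]
        rw [Finset.sum_comm_cycle]
        exact Finset.sum_congr rfl fun l _ => Finset.sum_congr rfl fun i _ =>
          Finset.sum_congr rfl fun j _ => by ring_nf

variable [DecidableEq ι]

theorem conj_adMatrix (hPQ : P * Q = 1) (l : ι) :
    Q * adMatrix C l * P = ∑ e, Q e l • adMatrix (changeFrame C P Q) e := by
  have h (j) : ∑ e, Q e l * P j e = (1 : Matrix ι ι ℝ) j l := by
    simp only [← hPQ, Matrix.mul_apply, mul_comm]
  simp only [adMatrix_changeFrame, Finset.smul_sum, smul_smul]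
  rw [Finset.sum_comm]
  simp [← Finset.sum_smul, h, Matrix.one_apply]

theorem IsLieConstants.changeFrame (hC : IsLieConstants C) (hPQ : P * Q = 1) :
    IsLieConstants (changeFrame C P Q) := by
  rw [isLieConstants_iff_commutator (changeFrame_skew hC.skew P Q)]
  intro b d
  have had (b) : adMatrix (EMSF.changeFrame C P Q) b = Q * adVec C (fun j => P j b) * P := by
    simp only [adMatrix_changeFrame, adVec, Finset.mul_sum, Finset.sum_mul, Matrix.mul_smul,
      Matrix.smul_mul]
  have hbr (l) : (fun j => P j b) ⬝ᵥ bracketMatrix C l *ᵥ (fun j => P j d)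
      = (Pᵀ * bracketMatrix C l * P) b d := by
    rw [Matrix.mul_assoc]
    rfl
  calc _ = Q * (∑ l, (Pᵀ * bracketMatrix C l * P) b d • adMatrix C l) * P := by
        rw [had, had, conj_mul_conj hPQ, conj_mul_conj hPQ, ← Matrix.sub_mul, ← Matrix.mul_sub,
          hC.adVec_commutator]
        simp only [hbr]
    _ = ∑ e, EMSF.changeFrame C P Q e b d • adMatrix (EMSF.changeFrame C P Q) e := by
        simp only [Finset.mul_sum, Finset.sum_mul, Matrix.mul_smul, Matrix.smul_mul,
          conj_adMatrix hPQ, Finset.smul_sum, smul_smul]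
        rw [Finset.sum_comm]
        simp only [← Finset.sum_smul, EMSF.changeFrame, mul_comm]

theorem traceForm_changeFrame (hC : ∀ k i j, C k i j = -C k j i) (hPQ : P * Q = 1) :
    traceForm (changeFrame C P Q) = traceForm C ᵥ* P := by
  ext d
  simp only [traceForm_eq_neg_trace (changeFrame_skew hC P Q), adMatrix_changeFrame,
    Matrix.trace_sum, Matrix.trace_smul, trace_conj hPQ, traceForm_eq_neg_trace hC, smul_eq_mul,
    neg_mul, Finset.sum_neg_distrib, Matrix.vecMul, dotProduct, mul_comm (P _ d)]

end ChangeFrame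

end LieConstants

section Metric

variable {ι : Type*} [Fintype ι] [DecidableEq ι] {C : ι → ι → ι → ℝ} {P Q : Matrix ι ι ℝ}

/-- The Christoffel symbols of the first kind of the left invariant metric `g`: the entry `(k, i)`
of `christoffelFirst C g j` is `g_{kl} γ^l_{ij}`. -/
def christoffelFirst (C : ι → ι → ι → ℝ) (g : Matrix ι ι ℝ) (j : ι) : Matrix ι ι ℝ :=
  (1 / 2 : ℝ) • (∑ m, g j m • bracketMatrix C m - (adMatrix C j)ᵀ * g - g * adMatrix C j)

/-- The Christoffel symbols of the left invariant metric `g`: the entry `(l, i)` of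
`christoffel C g j` is `γ^l_{ij}`. -/
def christoffel (C : ι → ι → ι → ℝ) (g : Matrix ι ι ℝ) (j : ι) : Matrix ι ι ℝ :=
  g⁻¹ * christoffelFirst C g j

/-- The Ricci tensor of the left invariant metric `g`. -/
def ricciMatrix (C : ι → ι → ι → ℝ) (g : Matrix ι ι ℝ) : Matrix ι ι ℝ :=
  Matrix.of fun i j => (traceForm C ᵥ* christoffel C g i) j
    - (christoffel C g j * christoffel C g i).trace

/-- The scalar curvature of the left invariant metric `g`. -/
def scalarCurv (C : ι → ι → ι → ℝ) (g : Matrix ι ι ℝ) : ℝ := (g⁻¹ * ricciMatrix C g).trace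

/-- The divergence of the left invariant symmetric tensor with the mixed components `X`. It does
not involve the metric. -/
def divMixed (C : ι → ι → ι → ℝ) (X : Matrix ι ι ℝ) (j : ι) : ℝ :=
  (traceForm C ᵥ* X) j + (adMatrix C j * X).trace

theorem inv_conj_transpose (hPQ : P * Q = 1) (g : Matrix ι ι ℝ) :
    (Pᵀ * g * P)⁻¹ = Q * g⁻¹ * Qᵀ := by
  rw [Matrix.mul_inv_rev, Matrix.mul_inv_rev, Matrix.inv_eq_right_inv hPQ,
    ← Matrix.transpose_nonsing_inv, Matrix.inv_eq_right_inv hPQ, Matrix.mul_assoc]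

theorem transpose_mul_transpose_eq_one (hPQ : P * Q = 1) : Qᵀ * Pᵀ = 1 := by
  rw [← Matrix.transpose_mul, hPQ, Matrix.transpose_one]

theorem christoffelFirst_changeFrame (hPQ : P * Q = 1) (g : Matrix ι ι ℝ) (d : ι) :
    christoffelFirst (changeFrame C P Q) (Pᵀ * g * P) d
      = ∑ j, P j d • (Pᵀ * christoffelFirst C g j * P) := by
  have hg : Pᵀ * g * P * Q = Pᵀ * g := by rw [Matrix.mul_assoc, hPQ, Matrix.mul_one]
  have bracket : ∑ m, (Pᵀ * g * P) d m • bracketMatrix (changeFrame C P Q) m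
      = ∑ j, P j d • ∑ l, g j l • (Pᵀ * bracketMatrix C l * P) := by
    simp only [bracketMatrix_changeFrame, Finset.smul_sum, smul_smul]
    rw [Finset.sum_comm, Finset.sum_comm (f := fun j l => (P j d * g j l) • _)]
    simp only [← Finset.sum_smul, ← Matrix.mul_apply, hg]
    simp only [Matrix.mul_apply, Matrix.transpose_apply]
  have ad (j : ι) : Pᵀ * g * P * (Q * adMatrix C j * P) = Pᵀ * (g * adMatrix C j) * P := by
    simp only [← Matrix.mul_assoc, hg]
  have adT (j : ι) : (Q * adMatrix C j * P)ᵀ * (Pᵀ * g * P)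
      = Pᵀ * ((adMatrix C j)ᵀ * g) * P := by
    simp only [Matrix.transpose_mul, Matrix.mul_assoc]
    rw [← Matrix.mul_assoc Qᵀ, transpose_mul_transpose_eq_one hPQ, Matrix.one_mul]
  simp only [christoffelFirst, bracket, adMatrix_changeFrame, Matrix.transpose_sum,
    Matrix.transpose_smul, Finset.sum_mul, Finset.mul_sum, Matrix.smul_mul, Matrix.mul_smul, ad,
    adT, Matrix.mul_sub, Matrix.sub_mul, smul_sub, Finset.sum_sub_distrib, Finset.smul_sum,
    smul_comm (1 / 2 : ℝ)]

theorem christoffel_changeFrame (hPQ : P * Q = 1) (g : Matrix ι ι ℝ) (d : ι) :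
    christoffel (changeFrame C P Q) (Pᵀ * g * P) d
      = ∑ j, P j d • (Q * christoffel C g j * P) := by
  rw [christoffel, christoffelFirst_changeFrame hPQ, inv_conj_transpose hPQ, Finset.mul_sum]
  refine Finset.sum_congr rfl fun j _ => ?_
  rw [Matrix.mul_smul, christoffel]
  simp only [Matrix.mul_assoc]
  rw [← Matrix.mul_assoc Qᵀ, transpose_mul_transpose_eq_one hPQ, Matrix.one_mul]

theorem traceForm_changeFrame_vecMul_conj (hC : ∀ k i j, C k i j = -C k j i) (hPQ : P * Q = 1)
    (X : Matrix ι ι ℝ) :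
    traceForm (changeFrame C P Q) ᵥ* (Q * X * P) = (traceForm C ᵥ* X) ᵥ* P := by
  rw [traceForm_changeFrame hC hPQ, Matrix.vecMul_vecMul, Matrix.vecMul_vecMul,
    ← Matrix.mul_assoc, ← Matrix.mul_assoc, hPQ, Matrix.one_mul]

theorem ricciMatrix_changeFrame (hC : ∀ k i j, C k i j = -C k j i) (hPQ : P * Q = 1)
    (g : Matrix ι ι ℝ) :
    ricciMatrix (changeFrame C P Q) (Pᵀ * g * P) = Pᵀ * ricciMatrix C g * P := by
  ext b d
  have quadratic : (christoffel (changeFrame C P Q) (Pᵀ * g * P) d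
        * christoffel (changeFrame C P Q) (Pᵀ * g * P) b).trace
      = ∑ j, ∑ i, P i b * (christoffel C g j * christoffel C g i).trace * P j d := by
    simp only [christoffel_changeFrame hPQ, Finset.sum_mul_sum, smul_mul_smul_comm,
      conj_mul_conj hPQ, Matrix.trace_sum, Matrix.trace_smul, trace_conj hPQ, smul_eq_mul,
      mul_right_comm, mul_comm (P _ d)]
  have linear : (traceForm (changeFrame C P Q)
        ᵥ* christoffel (changeFrame C P Q) (Pᵀ * g * P) b) d
      = ∑ j, ∑ i, P i b * (traceForm C ᵥ* christoffel C g i) j * P j d := by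
    simp only [christoffel_changeFrame hPQ, Matrix.vecMul_sum, Matrix.vecMul_smul,
      traceForm_changeFrame_vecMul_conj hC hPQ, Finset.sum_apply, Pi.smul_apply, smul_eq_mul]
    rw [Finset.sum_comm]
    refine Finset.sum_congr rfl fun i _ => ?_
    rw [Matrix.vecMul, dotProduct, Finset.mul_sum]
    simp only [mul_assoc]
  simp only [ricciMatrix, Matrix.of_apply, quadratic, linear, Matrix.mul_apply,
    Matrix.transpose_apply, Finset.sum_mul, mul_sub, sub_mul, Finset.sum_sub_distrib]

theorem scalarCurv_changeFrame (hC : ∀ k i j, C k i j = -C k j i) (hPQ : P * Q = 1)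
    (g : Matrix ι ι ℝ) : scalarCurv (changeFrame C P Q) (Pᵀ * g * P) = scalarCurv C g := by
  have h : Q * g⁻¹ * Qᵀ * (Pᵀ * ricciMatrix C g * P) = Q * (g⁻¹ * ricciMatrix C g) * P := by
    simp only [Matrix.mul_assoc]
    rw [← Matrix.mul_assoc Qᵀ, transpose_mul_transpose_eq_one hPQ, Matrix.one_mul]
  rw [scalarCurv, ricciMatrix_changeFrame hC hPQ, inv_conj_transpose hPQ, h, trace_conj hPQ]
  rfl

theorem divMixed_changeFrame (hC : ∀ k i j, C k i j = -C k j i) (hPQ : P * Q = 1)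
    (X : Matrix ι ι ℝ) : divMixed (changeFrame C P Q) (Q * X * P) = divMixed C X ᵥ* P := by
  ext d
  rw [divMixed, traceForm_changeFrame_vecMul_conj hC hPQ, adMatrix_changeFrame, Finset.sum_mul,
    Matrix.trace_sum, Matrix.vecMul, Matrix.vecMul, dotProduct, dotProduct,
    ← Finset.sum_add_distrib]
  refine Finset.sum_congr rfl fun j _ => ?_
  rw [Matrix.smul_mul, conj_mul_conj hPQ, Matrix.trace_smul, trace_conj hPQ, smul_eq_mul,
    divMixed, add_mul, mul_comm (P j d)]

/-- The columns of `P` form an orthonormal frame of the metric `g`, with the dual frame given by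
the rows of `Q`. -/
structure IsOrthonormalFrame (g P Q : Matrix ι ι ℝ) : Prop where
  mul_eq_one : P * Q = 1
  conj_eq_one : Pᵀ * g * P = 1

omit [DecidableEq ι] in
theorem exists_eq_transpose_mul_self {a : Matrix ι ι ℝ} (ha : a.PosSemidef) :
    ∃ Q : Matrix ι ι ℝ, a = Qᵀ * Q := by
  classical
  open scoped MatrixOrder in
  obtain ⟨Q, hQ⟩ := CStarAlgebra.nonneg_iff_eq_star_mul_self.mp ha.nonneg
  exact ⟨Q, by rw [hQ, Matrix.star_eq_conjTranspose, Matrix.conjTranspose_eq_transpose_of_trivial]⟩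

theorem exists_isOrthonormalFrame {g : Matrix ι ι ℝ} (hg : g.PosDef) :
    ∃ P Q : Matrix ι ι ℝ, IsOrthonormalFrame g P Q := by
  obtain ⟨Q, hQ⟩ := exists_eq_transpose_mul_self hg.posSemidef
  have hdet : IsUnit Q.det := by
    refine isUnit_iff_ne_zero.2 fun h0 => hg.det_pos.ne' ?_
    rw [hQ, Matrix.det_mul, h0, mul_zero]
  have hPQ : Q⁻¹ * Q = 1 := Matrix.nonsing_inv_mul Q hdet
  have hQP : Q * Q⁻¹ = 1 := Matrix.mul_nonsing_inv Q hdet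
  refine ⟨Q⁻¹, Q, hPQ, ?_⟩
  rw [hQ, ← Matrix.mul_assoc, transpose_mul_transpose_eq_one hQP, Matrix.one_mul, hQP]

namespace IsOrthonormalFrame

variable {g : Matrix ι ι ℝ} (hf : IsOrthonormalFrame g P Q)
include hf

theorem mul_eq_one' : Q * P = 1 := mul_eq_one_comm.1 hf.mul_eq_one

theorem inv_eq : g⁻¹ = P * Pᵀ := by
  have h := inv_conj_transpose hf.mul_eq_one g
  rw [hf.conj_eq_one, inv_one] at h
  calc g⁻¹ = P * Q * g⁻¹ * (Qᵀ * Pᵀ) := by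
        rw [hf.mul_eq_one, transpose_mul_transpose_eq_one hf.mul_eq_one, Matrix.one_mul,
          Matrix.mul_one]
    _ = P * (Q * g⁻¹ * Qᵀ) * Pᵀ := by simp only [Matrix.mul_assoc]
    _ = P * Pᵀ := by rw [← h, Matrix.mul_one]

theorem conj_inv_mul (A : Matrix ι ι ℝ) : Q * (g⁻¹ * A) * P = Pᵀ * A * P := by
  rw [hf.inv_eq, ← Matrix.mul_assoc, ← Matrix.mul_assoc, hf.mul_eq_one', Matrix.one_mul]

end IsOrthonormalFrame

end Metric

section ThreeDimensional

variable {c : Fin 3 → Fin 3 → Fin 3 → ℝ}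

theorem diag_eq_zero (hc : ∀ k i j, c k i j = -c k j i) (k i : Fin 3) : c k i i = 0 :=
  self_eq_neg.1 (hc k i i)

theorem christoffelFirst_one (j : Fin 3) : christoffelFirst c 1 j
    = (1 / 2 : ℝ) • (bracketMatrix c j - (adMatrix c j)ᵀ - adMatrix c j) := by
  simp [christoffelFirst, Matrix.one_apply]

theorem christoffel_one (j : Fin 3) :
    christoffel c 1 j = (1 / 2 : ℝ) • (bracketMatrix c j - (adMatrix c j)ᵀ - adMatrix c j) := by
  rw [christoffel, inv_one, Matrix.one_mul, christoffelFirst_one]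

theorem divMixed_ricciMatrix_one (hc : IsLieConstants c) (d : Fin 3) :
    divMixed c (ricciMatrix c 1) d = 0 := by
  have J (n) := hc.jacobi n 0 1 2
  have hd := diag_eq_zero hc.skew
  simp only [Fin.sum_univ_three, hd, hc.skew _ 1 0, hc.skew _ 0 2, hc.skew _ 2 1] at J
  fin_cases d <;>
  simp only [divMixed, ricciMatrix, christoffel_one, Matrix.vecMul, dotProduct, traceForm, adMatrix,
    bracketMatrix, Matrix.trace, Matrix.diag, Matrix.mul_apply, Matrix.of_apply, Matrix.smul_apply,
    Matrix.sub_apply, Matrix.transpose_apply, smul_eq_mul, Fin.sum_univ_three, hd, hc.skew _ 1 0,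
    hc.skew _ 0 2, hc.skew _ 2 1, Fin.zero_eta, Fin.mk_one, Fin.reduceFinMk]
  · linear_combination (c 0 1 2 - c 1 2 0 - c 2 0 1) * J 0 + (c 0 2 0 + c 1 1 2) * J 1
      + (c 0 0 1 + c 2 1 2) * J 2
  · linear_combination (c 0 2 0 + c 1 1 2) * J 0 + (-c 0 1 2 + c 1 2 0 - c 2 0 1) * J 1
      + (c 1 0 1 + c 2 2 0) * J 2
  · linear_combination (c 0 0 1 + c 2 1 2) * J 0 + (c 1 0 1 + c 2 2 0) * J 1
      + (-c 0 1 2 - c 1 2 0 + c 2 0 1) * J 2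

/-- The contracted Bianchi identity: the scalar curvature is constant in space. -/
theorem divMixed_inv_mul_ricciMatrix (hc : IsLieConstants c) {g : Mat3} (hg : g.PosDef) :
    divMixed c (g⁻¹ * ricciMatrix c g) = 0 := by
  obtain ⟨P, Q, hf⟩ := exists_isOrthonormalFrame hg
  have h : divMixed c (g⁻¹ * ricciMatrix c g) ᵥ* P = 0 := by
    rw [← divMixed_changeFrame hc.skew hf.mul_eq_one, hf.conj_inv_mul,
      ← ricciMatrix_changeFrame hc.skew hf.mul_eq_one, hf.conj_eq_one]
    exact funext fun d => divMixed_ricciMatrix_one (hc.changeFrame hf.mul_eq_one) d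
  calc divMixed c (g⁻¹ * ricciMatrix c g) = divMixed c (g⁻¹ * ricciMatrix c g) ᵥ* P ᵥ* Q := by
        rw [Matrix.vecMul_vecMul, hf.mul_eq_one, Matrix.vecMul_one]
    _ = 0 := by rw [h, Matrix.zero_vecMul]

end ThreeDimensional

section Calculus

variable {ι : Type*} [Fintype ι] {A : ℝ → Matrix ι ι ℝ} {A' : Matrix ι ι ℝ} {S : Set ℝ} {t : ℝ}

theorem hasDerivWithinAt_matrix {ι κ : Type*} [Finite ι] [Finite κ] {A : ℝ → Matrix ι κ ℝ}
    {A' : Matrix ι κ ℝ} :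
    HasDerivWithinAt A A' S t ↔ ∀ i j, HasDerivWithinAt (fun r => A r i j) (A' i j) S t := by
  cases nonempty_fintype ι
  cases nonempty_fintype κ
  exact hasDerivWithinAt_pi.trans (forall_congr' fun _ => hasDerivWithinAt_pi)

theorem hasDerivWithinAt_matrix_trace (hA : HasDerivWithinAt A A' S t) :
    HasDerivWithinAt (fun r => (A r).trace) A'.trace S t :=
  HasDerivWithinAt.fun_sum fun i _ => hasDerivWithinAt_matrix.1 hA i i

theorem hasDerivWithinAt_christoffelFirst {C : ι → ι → ι → ℝ} (hA : HasDerivWithinAt A A' S t)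
    (j : ι) :
    HasDerivWithinAt (fun r => christoffelFirst C (A r) j) (christoffelFirst C A' j) S t := by
  have h := hasDerivWithinAt_matrix.1 hA
  refine hasDerivWithinAt_matrix.2 fun x y => ?_
  simp only [christoffelFirst, Matrix.smul_apply, Matrix.sub_apply, Matrix.sum_apply,
    Matrix.mul_apply, smul_eq_mul]
  exact (((HasDerivWithinAt.fun_sum fun m _ => (h j m).mul_const _).sub
    (HasDerivWithinAt.fun_sum fun m _ => (h m y).const_mul _)).sub
    (HasDerivWithinAt.fun_sum fun m _ => (h x m).mul_const _)).const_mul _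

open scoped Matrix.Norms.Operator in
theorem hasDerivWithinAt_matrix_mul {B : ℝ → Matrix ι ι ℝ} {B' : Matrix ι ι ℝ}
    (hA : HasDerivWithinAt A A' S t) (hB : HasDerivWithinAt B B' S t) :
    HasDerivWithinAt (fun r => A r * B r) (A' * B t + A t * B') S t := by
  classical exact hA.mul hB

theorem hasDerivWithinAt_matrix_conj (P : Matrix ι ι ℝ) (hA : HasDerivWithinAt A A' S t) :
    HasDerivWithinAt (fun r => Pᵀ * A r * P) (Pᵀ * A' * P) S t := by
  have hconst (B : Matrix ι ι ℝ) : HasDerivWithinAt (fun _ : ℝ => B) 0 S t :=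
    hasDerivWithinAt_matrix.2 fun _ _ => hasDerivWithinAt_const _ _ _
  simpa using hasDerivWithinAt_matrix_mul (hasDerivWithinAt_matrix_mul (hconst Pᵀ) hA) (hconst P)

open scoped Matrix.Norms.Operator in
theorem hasDerivWithinAt_matrix_inv [DecidableEq ι] (hA : HasDerivWithinAt A A' S t)
    (h : IsUnit (A t)) :
    HasDerivWithinAt (fun r => (A r)⁻¹) (-((A t)⁻¹ * A' * (A t)⁻¹)) S t := by
  obtain ⟨u, hu⟩ := h
  have hinv : HasFDerivAt Ring.inverse _ (A t) := hu ▸ hasFDerivAt_ringInverse (𝕜 := ℝ) u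
  simp only [Matrix.nonsing_inv_eq_ringInverse, ← hu, Ring.inverse_unit]
  exact hinv.comp_hasDerivWithinAt t hA

end Calculus

section ScalarCurvature

theorem christoffelFirst_smul {ι : Type*} [Fintype ι] (C : ι → ι → ι → ℝ) (a : ℝ)
    (k : Matrix ι ι ℝ) (j : ι) :
    christoffelFirst C (a • k) j = a • christoffelFirst C k j := by
  simp only [christoffelFirst, Matrix.smul_apply, smul_assoc, ← Finset.smul_sum, Matrix.mul_smul,
    Matrix.smul_mul, ← smul_sub]
  rw [smul_comm]

variable {c : Fin 3 → Fin 3 → Fin 3 → ℝ} {S : Set ℝ} {t : ℝ}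

/-- The Palatini identity in an orthonormal frame: the trace of the variation of the Ricci tensor
is a divergence. -/
theorem palatini (hc : ∀ k i j, c k i j = -c k j i) {k : Mat3} (hk : k.IsSymm) :
    ∑ i, ((traceForm c ᵥ* (k * christoffelFirst c 1 i - christoffelFirst c k i)) i
      - 2 * ((k * christoffelFirst c 1 i - christoffelFirst c k i) * christoffel c 1 i).trace)
      = -(traceForm c ⬝ᵥ divMixed c k) := by
  have hd := diag_eq_zero hc
  have h10 : k 1 0 = k 0 1 := hk.apply 0 1
  have h20 : k 2 0 = k 0 2 := hk.apply 0 2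
  have h21 : k 2 1 = k 1 2 := hk.apply 1 2
  simp only [christoffelFirst_one, christoffel_one]
  simp only [christoffelFirst, divMixed, Matrix.vecMul, dotProduct,
    traceForm, adMatrix, bracketMatrix, Matrix.trace, Matrix.diag, Matrix.mul_apply,
    Matrix.of_apply, Matrix.smul_apply, Matrix.sub_apply, Matrix.add_apply,
    Matrix.transpose_apply, smul_eq_mul, Fin.sum_univ_three, hd, hc _ 1 0, hc _ 0 2, hc _ 2 1,
    h10, h20, h21]
  ring

theorem hasDerivWithinAt_scalarCurv_of_eq_one (hc : ∀ k i j, c k i j = -c k j i)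
    {g : ℝ → Mat3} {k : Mat3} (hk : k.IsSymm) (hg : HasDerivWithinAt g ((-2 : ℝ) • k) S t)
    (h1 : g t = 1) : HasDerivWithinAt (fun r => scalarCurv c (g r))
      (2 * (ricciMatrix c 1 * k).trace - 2 * (traceForm c ⬝ᵥ divMixed c k)) S t := by
  have hinv : HasDerivWithinAt (fun r => (g r)⁻¹) ((2 : ℝ) • k) S t := by
    simpa [h1] using hasDerivWithinAt_matrix_inv hg (h1 ▸ isUnit_one)
  set X : Fin 3 → Mat3 := fun j => k * christoffelFirst c 1 j - christoffelFirst c k j with hX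
  have hchr (j) : HasDerivWithinAt (fun r => christoffel c (g r) j) ((2 : ℝ) • X j) S t := by
    have h := hasDerivWithinAt_matrix_mul hinv (hasDerivWithinAt_christoffelFirst (C := c) hg j)
    rw [h1, inv_one, Matrix.one_mul, christoffelFirst_smul] at h
    rwa [Matrix.smul_mul, neg_smul, ← sub_eq_add_neg, ← smul_sub] at h
  set Ric' : Mat3 := Matrix.of fun i j => 2 * (traceForm c ᵥ* X i) j
    - 2 * (X j * christoffel c 1 i + christoffel c 1 j * X i).trace with hRic'
  have hric : HasDerivWithinAt (fun r => ricciMatrix c (g r)) Ric' S t := by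
    refine hasDerivWithinAt_matrix.2 fun i j => ?_
    have hlin : HasDerivWithinAt (fun r => (traceForm c ᵥ* christoffel c (g r) i) j)
        (2 * (traceForm c ᵥ* X i) j) S t := by
      have h := HasDerivWithinAt.fun_sum (u := Finset.univ) fun m _ =>
        (hasDerivWithinAt_matrix.1 (hchr i) m j).const_mul (traceForm c m)
      refine HasDerivWithinAt.congr_deriv h ?_
      simp only [Matrix.vecMul, dotProduct, Finset.mul_sum, Matrix.smul_apply, smul_eq_mul,
        mul_left_comm]
    refine (hlin.sub (hasDerivWithinAt_matrix_trace
      (hasDerivWithinAt_matrix_mul (hchr j) (hchr i)))).congr_deriv ?_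
    simp only [hRic', h1, Matrix.of_apply, Matrix.smul_mul, Matrix.mul_smul, ← smul_add,
      Matrix.trace_smul, smul_eq_mul]
  have htrace : Ric'.trace = -2 * (traceForm c ⬝ᵥ divMixed c k) := by
    rw [neg_mul, ← mul_neg, ← palatini hc hk, Finset.mul_sum]
    refine Finset.sum_congr rfl fun i _ => ?_
    simp only [hRic', Matrix.diag, Matrix.of_apply, Matrix.trace_add,
      Matrix.trace_mul_comm (christoffel c 1 i), hX]
    ring
  refine (hasDerivWithinAt_matrix_trace (hasDerivWithinAt_matrix_mul hinv hric)).congr_deriv ?_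
  rw [h1, inv_one, Matrix.one_mul, Matrix.trace_add, htrace, Matrix.smul_mul, Matrix.trace_smul,
    Matrix.trace_mul_comm, smul_eq_mul]
  ring

theorem hasDerivWithinAt_scalarCurv {C : Fin 3 → Fin 3 → Fin 3 → ℝ}
    (hC : ∀ k i j, C k i j = -C k j i) {g : ℝ → Mat3} {k : Mat3} (hk : k.IsSymm)
    (hg : HasDerivWithinAt g ((-2 : ℝ) • k) S t) (hpos : (g t).PosDef) :
    HasDerivWithinAt (fun r => scalarCurv C (g r))
      (2 * ((g t)⁻¹ * ricciMatrix C (g t) * ((g t)⁻¹ * k)).trace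
        - 2 * (traceForm C ⬝ᵥ (g t)⁻¹ *ᵥ divMixed C ((g t)⁻¹ * k))) S t := by
  obtain ⟨P, Q, hf⟩ := exists_isOrthonormalFrame hpos
  have hPQ := hf.mul_eq_one
  have hY : HasDerivWithinAt (fun r => Pᵀ * g r * P) ((-2 : ℝ) • (Pᵀ * k * P)) S t := by
    simpa using hasDerivWithinAt_matrix_conj P hg
  have hk' : (Pᵀ * k * P).IsSymm := by
    rw [Matrix.IsSymm, Matrix.transpose_mul, Matrix.transpose_mul, hk.eq,
      Matrix.transpose_transpose, Matrix.mul_assoc]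
  have h := hasDerivWithinAt_scalarCurv_of_eq_one (changeFrame_skew hC P Q) hk' hY hf.conj_eq_one
  simp only [scalarCurv_changeFrame hC hPQ] at h
  refine h.congr_deriv ?_
  have hric : (ricciMatrix (changeFrame C P Q) 1 * (Pᵀ * k * P)).trace
      = ((g t)⁻¹ * ricciMatrix C (g t) * ((g t)⁻¹ * k)).trace := by
    rw [← hf.conj_eq_one, ricciMatrix_changeFrame hC hPQ, ← hf.conj_inv_mul, ← hf.conj_inv_mul,
      conj_mul_conj hPQ, trace_conj hPQ]
  have hdiv : traceForm (changeFrame C P Q) ⬝ᵥ divMixed (changeFrame C P Q) (Pᵀ * k * P)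
      = traceForm C ⬝ᵥ (g t)⁻¹ *ᵥ divMixed C ((g t)⁻¹ * k) := by
    rw [← hf.conj_inv_mul, divMixed_changeFrame hC hPQ, traceForm_changeFrame hC hPQ, hf.inv_eq,
      ← Matrix.mulVec_mulVec, Matrix.dotProduct_mulVec, Matrix.mulVec_transpose]
  rw [hric, hdiv]

end ScalarCurvature

section BianchiClassification

variable {c : Fin 3 → Fin 3 → Fin 3 → ℝ} {n : Mat3}

/-- The symmetric matrix `n` of the Bianchi classification of three dimensional Lie algebras. For
unimodular Lie algebras the bracket of `x` and `y` is `n *ᵥ (x × y)`. -/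
def bianchiMatrix (c : Fin 3 → Fin 3 → Fin 3 → ℝ) : Mat3 :=
  !![c 0 1 2, (c 0 2 0 + c 1 1 2) / 2, (c 0 0 1 + c 2 1 2) / 2;
     (c 0 2 0 + c 1 1 2) / 2, c 1 2 0, (c 1 0 1 + c 2 2 0) / 2;
     (c 0 0 1 + c 2 1 2) / 2, (c 1 0 1 + c 2 2 0) / 2, c 2 0 1]

theorem isHermitian_bianchiMatrix : (bianchiMatrix c).IsHermitian := by
  ext i j
  fin_cases i <;> fin_cases j <;> simp [bianchiMatrix]

theorem scalarCurv_one_eq (hc : ∀ k i j, c k i j = -c k j i) :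
    scalarCurv c 1 = (bianchiMatrix c).trace ^ 2 / 2 - (bianchiMatrix c * bianchiMatrix c).trace
      - 3 / 2 * ∑ i, traceForm c i ^ 2 := by
  have hd := diag_eq_zero hc
  rw [scalarCurv, inv_one, Matrix.one_mul]
  simp only [bianchiMatrix, ricciMatrix, christoffel_one, traceForm, adMatrix, bracketMatrix,
    Matrix.vecMul, dotProduct, Matrix.trace, Matrix.diag,
    Matrix.mul_apply, Matrix.of_apply, Matrix.smul_apply, Matrix.sub_apply,
    Matrix.transpose_apply, smul_eq_mul, Fin.sum_univ_three, hd,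
    hc _ 1 0, hc _ 0 2, hc _ 2 1, Matrix.cons_val', Matrix.cons_val_zero,
    Matrix.cons_val_one, Matrix.cons_val, Matrix.cons_val_fin_one]
  ring

theorem bianchiMatrix_mulVec_traceForm (hc : IsLieConstants c) :
    bianchiMatrix c *ᵥ traceForm c = 0 := by
  have hd := diag_eq_zero hc.skew
  have J (n) := hc.jacobi n 0 1 2
  simp only [Fin.sum_univ_three, hd, hc.skew _ 1 0, hc.skew _ 0 2, hc.skew _ 2 1] at J
  ext i
  fin_cases i <;>
  simp only [bianchiMatrix, traceForm, Matrix.mulVec, dotProduct, Matrix.of_apply,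
    Fin.sum_univ_three, hd, hc.skew _ 1 0, hc.skew _ 0 2,
    hc.skew _ 2 1, Matrix.cons_val', Matrix.cons_val_zero, Matrix.cons_val_one, Matrix.cons_val,
    Matrix.cons_val_fin_one, Fin.zero_eta, Fin.mk_one, Fin.reduceFinMk, Pi.zero_apply]
  · linear_combination J 0
  · linear_combination J 1
  · linear_combination J 2

theorem adVec_mulVec_eq_bianchiMatrix (hc : ∀ k i j, c k i j = -c k j i) (ha : traceForm c = 0)
    (x y : Fin 3 → ℝ) : adVec c x *ᵥ y = bianchiMatrix c *ᵥ crossProduct x y := by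
  have hd := diag_eq_zero hc
  have h0 := congrFun ha 0
  have h1 := congrFun ha 1
  have h2 := congrFun ha 2
  simp only [traceForm, Fin.sum_univ_three, hd, hc _ 1 0, hc _ 0 2, hc _ 2 1,
    Pi.zero_apply] at h0 h1 h2
  ext a
  fin_cases a <;>
  simp only [adVec, adMatrix, bianchiMatrix, cross_apply, Matrix.mulVec, dotProduct,
    Matrix.sum_apply, Matrix.smul_apply, smul_eq_mul, Matrix.of_apply,
    Fin.sum_univ_three, hd, hc _ 1 0, hc _ 0 2, hc _ 2 1,
    Matrix.cons_val', Matrix.cons_val_zero, Matrix.cons_val_one, Matrix.cons_val,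
    Matrix.cons_val_fin_one, Fin.zero_eta, Fin.mk_one, Fin.reduceFinMk]
  · linear_combination (h2 / 2) * (x 0 * y 2 - x 2 * y 0) + (h1 / 2) * (x 0 * y 1 - x 1 * y 0)
  · linear_combination (h2 / 2) * (x 1 * y 2 - x 2 * y 1) - (h0 / 2) * (x 0 * y 1 - x 1 * y 0)
  · linear_combination -(h1 / 2) * (x 1 * y 2 - x 2 * y 1) - (h0 / 2) * (x 0 * y 2 - x 2 * y 0)

theorem trace_mul_self_eq_sum_eigenvalues_sq {ι : Type*} [Fintype ι] [DecidableEq ι]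
    {a : Matrix ι ι ℝ} (ha : a.IsHermitian) : (a * a).trace = ∑ i, ha.eigenvalues i ^ 2 := by
  have h : a * a = Unitary.conjStarAlgAut ℝ _ ha.eigenvectorUnitary
      (Matrix.diagonal fun i => ha.eigenvalues i ^ 2) := by
    conv_lhs => rw [ha.spectral_theorem, ← map_mul, Matrix.diagonal_mul_diagonal]
    simp only [sq, Function.comp_apply, RCLike.ofReal_real_eq_id, id_eq]
  rw [h, Unitary.conjStarAlgAut_apply, Matrix.trace_mul_cycle, Unitary.coe_star_mul_self,
    Matrix.one_mul, Matrix.trace_diagonal]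

theorem posDef_of_trace_mul_self_lt (hn : n.IsHermitian) (hpos : 0 < n.trace)
    (h : (n * n).trace < n.trace ^ 2 / 2) : n.PosDef := by
  rw [trace_mul_self_eq_sum_eigenvalues_sq hn, hn.trace_eq_sum_eigenvalues] at h
  rw [hn.trace_eq_sum_eigenvalues] at hpos
  rw [hn.posDef_iff_eigenvalues_pos]
  generalize hn.eigenvalues = l at h hpos
  simp only [Fin.sum_univ_three, RCLike.ofReal_real_eq_id, id_eq] at h hpos
  have h01 : 0 < l 0 * l 1 := by nlinarith [sq_nonneg (l 0 + l 1 - l 2)]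
  have h02 : 0 < l 0 * l 2 := by nlinarith [sq_nonneg (l 0 + l 2 - l 1)]
  have h0 : 0 < l 0 := by
    by_contra! h0
    linarith [neg_of_mul_pos_right h01 h0, neg_of_mul_pos_right h02 h0]
  intro i
  fin_cases i
  exacts [h0, pos_of_mul_pos_right h01 h0.le, pos_of_mul_pos_right h02 h0.le]

theorem posDef_adjugate_of_posDef (hn : n.PosDef) : n.adjugate.PosDef := by
  have h := hn.inv.smul hn.det_pos
  rwa [Matrix.inv_def, Ring.inverse_eq_inv', smul_smul, mul_inv_cancel₀ hn.det_pos.ne',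
    one_smul] at h

theorem posDef_adjugate_of_trace_mul_self_lt (hn : n.IsHermitian)
    (h : (n * n).trace < n.trace ^ 2 / 2) : n.adjugate.PosDef := by
  have hnonneg : 0 ≤ (n * n).trace := by
    rw [trace_mul_self_eq_sum_eigenvalues_sq hn]
    exact Finset.sum_nonneg fun _ _ => sq_nonneg _
  rcases lt_trichotomy n.trace 0 with h0 | h0 | h0
  · have hneg : (-n).adjugate = n.adjugate := by
      rw [Matrix.adjugate_fin_three, Matrix.adjugate_fin_three]
      simp
    rw [← hneg]
    exact posDef_adjugate_of_posDef (posDef_of_trace_mul_self_lt hn.neg (by simpa) (by simpa))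
  · rw [h0] at h
    linarith
  · exact posDef_adjugate_of_posDef (posDef_of_trace_mul_self_lt hn h0 h)

theorem transpose_mulVec_crossProduct (M : Mat3) (x y : Fin 3 → ℝ) :
    Mᵀ *ᵥ crossProduct (M *ᵥ x) (M *ᵥ y) = M.det • crossProduct x y := by
  ext i
  fin_cases i <;>
  simp [cross_apply, Matrix.mulVec, dotProduct, Fin.sum_univ_three, Matrix.det_fin_three] <;> ring

theorem isUnit_det_of_posDef_adjugate (hn : n.adjugate.PosDef) : IsUnit n.det := by
  have h := hn.det_pos
  rw [Matrix.det_adjugate, Fintype.card_fin] at h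
  exact isUnit_iff_ne_zero.2 fun h0 => by simp [h0] at h

theorem exists_mulVec_crossProduct (hn : n.adjugate.PosDef) :
    ∃ M : Mat3, IsUnit M.det ∧
      ∀ x y, M *ᵥ (n *ᵥ crossProduct x y) = crossProduct (M *ᵥ x) (M *ᵥ y) := by
  obtain ⟨M, hM, hdet⟩ : ∃ M : Mat3, Mᵀ * M = n.adjugate ∧ M.det = n.det := by
    obtain ⟨Q, hQ⟩ := exists_eq_transpose_mul_self hn.posSemidef
    have h := congrArg Matrix.det hQ
    rw [Matrix.det_mul, Matrix.det_transpose, Matrix.det_adjugate, Fintype.card_fin, ← sq] at h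
    rcases sq_eq_sq_iff_eq_or_eq_neg.1 h.symm with h | h
    · exact ⟨Q, hQ.symm, h⟩
    · exact ⟨-Q, by simp [hQ], by rw [Matrix.det_neg, h, Fintype.card_fin]; norm_num⟩
  have hunit : IsUnit M.det := hdet ▸ isUnit_det_of_posDef_adjugate hn
  refine ⟨M, hunit, fun x y => Matrix.mulVec_injective_of_isUnit (A := Mᵀ) ?_ ?_⟩
  · rwa [Matrix.isUnit_iff_isUnit_det, Matrix.det_transpose]
  · simp only [transpose_mulVec_crossProduct, Matrix.mulVec_mulVec, ← Matrix.mul_assoc, hM,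
      Matrix.adjugate_mul, hdet, Matrix.smul_mulVec, Matrix.one_mulVec]

theorem adVec_changeFrame {ι : Type*} [Fintype ι] [DecidableEq ι] {C : ι → ι → ι → ℝ}
    {P Q : Matrix ι ι ℝ} (hPQ : P * Q = 1) (x : ι → ℝ) :
    adVec (changeFrame C P Q) (Q *ᵥ x) = Q * adVec C x * P := by
  have hx : P *ᵥ Q *ᵥ x = x := by rw [Matrix.mulVec_mulVec, hPQ, Matrix.one_mulVec]
  calc adVec (changeFrame C P Q) (Q *ᵥ x)
      = ∑ j, (P *ᵥ Q *ᵥ x) j • (Q * adMatrix C j * P) := by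
        simp only [adVec, adMatrix_changeFrame, Finset.smul_sum, smul_smul]
        rw [Finset.sum_comm]
        refine Finset.sum_congr rfl fun j _ => ?_
        rw [← Finset.sum_smul]
        simp only [mul_comm _ (P j _)]
        rfl
    _ = Q * adVec C x * P := by
        simp only [hx, adVec, Finset.mul_sum, Finset.sum_mul, Matrix.mul_smul, Matrix.smul_mul]

theorem repr_lie_eq_adVec {L : Type*} [LieRing L] [LieAlgebra ℝ L] (b : Module.Basis (Fin 3) ℝ L)
    (x y : L) : b.repr ⁅x, y⁆ = adVec (structureConstants b) (b.repr x) *ᵥ b.repr y := by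
  ext k
  simp only [repr_lie_eq_sum, adVec, adMatrix, Matrix.mulVec, dotProduct, Matrix.sum_apply,
    Matrix.smul_apply, Matrix.of_apply, smul_eq_mul, Finset.sum_mul]
  rw [Finset.sum_comm]
  simp only [mul_right_comm]

theorem isBianchiIX_of_posDef_adjugate {L : Type*} [LieRing L] [LieAlgebra ℝ L]
    (b : Module.Basis (Fin 3) ℝ L) {P Q : Mat3} (hPQ : P * Q = 1)
    (ha : traceForm (changeFrame (structureConstants b) P Q) = 0)
    (hn : (bianchiMatrix (changeFrame (structureConstants b) P Q)).adjugate.PosDef) :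
    IsBianchiIX L := by
  have hC := (isLieConstants_structureConstants b).skew
  obtain ⟨M, hM, hcross⟩ := exists_mulVec_crossProduct hn
  have hu : IsUnit (M * Q).det := by
    rw [Matrix.det_mul]
    exact hM.mul (Matrix.isUnit_det_of_left_inverse hPQ)
  let f := b.equivFun.trans (Matrix.toLin'OfInv (Matrix.nonsing_inv_mul _ hu)
    (Matrix.mul_nonsing_inv _ hu))
  have hf (z : L) : f z = M *ᵥ (Q *ᵥ b.repr z) := by
    rw [Matrix.mulVec_mulVec]
    rfl
  have hconj (A : Mat3) (y : Fin 3 → ℝ) : (Q * A * P) *ᵥ (Q *ᵥ y) = Q *ᵥ A *ᵥ y := by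
    rw [Matrix.mulVec_mulVec, Matrix.mul_assoc _ P, hPQ, Matrix.mul_one, Matrix.mulVec_mulVec]
  refine ⟨f, fun x y => ?_⟩
  rw [hf, hf, hf, ← hcross, ← adVec_mulVec_eq_bianchiMatrix (changeFrame_skew hC P Q) ha,
    adVec_changeFrame hPQ, hconj, repr_lie_eq_adVec]

theorem scalarCurv_structureConstants_nonpos {L : Type*} [LieRing L] [LieAlgebra ℝ L]
    (b : Module.Basis (Fin 3) ℝ L) (hL : ¬ IsBianchiIX L) {g : Mat3} (hg : g.PosDef) :
    scalarCurv (structureConstants b) g ≤ 0 := by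
  have hC := isLieConstants_structureConstants b
  obtain ⟨P, Q, hf⟩ := exists_isOrthonormalFrame hg
  have hc := hC.changeFrame hf.mul_eq_one
  rw [← scalarCurv_changeFrame hC.skew hf.mul_eq_one, hf.conj_eq_one, scalarCurv_one_eq hc.skew]
  have hsq : 0 ≤ ∑ i, traceForm (changeFrame (structureConstants b) P Q) i ^ 2 :=
    Finset.sum_nonneg fun i _ => sq_nonneg _
  by_contra! hpos
  have hn := posDef_adjugate_of_trace_mul_self_lt
    (isHermitian_bianchiMatrix (c := changeFrame (structureConstants b) P Q)) (by linarith)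
  have ha := Matrix.eq_zero_of_mulVec_eq_zero (isUnit_det_of_posDef_adjugate hn).ne_zero
    (bianchiMatrix_mulVec_traceForm hc)
  exact hL (isBianchiIX_of_posDef_adjugate b hf.mul_eq_one ha hn)

end BianchiClassification

section

variable {ι : Type*} [Fintype ι] {S : Set ℝ} {t : ℝ}

theorem hasDerivWithinAt_dotProduct {x y : ℝ → ι → ℝ} {x' y' : ι → ℝ}
    (hx : HasDerivWithinAt x x' S t) (hy : HasDerivWithinAt y y' S t) :
    HasDerivWithinAt (fun r => x r ⬝ᵥ y r) (x' ⬝ᵥ y t + x t ⬝ᵥ y') S t := by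
  refine (HasDerivWithinAt.fun_sum fun i _ =>
    (hasDerivWithinAt_pi.1 hx i).mul (hasDerivWithinAt_pi.1 hy i)).congr_deriv ?_
  exact Finset.sum_add_distrib

theorem hasDerivWithinAt_mulVec {A : ℝ → Matrix ι ι ℝ} {A' : Matrix ι ι ℝ} {x : ℝ → ι → ℝ}
    {x' : ι → ℝ} (hA : HasDerivWithinAt A A' S t) (hx : HasDerivWithinAt x x' S t) :
    HasDerivWithinAt (fun r => A r *ᵥ x r) (A' *ᵥ x t + A t *ᵥ x') S t :=
  hasDerivWithinAt_pi.2 fun i =>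
    hasDerivWithinAt_dotProduct (hasDerivWithinAt_pi.2 (hasDerivWithinAt_matrix.1 hA i)) hx

end

section

variable {ι : Type*} [Fintype ι] {C : ι → ι → ι → ℝ} {g : Matrix ι ι ℝ}

theorem trace_mul_eq_zero_of_isSymm {A B : Matrix ι ι ℝ} (hA : A.IsSymm) (hB : Bᵀ = -B) :
    (A * B).trace = 0 := by
  have h := Matrix.trace_transpose (A * B)
  rw [Matrix.transpose_mul, hA.eq, hB, Matrix.neg_mul, Matrix.trace_neg, Matrix.trace_mul_comm] at h
  linarith

theorem transpose_sum_smul_bracketMatrix (hC : ∀ k i j, C k i j = -C k j i) (x : ι → ℝ) :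
    (∑ m, x m • bracketMatrix C m)ᵀ = -∑ m, x m • bracketMatrix C m := by
  simp only [Matrix.transpose_sum, Matrix.transpose_smul, transpose_bracketMatrix hC, smul_neg,
    Finset.sum_neg_distrib]

theorem christoffelFirst_torsion (hC : ∀ k i j, C k i j = -C k j i) (hg : g.IsSymm) (k i j : ι) :
    christoffelFirst C g j k i - christoffelFirst C g i k j = (g * adMatrix C i) k j := by
  simp only [christoffelFirst, adMatrix, bracketMatrix, Matrix.smul_apply, Matrix.sub_apply,
    Matrix.sum_apply, Matrix.mul_apply, Matrix.transpose_apply, Matrix.of_apply, smul_eq_mul,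
    ← mul_sub, ← Finset.sum_sub_distrib, Finset.mul_sum]
  refine Finset.sum_congr rfl fun m _ => ?_
  rw [hC m k i, hC m k j, hC m j i, hg.apply m i, hg.apply m j]
  ring

variable [DecidableEq ι]

theorem inv_mul_of_posDef (hg : g.PosDef) : g⁻¹ * g = 1 :=
  Matrix.nonsing_inv_mul _ (isUnit_iff_ne_zero.2 hg.det_pos.ne')

theorem christoffel_torsion (hC : ∀ k i j, C k i j = -C k j i) (hg : g.PosDef) (l i j : ι) :
    christoffel C g j l i - christoffel C g i l j = C l i j := by
  have hg' : g.IsSymm := hg.isHermitian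
  calc christoffel C g j l i - christoffel C g i l j
      = (g⁻¹ * (g * adMatrix C i)) l j := by
        simp only [christoffel, Matrix.mul_apply (M := g⁻¹), ← Finset.sum_sub_distrib, ← mul_sub,
          christoffelFirst_torsion hC hg']
    _ = C l i j := by
        rw [← Matrix.mul_assoc, inv_mul_of_posDef hg, Matrix.one_mul]
        rfl

theorem inv_isSymm (hg : g.PosDef) : (g⁻¹).IsSymm :=
  Matrix.IsSymm.inv (show g.IsSymm from hg.isHermitian)

theorem trace_christoffel_mul (hC : ∀ k i j, C k i j = -C k j i) (hg : g.PosDef)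
    {k : Matrix ι ι ℝ} (hk : k.IsSymm) (j : ι) :
    (christoffel C g j * (g⁻¹ * k)).trace = -(adMatrix C j * (g⁻¹ * k)).trace := by
  have hg' : (g⁻¹)ᵀ = g⁻¹ := inv_isSymm hg
  have hgi := inv_mul_of_posDef hg
  have hskew : (g⁻¹ * (∑ m, g j m • bracketMatrix C m) * (g⁻¹ * k)).trace = 0 := by
    rw [Matrix.trace_mul_cycle, ← trace_mul_eq_zero_of_isSymm (A := g⁻¹ * k * g⁻¹)
      (by rw [Matrix.IsSymm, Matrix.transpose_mul, Matrix.transpose_mul, hg', hk.eq,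
        Matrix.mul_assoc]) (transpose_sum_smul_bracketMatrix hC (g j))]
  have had : (g⁻¹ * ((adMatrix C j)ᵀ * g) * (g⁻¹ * k)).trace
      = (adMatrix C j * (g⁻¹ * k)).trace := by
    calc (g⁻¹ * ((adMatrix C j)ᵀ * g) * (g⁻¹ * k)).trace
        = (g⁻¹ * (adMatrix C j)ᵀ * (g * g⁻¹) * k).trace := by simp only [Matrix.mul_assoc]
      _ = (k * adMatrix C j * g⁻¹).trace := by
        rw [mul_eq_one_comm.1 hgi, Matrix.mul_one, ← Matrix.trace_transpose, Matrix.transpose_mul,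
          Matrix.transpose_mul, Matrix.transpose_transpose, hg', hk.eq, Matrix.mul_assoc]
      _ = (adMatrix C j * (g⁻¹ * k)).trace := by rw [Matrix.mul_assoc, Matrix.trace_mul_comm,
          Matrix.mul_assoc]
  rw [christoffel, christoffelFirst, Matrix.mul_smul, Matrix.smul_mul, Matrix.mul_sub,
    Matrix.mul_sub, Matrix.sub_mul, Matrix.sub_mul, Matrix.trace_smul, Matrix.trace_sub,
    Matrix.trace_sub, hskew, had, ← Matrix.mul_assoc g⁻¹ g, hgi, Matrix.one_mul, smul_eq_mul]
  ring

theorem trace_christoffel (hC : ∀ k i j, C k i j = -C k j i) (hg : g.PosDef) (j : ι) :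
    (christoffel C g j).trace = traceForm C j := by
  have h := trace_christoffel_mul hC hg (show g.IsSymm from hg.isHermitian) j
  rwa [inv_mul_of_posDef hg, Matrix.mul_one, Matrix.mul_one, ← traceForm_eq_neg_trace hC] at h

theorem sum_christoffel_mul_inv (hC : ∀ k i j, C k i j = -C k j i) (hg : g.PosDef) :
    (fun n => ∑ i, (christoffel C g i * g⁻¹) n i) = -(g⁻¹ *ᵥ traceForm C) := by
  have hgi := inv_mul_of_posDef hg
  have hgi' := mul_eq_one_comm.1 hgi
  have hbracket (n : ι) :
      ∑ i, ((∑ m, g i m • bracketMatrix C m) * g⁻¹) n i = -traceForm C n := by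
    calc ∑ i, ((∑ m, g i m • bracketMatrix C m) * g⁻¹) n i
        = ∑ m, (bracketMatrix C m * (g⁻¹ * g)) n m := by
          simp only [Matrix.sum_mul, Matrix.sum_apply, Matrix.smul_mul, Matrix.smul_apply,
            smul_eq_mul, ← Matrix.mul_assoc]
          rw [Finset.sum_comm]
          exact Finset.sum_congr rfl fun m _ => (Finset.sum_congr rfl fun i _ => mul_comm _ _)
      _ = -traceForm C n := by
          simp only [hgi, Matrix.mul_one, bracketMatrix, Matrix.of_apply, traceForm,
            ← Finset.sum_neg_distrib]
          exact Finset.sum_congr rfl fun m _ => hC m n m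
  have had (n : ι) : ∑ i, ((g * adMatrix C i) * g⁻¹) n i = 0 := by
    calc ∑ i, ((g * adMatrix C i) * g⁻¹) n i
        = ∑ a, g n a * (bracketMatrix C a * g⁻¹).trace := by
          simp only [Matrix.mul_assoc g, Matrix.mul_apply (M := g)]
          rw [Finset.sum_comm]
          simp only [← Finset.mul_sum]
          rfl
      _ = 0 := Finset.sum_eq_zero fun a _ => by
          rw [Matrix.trace_mul_comm, trace_mul_eq_zero_of_isSymm (inv_isSymm hg)
            (transpose_bracketMatrix hC a), mul_zero]
  have hfirst : (fun n => ∑ i, (christoffelFirst C g i * g⁻¹) n i) = -traceForm C := by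
    funext n
    have htr : ∑ i, ((adMatrix C i)ᵀ * g * g⁻¹) n i = traceForm C n := by
      simp only [Matrix.mul_assoc, hgi', Matrix.mul_one]
      rfl
    simp only [christoffelFirst, Matrix.smul_mul, Matrix.sub_mul, Matrix.smul_apply,
      Matrix.sub_apply, smul_eq_mul]
    rw [← Finset.mul_sum, Finset.sum_sub_distrib, Finset.sum_sub_distrib, hbracket, had, htr,
      Pi.neg_apply]
    ring
  rw [← Matrix.mulVec_neg, ← hfirst]
  funext n
  simp only [christoffel, Matrix.mul_assoc g⁻¹, Matrix.mulVec, dotProduct,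
    Matrix.mul_apply (M := g⁻¹), Finset.mul_sum]
  exact Finset.sum_comm

end

section

variable {ι : Type*} [Fintype ι] {C : ι → ι → ι → ℝ}

theorem dotProduct_mulVec_self_of_skew {A : Matrix ι ι ℝ} (hA : Aᵀ = -A) (x : ι → ℝ) :
    x ⬝ᵥ A *ᵥ x = 0 := by
  have h : x ⬝ᵥ A *ᵥ x = -(x ⬝ᵥ A *ᵥ x) := by
    conv_lhs => rw [Matrix.dotProduct_mulVec, ← Matrix.mulVec_transpose, hA, Matrix.neg_mulVec,
      neg_dotProduct, dotProduct_comm]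
  linarith

theorem adVec_mulVec_self (hC : ∀ k i j, C k i j = -C k j i) (x : ι → ℝ) :
    adVec C x *ᵥ x = 0 := by
  funext k
  rw [Pi.zero_apply, ← dotProduct_mulVec_self_of_skew (transpose_bracketMatrix hC k) x]
  simp only [adVec, Matrix.sum_mulVec, Matrix.smul_mulVec, Finset.sum_apply, Pi.smul_apply,
    smul_eq_mul]
  rfl

theorem sum_smul_bracketMatrix_mulVec (hC : ∀ k i j, C k i j = -C k j i) (x y : ι → ℝ) :
    (∑ k, y k • bracketMatrix C k) *ᵥ x = -(y ᵥ* adVec C x) := by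
  funext j
  have had (k : ι) : adVec C x k j = -∑ l, C k j l * x l := by
    simp only [adVec, Matrix.sum_apply, Matrix.smul_apply, adMatrix, Matrix.of_apply, smul_eq_mul,
      ← Finset.sum_neg_distrib]
    exact Finset.sum_congr rfl fun l _ => by rw [hC k l j]; ring
  simp only [Matrix.sum_mulVec, Matrix.smul_mulVec, Finset.sum_apply, Pi.smul_apply, Pi.neg_apply,
    Matrix.vecMul, dotProduct, had, mul_neg, Finset.sum_neg_distrib, neg_neg]
  rfl

theorem IsLieConstants.sum_traceForm_smul_bracketMatrix (hC : IsLieConstants C) :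
    ∑ k, traceForm C k • bracketMatrix C k = 0 := by
  ext i j
  have h := congrArg Matrix.trace ((isLieConstants_iff_commutator hC.skew).1 hC i j)
  rw [Matrix.trace_sub, Matrix.trace_mul_comm, sub_self, Matrix.trace_sum] at h
  simp only [Matrix.sum_apply, Matrix.smul_apply, bracketMatrix, Matrix.of_apply,
    traceForm_eq_neg_trace hC.skew, smul_eq_mul, neg_mul, Finset.sum_neg_distrib, Matrix.zero_apply,
    Matrix.trace_smul] at h ⊢
  rw [neg_eq_zero, h]
  exact Finset.sum_congr rfl fun k _ => mul_comm _ _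

theorem divMixed_add (X Y : Matrix ι ι ℝ) : divMixed C (X + Y) = divMixed C X + divMixed C Y := by
  funext j
  simp only [divMixed, Matrix.vecMul_add, Matrix.mul_add, Matrix.trace_add, Pi.add_apply]
  ring

theorem divMixed_smul (a : ℝ) (X : Matrix ι ι ℝ) : divMixed C (a • X) = a • divMixed C X := by
  funext j
  simp only [divMixed, Matrix.vecMul_smul, Matrix.mul_smul, Matrix.trace_smul, Pi.smul_apply,
    smul_add]

theorem divMixed_one [DecidableEq ι] (hC : ∀ k i j, C k i j = -C k j i) :
    divMixed C 1 = 0 := by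
  funext j
  rw [divMixed, Matrix.vecMul_one, Matrix.mul_one, traceForm_eq_neg_trace hC, neg_add_cancel,
    Pi.zero_apply]

theorem divMixed_vecMulVec (hC : ∀ k i j, C k i j = -C k j i) (x y : ι → ℝ) :
    divMixed C (Matrix.vecMulVec x y) = (traceForm C ⬝ᵥ x) • y - y ᵥ* adVec C x := by
  funext j
  have had : adMatrix C j *ᵥ x ⬝ᵥ y = -(y ᵥ* adVec C x) j := by
    rw [← Pi.neg_apply, ← sum_smul_bracketMatrix_mulVec hC, dotProduct_comm]
    simp only [Matrix.sum_mulVec, Matrix.smul_mulVec, Finset.sum_apply, Pi.smul_apply, smul_eq_mul]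
    rfl
  rw [divMixed, Matrix.vecMul_vecMulVec, Matrix.mul_vecMulVec, Matrix.trace_vecMulVec, had]
  rfl

theorem hasDerivWithinAt_divMixed {X : ℝ → Matrix ι ι ℝ} {X' : Matrix ι ι ℝ} {S : Set ℝ} {t : ℝ}
    (hX : HasDerivWithinAt X X' S t) :
    HasDerivWithinAt (fun r => divMixed C (X r)) (divMixed C X') S t := by
  refine hasDerivWithinAt_pi.2 fun j => ?_
  have hX := hasDerivWithinAt_matrix.1 hX
  simp only [divMixed, Matrix.vecMul, dotProduct, Matrix.trace, Matrix.diag_apply,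
    Matrix.mul_apply]
  exact (HasDerivWithinAt.fun_sum fun i _ => (hX i j).const_mul _).add
    (HasDerivWithinAt.fun_sum fun i _ => HasDerivWithinAt.fun_sum fun l _ =>
      (hX l i).const_mul _)

variable [DecidableEq ι] {g : Matrix ι ι ℝ}

theorem sum_smul_christoffel_mulVec_self (hC : ∀ k i j, C k i j = -C k j i) (hg : g.IsSymm)
    (x : ι → ℝ) :
    (∑ j, x j • christoffel C g j) *ᵥ x = -(g⁻¹ *ᵥ ((g *ᵥ x) ᵥ* adVec C x)) := by
  have hfirst : ∑ j, x j • christoffelFirst C g j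
      = (1 / 2 : ℝ) • (∑ m, (g *ᵥ x) m • bracketMatrix C m - (adVec C x)ᵀ * g
          - g * adVec C x) := by
    have hbracket : ∑ j, x j • ∑ m, g j m • bracketMatrix C m
        = ∑ m, (g *ᵥ x) m • bracketMatrix C m := by
      simp only [Finset.smul_sum, smul_smul, Matrix.mulVec, dotProduct, Finset.sum_smul]
      rw [Finset.sum_comm]
      simp only [hg.apply, mul_comm (x _)]
    simp only [christoffelFirst, smul_comm (x _) (1 / 2 : ℝ), ← Finset.smul_sum, smul_sub,
      Finset.sum_sub_distrib, hbracket, adVec, Matrix.transpose_sum, Matrix.transpose_smul,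
      Finset.sum_mul, Finset.mul_sum, Matrix.smul_mul, Matrix.mul_smul]
  have had : ((adVec C x)ᵀ * g) *ᵥ x = (g *ᵥ x) ᵥ* adVec C x := by
    rw [← Matrix.mulVec_mulVec, Matrix.mulVec_transpose]
  have hself : (g * adVec C x) *ᵥ x = 0 := by
    rw [← Matrix.mulVec_mulVec, adVec_mulVec_self hC, Matrix.mulVec_zero]
  simp only [christoffel, ← Matrix.mul_smul, ← Finset.mul_sum]
  rw [hfirst, ← Matrix.mulVec_mulVec, Matrix.smul_mulVec, Matrix.sub_mulVec, Matrix.sub_mulVec,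
    sum_smul_bracketMatrix_mulVec hC, had, hself, ← Matrix.mulVec_neg]
  congr 1
  module

end

namespace State

variable {C : Fin 3 → Fin 3 → Fin 3 → ℝ} {m Λ : ℝ} {s : State}

section Metric

variable (hg : s.g.PosDef)
include hg

theorem g_isSymm : s.g.IsSymm := hg.isHermitian

theorem gi_isSymm : s.gi.IsSymm := inv_isSymm hg

theorem gi_mul_g : s.gi * s.g = 1 := inv_mul_of_posDef hg

theorem g_mul_gi : s.g * s.gi = 1 := mul_eq_one_comm.1 (gi_mul_g hg)

theorem raise_eq (a : Mat3) : Matrix.of (s.raise a) = s.gi * a * s.gi := by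
  ext i j
  simp only [raise, Matrix.of_apply, Matrix.mul_apply, Finset.sum_mul]
  rw [Finset.sum_comm]
  refine Finset.sum_congr rfl fun n _ => Finset.sum_congr rfl fun l _ => ?_
  rw [(gi_isSymm hg).apply n j]
  ring

theorem normSq_eq (a : Mat3) : s.normSq a = (s.gi * a * (s.gi * aᵀ)).trace := by
  rw [← Matrix.mul_assoc, ← raise_eq hg, Matrix.trace_mul_comm]
  exact Finset.sum_comm

theorem sum_gi_mul (a : Mat3) : ∑ i, ∑ j, s.gi i j * a i j = (s.gi * a).trace := by
  rw [Finset.sum_comm]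
  simp only [fun i j => (gi_isSymm hg).apply i j]
  rfl

theorem H_eq : s.H = (s.gi * s.k).trace := sum_gi_mul hg s.k

theorem christoffel_g (hC : ∀ k i j, C k i j = -C k j i) (j : Fin 3) :
    christoffel C s.g j = Matrix.of fun l i => s.conn C l i j := by
  ext l i
  simp only [christoffel, christoffelFirst, conn, bracketMatrix, adMatrix, Matrix.of_apply,
    Matrix.mul_apply, Matrix.smul_apply, Matrix.sub_apply, Matrix.sum_apply, smul_eq_mul,
    Matrix.transpose_apply, Finset.mul_sum, ← Finset.sum_sub_distrib]
  refine Finset.sum_congr rfl fun k _ => Finset.sum_congr rfl fun n _ => ?_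
  rw [(g_isSymm hg).apply i n, hC n i j, gi]
  ring

theorem Ric_eq (hC : ∀ k i j, C k i j = -C k j i) (i j : Fin 3) :
    s.Ric C i j = ricciMatrix C s.g i j := by
  have hconn (l i j) : s.conn C l i j = christoffel C s.g j l i := by
    rw [christoffel_g hg hC, Matrix.of_apply]
  have htrace : ∑ l, ∑ n, christoffel C s.g n l l * christoffel C s.g i n j
      = (traceForm C ᵥ* christoffel C s.g i) j := by
    rw [Finset.sum_comm]
    simp only [← Finset.sum_mul, Matrix.vecMul, dotProduct, ← trace_christoffel hC hg]
    rfl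
  have hquadratic : ∑ l, ∑ n, christoffel C s.g l n j * christoffel C s.g i l n
        + ∑ l, ∑ n, C l n j * christoffel C s.g i n l
      = (christoffel C s.g j * christoffel C s.g i).trace := by
    rw [Finset.sum_comm (f := fun l n => C l n j * _), ← Finset.sum_add_distrib, Matrix.trace,
      ← Matrix.trace, Matrix.trace_mul_comm]
    refine Finset.sum_congr rfl fun l _ => ?_
    rw [← Finset.sum_add_distrib, Matrix.diag_apply, Matrix.mul_apply]
    refine Finset.sum_congr rfl fun n _ => ?_
    rw [← add_mul, ← christoffel_torsion hC hg, add_sub_cancel, mul_comm]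
  simp only [Ric, hconn, Finset.sum_sub_distrib, ricciMatrix, Matrix.of_apply]
  rw [htrace, ← hquadratic, sub_sub]

theorem R_eq (hC : ∀ k i j, C k i j = -C k j i) : s.R C = scalarCurv C s.g := by
  simp only [R, Ric_eq hg hC]
  exact sum_gi_mul hg _

theorem divk_eq (hC : ∀ k i j, C k i j = -C k j i) (hk : s.k.IsSymm) :
    s.divk C = divMixed C (s.gi * s.k) := by
  funext j
  have hconn (l i j) : s.conn C l i j = christoffel C s.g j l i := by
    rw [christoffel_g hg hC, Matrix.of_apply]
  have hcontracted : ∑ i, ∑ l, ∑ n, s.gi i l * (christoffel C s.g i n l * s.k n j)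
      = -(traceForm C ᵥ* (s.gi * s.k)) j := by
    calc ∑ i, ∑ l, ∑ n, s.gi i l * (christoffel C s.g i n l * s.k n j)
        = ∑ i, ∑ n, (christoffel C s.g i * s.gi) n i * s.k n j := by
          refine Finset.sum_congr rfl fun i _ => ?_
          rw [Finset.sum_comm]
          refine Finset.sum_congr rfl fun n _ => ?_
          rw [Matrix.mul_apply, Finset.sum_mul]
          refine Finset.sum_congr rfl fun l _ => ?_
          rw [(gi_isSymm hg).apply l i]
          ring
      _ = ((fun n => ∑ i, (christoffel C s.g i * s.gi) n i) ᵥ* s.k) j := by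
          rw [Finset.sum_comm]
          simp only [Matrix.vecMul, dotProduct, Finset.sum_mul]
      _ = -(traceForm C ᵥ* (s.gi * s.k)) j := by
          rw [gi, sum_christoffel_mul_inv hC hg, ← Matrix.vecMul_transpose, inv_isSymm hg,
            Matrix.neg_vecMul, Matrix.vecMul_vecMul]
          rfl
  have htrace : ∑ i, ∑ l, ∑ n, s.gi i l * (christoffel C s.g j n l * s.k i n)
      = -(adMatrix C j * (s.gi * s.k)).trace := by
    calc ∑ i, ∑ l, ∑ n, s.gi i l * (christoffel C s.g j n l * s.k i n)
        = (s.gi * ((christoffel C s.g j)ᵀ * s.kᵀ)).trace := by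
          simp only [Matrix.trace, Matrix.diag_apply, Matrix.mul_apply, Matrix.transpose_apply,
            Finset.mul_sum]
      _ = (christoffel C s.g j * (s.gi * s.k)).trace := by
          rw [← Matrix.transpose_mul, ← Matrix.trace_transpose, Matrix.transpose_mul,
            Matrix.transpose_transpose, gi_isSymm hg, Matrix.mul_assoc, Matrix.trace_mul_comm,
            Matrix.mul_assoc]
      _ = -(adMatrix C j * (s.gi * s.k)).trace := trace_christoffel_mul hC hg hk j
  simp only [divk, hconn, Finset.mul_sum, mul_sub, mul_neg, Finset.sum_sub_distrib,
    Finset.sum_neg_distrib]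
  rw [hcontracted, htrace]
  simp only [divMixed]
  ring

end Metric

theorem u_dotProduct_uLow_nonneg (hg : s.g.PosDef) : 0 ≤ s.u ⬝ᵥ s.uLow :=
  hg.posSemidef.dotProduct_mulVec_nonneg s.u

theorem u0_sq (hg : s.g.PosDef) : s.u0 ^ 2 = 1 + s.u ⬝ᵥ s.uLow := by
  have hu : ∑ i, ∑ j, s.g i j * s.u i * s.u j = s.u ⬝ᵥ s.uLow := by
    simp only [dotProduct, uLow, Finset.mul_sum, mul_left_comm, mul_assoc]
  rw [u0, hu, Real.sq_sqrt (by linarith [u_dotProduct_uLow_nonneg hg])]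

theorem u0_pos (hg : s.g.PosDef) : 0 < s.u0 := by
  refine (Real.sqrt_nonneg _).lt_of_ne' fun h => ?_
  have h' : s.u0 ^ 2 = 0 := by rw [u0, h, zero_pow two_ne_zero]
  linarith [u0_sq hg, u_dotProduct_uLow_nonneg hg]

end State

namespace State

variable {C : Fin 3 → Fin 3 → Fin 3 → ℝ} {m Λ : ℝ}

section

variable (s : State)

/-- The energy density of the electromagnetic field and the dust. -/
def energyDensity : ℝ := s.τ00 + s.ρ * s.u0 ^ 2

/-- The momentum density of the electromagnetic field and the dust, with the sign for which the
momentum constraint reads `∇^i k_{ij} = 8π J_j`. -/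
def momentumDensity (j : Fin 3) : ℝ := s.ρ * s.u0 * s.uLow j - s.τ0 j

/-- The mixed components of the spatial stress tensor of the electromagnetic field and the dust. -/
def stress : Mat3 := s.gi * (Matrix.of s.τ + s.ρ • Matrix.vecMulVec s.uLow s.uLow)

/-- The spatial part of the Lorentz force on a unit charge, per unit of coordinate time. -/
def lorentzForce : Fin 3 → ℝ := s.ELow + s.u0⁻¹ • s.F *ᵥ s.u

/-- The difference of the two sides of the Hamiltonian constraint. -/
def hamiltonianDefect (C : Fin 3 → Fin 3 → Fin 3 → ℝ) (m Λ : ℝ) : ℝ :=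
  s.R C - s.normSq s.k + s.H ^ 2 - 16 * Real.pi * (s.T00 m + s.energyDensity) - 2 * Λ

/-- The difference of the two sides of the momentum constraint. -/
def momentumDefect (C : Fin 3 → Fin 3 → Fin 3 → ℝ) : Fin 3 → ℝ :=
  divMixed C (s.gi * s.k) - (8 * Real.pi) • s.momentumDensity

/-- The left-hand side of the magnetic constraint. -/
def magneticDefect (C : Fin 3 → Fin 3 → Fin 3 → ℝ) (i j k : Fin 3) : ℝ :=
  ∑ l, (C l i j * s.F k l + C l k i * s.F j l + C l j k * s.F i l)

/-- The left-hand side of the Gauss law. -/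
def gaussDefect (C : Fin 3 → Fin 3 → Fin 3 → ℝ) : ℝ :=
  traceForm C ⬝ᵥ s.E + 4 * Real.pi * (s.e * s.u0)

theorem momentumDensity_eq : s.momentumDensity = s.F *ᵥ s.E + (s.ρ * s.u0) • s.uLow := by
  funext j
  simp only [momentumDensity, τ0, Pi.add_apply, Pi.smul_apply, smul_eq_mul, Matrix.mulVec,
    dotProduct, mul_comm (s.F j _)]
  ring

theorem FRate_eq : Matrix.of (s.FRate C) = ∑ k, s.ELow k • bracketMatrix C k := by
  ext i j
  simp only [FRate, bracketMatrix, Matrix.of_apply, Matrix.sum_apply, Matrix.smul_apply,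
    smul_eq_mul, mul_comm]

theorem densityCoeff_eq :
    s.densityCoeff C = (s.u ⬝ᵥ s.k *ᵥ s.u) / s.u0 ^ 2 + (traceForm C ⬝ᵥ s.u) / s.u0 - s.H := by
  have hk : ∑ i, ∑ j, s.k i j * s.u i * s.u j = s.u ⬝ᵥ s.k *ᵥ s.u := by
    simp only [dotProduct, Matrix.mulVec, Finset.mul_sum, mul_left_comm, mul_assoc]
  have hθ : ∑ i, ∑ j, C i i j * s.u j = traceForm C ⬝ᵥ s.u := by
    rw [Finset.sum_comm]
    simp only [dotProduct, traceForm, Finset.sum_mul]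
  rw [densityCoeff, hk, hθ]

end

variable {s : State} (hg : s.g.PosDef)
include hg

theorem gi_mulVec_uLow : s.gi *ᵥ s.uLow = s.u := by
  rw [show s.uLow = s.g *ᵥ s.u from rfl, Matrix.mulVec_mulVec, gi_mul_g hg, Matrix.one_mulVec]

theorem gi_mulVec_ELow : s.gi *ᵥ s.ELow = s.E := by
  rw [show s.ELow = s.g *ᵥ s.E from rfl, Matrix.mulVec_mulVec, gi_mul_g hg, Matrix.one_mulVec]

theorem transpose_gi_mul_F_mul_gi (hF : s.Fᵀ = -s.F) :
    (s.gi * s.F * s.gi)ᵀ = -(s.gi * s.F * s.gi) := by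
  rw [Matrix.transpose_mul, Matrix.transpose_mul, gi_isSymm hg, hF, Matrix.neg_mul,
    Matrix.mul_neg, Matrix.mul_assoc]

theorem constraints_iff (hC : ∀ k i j, C k i j = -C k j i) (hk : s.k.IsSymm) :
    s.Constraints C m Λ ↔ s.hamiltonianDefect C m Λ = 0 ∧ s.momentumDefect C = 0 ∧
      (∀ i j k, s.magneticDefect C i j k = 0) ∧ s.gaussDefect C = 0 := by
  have hθ : ∑ i, ∑ k, C i i k * s.E k = traceForm C ⬝ᵥ s.E := by
    rw [Finset.sum_comm]
    simp only [dotProduct, traceForm, Finset.sum_mul]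
  have hmom : s.momentumDefect C = 0 ↔
      ∀ j, s.divk C j = -(8 * Real.pi) * (s.τ0 j + s.ρ * (-s.u0) * s.uLow j) := by
    rw [momentumDefect, ← divk_eq hg hC hk, sub_eq_zero, funext_iff]
    refine forall_congr' fun j => ?_
    rw [Pi.smul_apply, smul_eq_mul, momentumDensity,
      show -(8 * Real.pi) * (s.τ0 j + s.ρ * (-s.u0) * s.uLow j)
        = 8 * Real.pi * (s.ρ * s.u0 * s.uLow j - s.τ0 j) by ring]
  constructor
  · rintro ⟨hham, hdiv, hmag, hel⟩
    refine ⟨?_, hmom.2 hdiv, hmag, ?_⟩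
    · rw [hamiltonianDefect, energyDensity]
      linarith
    · rw [gaussDefect, ← hθ, ← mul_assoc, hel]
  · rintro ⟨hham, hdiv, hmag, hel⟩
    refine ⟨?_, hmom.1 hdiv, hmag, ?_⟩
    · rw [hamiltonianDefect, energyDensity] at hham
      linarith
    · rw [hθ, mul_assoc, ← gaussDefect, hel]

theorem ERate_eq (hF : s.Fᵀ = -s.F) :
    s.ERate C = s.H • s.E - traceForm C ᵥ* (s.gi * s.F * s.gi)
      + (1 / 2 : ℝ) • (fun i => (bracketMatrix C i * (s.gi * s.F * s.gi)).trace)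
      + (4 * Real.pi * s.e) • s.u := by
  have hθ (i : Fin 3) : ∑ j, ∑ k, C j j k * s.raise s.F k i
      = (traceForm C ᵥ* (s.gi * s.F * s.gi)) i := by
    rw [Finset.sum_comm, ← raise_eq hg]
    simp only [← Finset.sum_mul]
    rfl
  have hB (i : Fin 3) : ∑ j, ∑ k, C i j k * s.raise s.F j k
      = -(bracketMatrix C i * (s.gi * s.F * s.gi)).trace := by
    rw [← Matrix.trace_neg, ← Matrix.mul_neg, ← transpose_gi_mul_F_mul_gi hg hF,
      ← raise_eq hg]
    rfl
  funext i
  simp only [ERate, hθ, hB, Pi.add_apply, Pi.sub_apply, Pi.smul_apply, smul_eq_mul]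
  ring

theorem g_mulVec_uRate (hC : ∀ k i j, C k i j = -C k j i) (hF : s.Fᵀ = -s.F) :
    s.g *ᵥ s.uRate C = (2 : ℝ) • s.k *ᵥ s.u + s.u0⁻¹ • (s.uLow ᵥ* adVec C s.u)
      - (4 * Real.pi * (s.e / s.ρ)) • s.lorentzForce := by
  have hconn (i : Fin 3) : ∑ j, ∑ k, s.conn C i j k * s.u j * s.u k
      = -(s.gi *ᵥ (s.uLow ᵥ* adVec C s.u)) i := by
    rw [gi, show s.uLow = s.g *ᵥ s.u from rfl, ← Pi.neg_apply,
      ← sum_smul_christoffel_mulVec_self hC (g_isSymm hg), Finset.sum_comm]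
    simp only [christoffel_g hg hC, Matrix.sum_mulVec, Matrix.smul_mulVec, Finset.sum_apply,
      Pi.smul_apply, smul_eq_mul]
    simp only [Matrix.mulVec, dotProduct, Matrix.of_apply, Finset.mul_sum, mul_left_comm, mul_comm]
  have hmagnetic (i : Fin 3) : ∑ j, ∑ l, s.gi i l * s.F j l * s.u j
      = -(s.gi *ᵥ s.F *ᵥ s.u) i := by
    rw [← Pi.neg_apply, ← Matrix.mulVec_neg, ← Matrix.neg_mulVec, ← hF, Finset.sum_comm]
    simp only [Matrix.mulVec, dotProduct, Matrix.transpose_apply, Finset.mul_sum, mul_assoc]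
  have hrate : s.uRate C = (2 : ℝ) • s.gi *ᵥ s.k *ᵥ s.u
      + s.u0⁻¹ • s.gi *ᵥ (s.uLow ᵥ* adVec C s.u)
      - (4 * Real.pi * (s.e / s.ρ)) • (s.E + s.u0⁻¹ • s.gi *ᵥ s.F *ᵥ s.u) := by
    funext i
    rw [Matrix.mulVec_mulVec s.u]
    simp only [uRate, hconn, hmagnetic, Pi.add_apply, Pi.sub_apply, Pi.smul_apply, smul_eq_mul,
      div_eq_mul_inv]
    change 2 * ((s.gi * s.k) *ᵥ s.u) i - _ - _ + _ = _
    ring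
  have hcancel (x : Fin 3 → ℝ) : s.g *ᵥ s.gi *ᵥ x = x := by
    rw [Matrix.mulVec_mulVec, g_mul_gi hg, Matrix.one_mulVec]
  rw [hrate, lorentzForce]
  simp only [Matrix.mulVec_sub, Matrix.mulVec_add, Matrix.mulVec_smul, hcancel]
  rfl

theorem stress_eq (hF : s.Fᵀ = -s.F) :
    s.stress = (1 / 2 * s.ESq - 1 / 4 * s.normSq s.F) • 1 - Matrix.vecMulVec s.E s.ELow
      - s.gi * s.F * (s.gi * s.F) + s.ρ • Matrix.vecMulVec s.u s.uLow := by
  have hτ : Matrix.of s.τ = (1 / 2 * s.ESq - 1 / 4 * s.normSq s.F) • s.g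
      - Matrix.vecMulVec s.ELow s.ELow - s.F * (s.gi * s.F) := by
    ext i j
    have hFF : ∑ k, ∑ l, s.gi k l * s.F i k * s.F j l = -(s.F * (s.gi * s.F)) i j := by
      rw [← Matrix.neg_apply, ← Matrix.mul_neg, ← Matrix.mul_neg, ← hF]
      simp only [Matrix.mul_apply, Matrix.transpose_apply, Finset.mul_sum, mul_assoc, mul_left_comm]
    simp only [τ, hFF, Matrix.of_apply, Matrix.sub_apply, Matrix.smul_apply,
      Matrix.vecMulVec_apply, smul_eq_mul]
    ring
  rw [stress, hτ, Matrix.mul_add, Matrix.mul_sub, Matrix.mul_sub, Matrix.mul_smul, Matrix.mul_smul,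
    Matrix.mul_vecMulVec, Matrix.mul_vecMulVec, gi_mul_g hg, gi_mulVec_uLow hg, gi_mulVec_ELow hg,
    Matrix.mul_assoc]

theorem normSq_F_eq (hF : s.Fᵀ = -s.F) :
    s.normSq s.F = -(s.gi * s.F * (s.gi * s.F)).trace := by
  rw [normSq_eq hg, hF, Matrix.mul_neg, Matrix.mul_neg, Matrix.trace_neg]

theorem normSq_k_eq (hk : s.k.IsSymm) : s.normSq s.k = (s.gi * s.k * (s.gi * s.k)).trace := by
  rw [normSq_eq hg, hk]

theorem trace_vecMulVec_mul_gi_mul_k (x : Fin 3 → ℝ) :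
    (Matrix.vecMulVec x (s.g *ᵥ x) * (s.gi * s.k)).trace = x ⬝ᵥ s.k *ᵥ x := by
  rw [Matrix.vecMulVec_mul, Matrix.trace_vecMulVec, ← Matrix.vecMul_transpose, (g_isSymm hg).eq,
    Matrix.vecMul_vecMul, ← Matrix.mul_assoc, g_mul_gi hg, Matrix.one_mul, dotProduct_comm,
    ← Matrix.dotProduct_mulVec]

theorem trace_stress_mul (hF : s.Fᵀ = -s.F) :
    (s.stress * (s.gi * s.k)).trace = (1 / 2 * s.ESq - 1 / 4 * s.normSq s.F) * s.H
      - s.E ⬝ᵥ s.k *ᵥ s.E - (s.gi * s.k * (s.gi * s.F * (s.gi * s.F))).trace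
      + s.ρ * (s.u ⬝ᵥ s.k *ᵥ s.u) := by
  rw [stress_eq hg hF, Matrix.add_mul, Matrix.sub_mul, Matrix.sub_mul, Matrix.smul_mul,
    Matrix.smul_mul, Matrix.one_mul, Matrix.trace_add, Matrix.trace_sub, Matrix.trace_sub,
    Matrix.trace_smul, Matrix.trace_smul, show s.ELow = s.g *ᵥ s.E from rfl,
    show s.uLow = s.g *ᵥ s.u from rfl, trace_vecMulVec_mul_gi_mul_k hg,
    trace_vecMulVec_mul_gi_mul_k hg, Matrix.trace_mul_comm (s.gi * s.k), ← H_eq hg, smul_eq_mul,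
    smul_eq_mul]

theorem trace_stress (hF : s.Fᵀ = -s.F) : s.stress.trace = s.energyDensity - s.ρ := by
  rw [stress_eq hg hF, Matrix.trace_add, Matrix.trace_sub, Matrix.trace_sub, Matrix.trace_smul,
    Matrix.trace_smul, Matrix.trace_vecMulVec, Matrix.trace_vecMulVec, Matrix.trace_one,
    energyDensity, τ00, u0_sq hg, show s.E ⬝ᵥ s.ELow = s.ESq from rfl, normSq_F_eq hg hF]
  simp only [Fintype.card_fin, smul_eq_mul]
  push_cast
  ring

theorem trace_matterTensor : ∑ l, ∑ n, s.gi l n * (s.T m l n + s.ρ * s.uLow l * s.uLow n)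
    = 3 * (s.U - 1 / 2 * m ^ 2 * s.Φ ^ 2) + s.ρ * (s.u0 ^ 2 - 1) := by
  have hT : (Matrix.of fun l n => s.T m l n + s.ρ * s.uLow l * s.uLow n)
      = (s.U - 1 / 2 * m ^ 2 * s.Φ ^ 2) • s.g + s.ρ • Matrix.vecMulVec s.uLow s.uLow := by
    ext l n
    simp only [T, Matrix.of_apply, Matrix.add_apply, Matrix.smul_apply, Matrix.vecMulVec_apply,
      smul_eq_mul]
    ring
  refine (sum_gi_mul hg (Matrix.of fun l n => s.T m l n + s.ρ * s.uLow l * s.uLow n)).trans ?_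
  rw [hT, Matrix.mul_add, Matrix.mul_smul, Matrix.mul_smul, Matrix.mul_vecMulVec, gi_mul_g hg,
    gi_mulVec_uLow hg, Matrix.trace_add, Matrix.trace_smul, Matrix.trace_smul, Matrix.trace_one,
    Matrix.trace_vecMulVec, u0_sq hg, Fintype.card_fin, smul_eq_mul, smul_eq_mul]
  push_cast
  ring

theorem gi_mul_kRate (hC : ∀ k i j, C k i j = -C k j i) :
    s.gi * Matrix.of (s.kRate C m Λ) = s.gi * ricciMatrix C s.g + s.H • (s.gi * s.k)
      - (2 : ℝ) • (s.gi * s.k * (s.gi * s.k)) - (8 * Real.pi) • s.stress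
      - (4 * Real.pi * (m ^ 2 * s.Φ ^ 2 + s.ρ) + Λ) • 1 := by
  have hrate : Matrix.of (s.kRate C m Λ) = ricciMatrix C s.g + s.H • s.k
      - (2 : ℝ) • (s.k * (s.gi * s.k))
      - (8 * Real.pi) • (Matrix.of s.τ + s.ρ • Matrix.vecMulVec s.uLow s.uLow)
      - (4 * Real.pi * (m ^ 2 * s.Φ ^ 2 + s.ρ) + Λ) • s.g := by
    ext i j
    have hkk : ∑ l, s.kMixed l j * s.k i l = (s.k * (s.gi * s.k)) i j := by
      rw [Matrix.mul_apply]
      exact Finset.sum_congr rfl fun l _ => mul_comm _ _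
    simp only [kRate, trace_matterTensor hg, hkk, Ric_eq hg hC, T00, Matrix.of_apply,
      Matrix.add_apply, Matrix.sub_apply, Matrix.smul_apply, Matrix.vecMulVec_apply, smul_eq_mul]
    rw [T]
    ring
  rw [hrate, stress]
  simp only [Matrix.mul_sub, Matrix.mul_add, Matrix.mul_smul, gi_mul_g hg, Matrix.mul_assoc]

end State

theorem eq_zero_of_linear_ode {E : Type*} [NormedAddCommGroup E] [NormedSpace ℝ E] {y : ℝ → E}
    {f : ℝ → ℝ} (hf : ContinuousOn f (Set.Ici 0))
    (hy : ∀ t, 0 ≤ t → HasDerivWithinAt y (f t • y t) (Set.Ici 0) t) (h0 : y 0 = 0) {t : ℝ}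
    (ht : 0 ≤ t) : y t = 0 := by
  obtain ⟨K, hK⟩ := isCompact_Icc.exists_bound_of_continuousOn
    (hf.mono (Set.Icc_subset_Ici_self : Set.Icc 0 t ⊆ Set.Ici 0))
  refine eq_zero_of_abs_deriv_le_mul_abs_self_of_eq_zero_right (f' := fun r => f r • y r) (K := K)
    (fun r hr => ((hy r hr.1).continuousWithinAt).mono Set.Icc_subset_Ici_self)
    (fun r hr => (hy r hr.1).mono (Set.Ici_subset_Ici.2 hr.1)) h0 (fun r hr => ?_) t ⟨ht, le_rfl⟩
  rw [norm_smul]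
  exact mul_le_mul_of_nonneg_right (hK r ⟨hr.1, hr.2.le⟩) (norm_nonneg _)

theorem eq_initial_of_deriv_zero {E : Type*} [NormedAddCommGroup E] [NormedSpace ℝ E] {y : ℝ → E}
    (hy : ∀ t, 0 ≤ t → HasDerivWithinAt y 0 (Set.Ici 0) t) {t : ℝ} (ht : 0 ≤ t) : y t = y 0 := by
  have h := eq_zero_of_linear_ode (y := fun r => y r - y 0) (f := fun _ => 0) continuousOn_const
    (fun r hr => by simpa using (hy r hr).sub_const (y 0)) (sub_self _) ht
  exact sub_eq_zero.1 h

namespace IsGlobalSolution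

variable {C : Fin 3 → Fin 3 → Fin 3 → ℝ} {m Λ : ℝ} {v : ℝ → State}
  (h : IsGlobalSolution C m Λ v) {t : ℝ} (ht : 0 ≤ t)
include h

theorem F_antisymm (hC : ∀ k i j, C k i j = -C k j i) (h0 : (v 0).Fᵀ = -(v 0).F) {t : ℝ}
    (ht : 0 ≤ t) : (v t).Fᵀ = -(v t).F := by
  ext i j
  have hderiv (r : ℝ) (hr : 0 ≤ r) :
      HasDerivWithinAt (fun r => (v r).F i j + (v r).F j i) 0 (Set.Ici 0) r := by
    refine ((h.F_eq r hr i j).add (h.F_eq r hr j i)).congr_deriv ?_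
    simp only [State.FRate, fun k => hC k i j, neg_mul, Finset.sum_neg_distrib, neg_add_cancel]
  have hinit : (v 0).F j i = -(v 0).F i j := congrFun (congrFun h0 i) j
  have hconst := eq_initial_of_deriv_zero hderiv ht
  simp only [Matrix.transpose_apply, Matrix.neg_apply]
  linarith

include ht

theorem k_symm : (v t).k.IsSymm := by
  refine Matrix.IsSymm.ext fun i j => ?_
  have hji := (h.g_eq t ht j i).congr_of_mem (f₁ := fun r => (v r).g i j)
    (fun r hr => (State.g_isSymm (h.g_posDef r hr)).apply j i) ht
  have heq := (uniqueDiffOn_Ici (0 : ℝ) t ht).eq_deriv _ (h.g_eq t ht i j) hji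
  linarith

theorem g_deriv :
    HasDerivWithinAt (fun r => (v r).g) ((-2 : ℝ) • (v t).k) (Set.Ici 0) t :=
  hasDerivWithinAt_matrix.2 (h.g_eq t ht)

theorem k_deriv :
    HasDerivWithinAt (fun r => (v r).k) (Matrix.of ((v t).kRate C m Λ)) (Set.Ici 0) t :=
  hasDerivWithinAt_matrix.2 (h.k_eq t ht)

theorem E_deriv : HasDerivWithinAt (fun r => (v r).E) ((v t).ERate C) (Set.Ici 0) t :=
  hasDerivWithinAt_pi.2 (h.E_eq t ht)

theorem u_deriv : HasDerivWithinAt (fun r => (v r).u) ((v t).uRate C) (Set.Ici 0) t :=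
  hasDerivWithinAt_pi.2 (h.u_eq t ht)

theorem F_deriv : HasDerivWithinAt (fun r => (v r).F)
    (∑ k, (v t).ELow k • bracketMatrix C k) (Set.Ici 0) t := by
  rw [← State.FRate_eq]
  exact hasDerivWithinAt_matrix.2 (h.F_eq t ht)

theorem gi_deriv : HasDerivWithinAt (fun r => (v r).gi)
    ((2 : ℝ) • ((v t).gi * (v t).k * (v t).gi)) (Set.Ici 0) t := by
  have hderiv := hasDerivWithinAt_matrix_inv (h.g_deriv ht) (h.g_posDef t ht).isUnit
  rwa [Matrix.mul_smul, Matrix.smul_mul, ← neg_smul, neg_neg] at hderiv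

theorem mixed_deriv {A : ℝ → Mat3} {A' : Mat3} (hA : HasDerivWithinAt A A' (Set.Ici 0) t) :
    HasDerivWithinAt (fun r => (v r).gi * A r)
      ((2 : ℝ) • ((v t).gi * (v t).k * ((v t).gi * A t)) + (v t).gi * A') (Set.Ici 0) t := by
  have hderiv := hasDerivWithinAt_matrix_mul (h.gi_deriv ht) hA
  rwa [Matrix.smul_mul, Matrix.mul_assoc _ (v t).gi] at hderiv

theorem kMixed_deriv (hC : ∀ k i j, C k i j = -C k j i) :
    HasDerivWithinAt (fun r => (v r).gi * (v r).k)
      ((v t).gi * ricciMatrix C (v t).g + (v t).H • ((v t).gi * (v t).k)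
        - (8 * Real.pi) • (v t).stress
        - (4 * Real.pi * (m ^ 2 * (v t).Φ ^ 2 + (v t).ρ) + Λ) • 1) (Set.Ici 0) t := by
  have hderiv := h.mixed_deriv ht (h.k_deriv ht)
  rw [State.gi_mul_kRate (h.g_posDef t ht) hC] at hderiv
  convert hderiv using 1
  module

theorem H_deriv (hC : ∀ k i j, C k i j = -C k j i) (hF : (v t).Fᵀ = -(v t).F) :
    HasDerivWithinAt (fun r => (v r).H)
      ((v t).R C + (v t).H ^ 2 - 8 * Real.pi * (v t).energyDensity
        - 12 * Real.pi * m ^ 2 * (v t).Φ ^ 2 - 4 * Real.pi * (v t).ρ - 3 * Λ) (Set.Ici 0) t := by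
  have hg := h.g_posDef t ht
  refine ((hasDerivWithinAt_matrix_trace (h.kMixed_deriv ht hC)).congr_of_mem
    (fun r hr => State.H_eq (h.g_posDef r hr)) ht).congr_deriv ?_
  simp only [Matrix.trace_add, Matrix.trace_sub, Matrix.trace_smul, smul_eq_mul, Matrix.trace_one,
    Fintype.card_fin, State.trace_stress hg hF, ← State.H_eq hg]
  rw [State.R_eq hg hC, scalarCurv, State.gi]
  push_cast
  ring

theorem T00_deriv : HasDerivWithinAt (fun r => (v r).T00 m) (2 * (v t).H * (v t).U)
    (Set.Ici 0) t := by
  refine ((h.U_eq t ht).add (((h.Φ_eq t ht).pow 2).const_mul (1 / 2 * m ^ 2))).congr_deriv ?_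
  rw [State.URate]
  push_cast
  ring

end IsGlobalSolution

namespace IsGlobalSolution

variable {C : Fin 3 → Fin 3 → Fin 3 → ℝ} {m Λ : ℝ} {v : ℝ → State}
  (h : IsGlobalSolution C m Λ v) {t : ℝ} (ht : 0 ≤ t) (hC : ∀ k i j, C k i j = -C k j i)
  (hF : (v t).Fᵀ = -(v t).F)
include h ht

theorem ELow_deriv : HasDerivWithinAt (fun r => (v r).ELow)
    ((-2 : ℝ) • (v t).k *ᵥ (v t).E + (v t).g *ᵥ (v t).ERate C) (Set.Ici 0) t := by
  have hderiv := hasDerivWithinAt_mulVec (h.g_deriv ht) (h.E_deriv ht)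
  rwa [Matrix.smul_mulVec] at hderiv

include hC hF

theorem uLow_deriv : HasDerivWithinAt (fun r => (v r).uLow)
    ((v t).u0⁻¹ • ((v t).uLow ᵥ* adVec C (v t).u)
      - (4 * Real.pi * ((v t).e / (v t).ρ)) • (v t).lorentzForce) (Set.Ici 0) t := by
  refine (hasDerivWithinAt_mulVec (h.g_deriv ht) (h.u_deriv ht)).congr_deriv ?_
  rw [Matrix.smul_mulVec, State.g_mulVec_uRate (h.g_posDef t ht) hC hF]
  module

theorem u_dotProduct_uLow_deriv : HasDerivWithinAt (fun r => (v r).u ⬝ᵥ (v r).uLow)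
    (2 * ((v t).u ⬝ᵥ (v t).k *ᵥ (v t).u
      - 4 * Real.pi * ((v t).e / (v t).ρ) * ((v t).ELow ⬝ᵥ (v t).u))) (Set.Ici 0) t := by
  have hg := h.g_posDef t ht
  refine (hasDerivWithinAt_dotProduct (h.u_deriv ht) (h.uLow_deriv ht hC hF)).congr_deriv ?_
  have hlower : (v t).uRate C ⬝ᵥ (v t).uLow = (v t).u ⬝ᵥ (v t).g *ᵥ (v t).uRate C := by
    rw [Matrix.dotProduct_mulVec, ← Matrix.mulVec_transpose, (State.g_isSymm hg).eq,
      dotProduct_comm]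
    rfl
  have hgeodesic : (v t).u ⬝ᵥ (v t).uLow ᵥ* adVec C (v t).u = 0 := by
    rw [dotProduct_comm, ← Matrix.dotProduct_mulVec, adVec_mulVec_self hC, dotProduct_zero]
  have hforce : (v t).u ⬝ᵥ (v t).lorentzForce = (v t).ELow ⬝ᵥ (v t).u := by
    rw [State.lorentzForce, dotProduct_add, dotProduct_smul, dotProduct_mulVec_self_of_skew hF,
      smul_zero, add_zero, dotProduct_comm]
  rw [hlower, State.g_mulVec_uRate hg hC hF]
  simp only [dotProduct_add, dotProduct_sub, dotProduct_smul, smul_eq_mul, hgeodesic, hforce]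
  ring

theorem u0_deriv : HasDerivWithinAt (fun r => (v r).u0)
    (((v t).u ⬝ᵥ (v t).k *ᵥ (v t).u
      - 4 * Real.pi * ((v t).e / (v t).ρ) * ((v t).ELow ⬝ᵥ (v t).u)) / (v t).u0)
    (Set.Ici 0) t := by
  have hg := h.g_posDef t ht
  have hsq (r : ℝ) (hr : r ∈ Set.Ici (0 : ℝ)) :
      (v r).u0 = √(1 + (v r).u ⬝ᵥ (v r).uLow) := by
    rw [← State.u0_sq (h.g_posDef r hr), Real.sqrt_sq (State.u0_pos (h.g_posDef r hr)).le]
  have hne : 1 + (v t).u ⬝ᵥ (v t).uLow ≠ 0 := by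
    rw [← State.u0_sq hg]
    exact (pow_pos (State.u0_pos hg) 2).ne'
  refine ((((h.u_dotProduct_uLow_deriv ht hC hF).const_add 1).sqrt hne).congr_of_mem
    hsq ht).congr_deriv ?_
  rw [← hsq t ht, mul_div_mul_left _ _ two_ne_zero]

theorem rho_mul_u0_deriv : HasDerivWithinAt (fun r => (v r).ρ * (v r).u0)
    ((v t).ρ * ((v t).H * (v t).u0 - traceForm C ⬝ᵥ (v t).u)) (Set.Ici 0) t := by
  have hρ := h.ρ_ne_zero t ht
  have hu0 := (State.u0_pos (h.g_posDef t ht)).ne'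
  refine ((h.ρ_eq t ht).mul (h.u0_deriv ht hC hF)).congr_deriv ?_
  change State.ρRate C _ * _ + _ = _
  rw [State.ρRate, State.densityCoeff_eq, ← dotProduct]
  field_simp
  ring

theorem e_mul_u0_deriv : HasDerivWithinAt (fun r => (v r).e * (v r).u0)
    ((v t).e * ((v t).H * (v t).u0 - traceForm C ⬝ᵥ (v t).u)) (Set.Ici 0) t := by
  have hρ := h.ρ_ne_zero t ht
  have hu0 := (State.u0_pos (h.g_posDef t ht)).ne'
  refine ((h.e_eq t ht).mul (h.u0_deriv ht hC hF)).congr_deriv ?_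
  rw [State.eRate, State.densityCoeff_eq, ← dotProduct]
  field_simp
  ring

end IsGlobalSolution

section MagneticConstraint

variable {ι : Type*} [Fintype ι] {C : ι → ι → ι → ℝ} {F X : Matrix ι ι ℝ}

theorem two_mul_trace_adMatrix_mul_mul (hC : ∀ k i j, C k i j = -C k j i) (hX : Xᵀ = -X)
    (hF : ∀ i j k, ∑ l, (C l i j * F k l + C l k i * F j l + C l j k * F i l) = 0) (j : ι) :
    2 * (adMatrix C j * (X * F)).trace
      = (F *ᵥ fun i => (bracketMatrix C i * X).trace) j := by
  have hX' (k l : ι) : X k l = -X l k := (neg_eq_iff_eq_neg.2 (congrFun (congrFun hX k) l)).symm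
  have htrace : (adMatrix C j * (X * F)).trace = ∑ l, ∑ k, ∑ n, X l k * (C n j l * F k n) := by
    simp only [Matrix.trace, Matrix.diag_apply, Matrix.mul_apply, adMatrix, Matrix.of_apply,
      Finset.mul_sum]
    rw [Finset.sum_comm]
    refine Finset.sum_congr rfl fun l _ => Finset.sum_comm.trans ?_
    exact Finset.sum_congr rfl fun k _ => Finset.sum_congr rfl fun n _ => by ring
  have hswap : ∑ l, ∑ k, ∑ n, X l k * (C n k j * F l n) = (adMatrix C j * (X * F)).trace := by
    rw [htrace, Finset.sum_comm]
    refine Finset.sum_congr rfl fun k _ => Finset.sum_congr rfl fun l _ =>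
      Finset.sum_congr rfl fun n _ => ?_
    rw [hX' l k, hC n k j]
    ring
  have hbracket : ∑ l, ∑ k, ∑ n, X l k * (C n l k * F j n)
      = -(F *ᵥ fun i => (bracketMatrix C i * X).trace) j := by
    have hB (n : ι) : (bracketMatrix C n * X).trace = -∑ l, ∑ k, C n l k * X l k := by
      simp only [← Finset.sum_neg_distrib, ← mul_neg, ← hX']
      rfl
    simp only [Matrix.mulVec, dotProduct, hB, mul_neg, Finset.sum_neg_distrib, neg_neg,
      Finset.mul_sum]
    refine ((Finset.sum_congr rfl fun l _ => Finset.sum_comm).trans Finset.sum_comm).trans ?_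
    exact Finset.sum_congr rfl fun n _ => Finset.sum_congr rfl fun l _ =>
      Finset.sum_congr rfl fun k _ => by ring
  have hcontract : ∑ l, ∑ k, X l k *
      ∑ n, (C n j l * F k n + C n k j * F l n + C n l k * F j n) = 0 :=
    Finset.sum_eq_zero fun l _ => Finset.sum_eq_zero fun k _ => by rw [hF, mul_zero]
  simp only [Finset.mul_sum, mul_add, Finset.sum_add_distrib] at hcontract
  rw [hswap, hbracket, ← htrace] at hcontract
  linarith

theorem divMixed_mul_of_magnetic (hC : ∀ k i j, C k i j = -C k j i) (hX : Xᵀ = -X)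
    (hF : Fᵀ = -F)
    (hmag : ∀ i j k, ∑ l, (C l i j * F k l + C l k i * F j l + C l j k * F i l) = 0) :
    divMixed C (X * F) = (1 / 2 : ℝ) • (F *ᵥ fun i => (bracketMatrix C i * X).trace)
      - F *ᵥ (traceForm C ᵥ* X) := by
  funext j
  have htrace := two_mul_trace_adMatrix_mul_mul hC hX hmag j
  rw [divMixed, ← Matrix.vecMul_vecMul, ← Matrix.mulVec_transpose, hF, Matrix.neg_mulVec]
  simp only [Pi.sub_apply, Pi.neg_apply, Pi.smul_apply, smul_eq_mul]
  linarith

end MagneticConstraint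

namespace IsGlobalSolution

variable {C : Fin 3 → Fin 3 → Fin 3 → ℝ} {m Λ : ℝ} {v : ℝ → State}
  (h : IsGlobalSolution C m Λ v) {t : ℝ} (ht : 0 ≤ t) (hC : IsLieConstants C)
  (hF : (v t).Fᵀ = -(v t).F)
include h ht hC

theorem magneticDefect_deriv (i j k : Fin 3) : HasDerivWithinAt
    (fun r => (v r).magneticDefect C i j k) 0 (Set.Ici 0) t := by
  refine (HasDerivWithinAt.fun_sum fun l _ =>
    (((h.F_eq t ht k l).const_mul (C l i j)).add ((h.F_eq t ht j l).const_mul (C l k i))).add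
      ((h.F_eq t ht i l).const_mul (C l j k))).congr_deriv ?_
  calc _ = ∑ n, (v t).ELow n *
          ∑ l, (C l i j * C n k l + C l k i * C n j l + C l j k * C n i l) := by
        simp only [State.FRate, Finset.mul_sum, ← Finset.sum_add_distrib]
        rw [Finset.sum_comm]
        exact Finset.sum_congr rfl fun n _ => Finset.sum_congr rfl fun l _ => by ring
    _ = 0 := Finset.sum_eq_zero fun n _ => by rw [hC.jacobi, mul_zero]

include hF

theorem gaussDefect_deriv : HasDerivWithinAt (fun r => (v r).gaussDefect C)
    ((v t).H * (v t).gaussDefect C) (Set.Ici 0) t := by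
  have hg := h.g_posDef t ht
  refine ((hasDerivWithinAt_dotProduct (hasDerivWithinAt_const t _ (traceForm C))
    (h.E_deriv ht)).add ((h.e_mul_u0_deriv ht hC.skew hF).const_mul (4 * Real.pi))).congr_deriv ?_
  have hskew : traceForm C ⬝ᵥ (traceForm C ᵥ* ((v t).gi * (v t).F * (v t).gi)) = 0 := by
    rw [dotProduct_comm, ← Matrix.dotProduct_mulVec,
      dotProduct_mulVec_self_of_skew (State.transpose_gi_mul_F_mul_gi hg hF)]
  have hbracket : traceForm C ⬝ᵥ (fun i =>
      (bracketMatrix C i * ((v t).gi * (v t).F * (v t).gi)).trace) = 0 := by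
    have h0 := congrArg (fun A => (A * ((v t).gi * (v t).F * (v t).gi)).trace)
      hC.sum_traceForm_smul_bracketMatrix
    simpa only [Matrix.sum_mul, Matrix.smul_mul, Matrix.trace_sum, Matrix.trace_smul,
      Matrix.zero_mul, Matrix.trace_zero, smul_eq_mul, dotProduct] using h0
  rw [State.ERate_eq hg hF, State.gaussDefect]
  simp only [zero_dotProduct, dotProduct_add, dotProduct_sub, dotProduct_smul, hskew, hbracket,
    smul_eq_mul]
  ring

theorem momentumDensity_deriv
    (hmag : ∀ i j k, (v t).magneticDefect C i j k = 0) (hel : (v t).gaussDefect C = 0) :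
    HasDerivWithinAt (fun r => (v r).momentumDensity)
      ((v t).H • (v t).momentumDensity - divMixed C (v t).stress) (Set.Ici 0) t := by
  have hg := h.g_posDef t ht
  have hu0 := (State.u0_pos hg).ne'
  have hρ := h.ρ_ne_zero t ht
  simp only [State.momentumDensity_eq]
  refine ((hasDerivWithinAt_mulVec (h.F_deriv ht) (h.E_deriv ht)).add
    ((h.rho_mul_u0_deriv ht hC.skew hF).smul (h.uLow_deriv ht hC.skew hF))).congr_deriv ?_
  have hFE : (v t).F *ᵥ (v t).ERate C = (v t).H • (v t).F *ᵥ (v t).E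
      + divMixed C ((v t).gi * (v t).F * ((v t).gi * (v t).F))
      + (4 * Real.pi * (v t).e) • (v t).F *ᵥ (v t).u := by
    rw [← Matrix.mul_assoc, divMixed_mul_of_magnetic hC.skew
      (State.transpose_gi_mul_F_mul_gi hg hF) hF hmag, State.ERate_eq hg hF]
    simp only [Matrix.mulVec_add, Matrix.mulVec_sub, Matrix.mulVec_smul]
    abel
  have hdiv : divMixed C (v t).stress = -((traceForm C ⬝ᵥ (v t).E) • (v t).ELow
        - (v t).ELow ᵥ* adVec C (v t).E)
      - divMixed C ((v t).gi * (v t).F * ((v t).gi * (v t).F))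
      + (v t).ρ • ((traceForm C ⬝ᵥ (v t).u) • (v t).uLow - (v t).uLow ᵥ* adVec C (v t).u) := by
    rw [State.stress_eq hg hF, sub_eq_add_neg, sub_eq_add_neg, ← neg_one_smul ℝ,
      ← neg_one_smul ℝ (_ * _)]
    simp only [divMixed_add, divMixed_smul, divMixed_one hC.skew, divMixed_vecMulVec hC.skew]
    module
  have hθE : traceForm C ⬝ᵥ (v t).E = -(4 * Real.pi * ((v t).e * (v t).u0)) :=
    eq_neg_of_add_eq_zero_left hel
  rw [hFE, hdiv, hθE, sum_smul_bracketMatrix_mulVec hC.skew, State.lorentzForce]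
  match_scalars <;> field_simp
  ring

end IsGlobalSolution

namespace IsGlobalSolution

variable {C : Fin 3 → Fin 3 → Fin 3 → ℝ} {m Λ : ℝ} {v : ℝ → State}
  (h : IsGlobalSolution C m Λ v) {t : ℝ} (ht : 0 ≤ t) (hC : IsLieConstants C)
  (hF : (v t).Fᵀ = -(v t).F)
include h ht

include hF in
theorem ESq_deriv : HasDerivWithinAt (fun r => (v r).ESq)
    (2 * ((v t).H * (v t).ESq - traceForm C ⬝ᵥ (v t).gi *ᵥ (v t).F *ᵥ (v t).E
      - (v t).E ⬝ᵥ (v t).k *ᵥ (v t).E + 4 * Real.pi * (v t).e * ((v t).ELow ⬝ᵥ (v t).u))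
      + (fun i => (bracketMatrix C i * ((v t).gi * (v t).F * (v t).gi)).trace) ⬝ᵥ (v t).ELow)
    (Set.Ici 0) t := by
  have hg := h.g_posDef t ht
  refine (hasDerivWithinAt_dotProduct (h.E_deriv ht) (h.ELow_deriv ht)).congr_deriv ?_
  have hlower : (v t).E ⬝ᵥ (v t).g *ᵥ (v t).ERate C = (v t).ERate C ⬝ᵥ (v t).ELow := by
    rw [Matrix.dotProduct_mulVec, ← Matrix.mulVec_transpose, (State.g_isSymm hg).eq,
      dotProduct_comm]
    rfl
  have hθ : traceForm C ᵥ* ((v t).gi * (v t).F * (v t).gi) ⬝ᵥ (v t).ELow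
      = traceForm C ⬝ᵥ (v t).gi *ᵥ (v t).F *ᵥ (v t).E := by
    rw [← Matrix.dotProduct_mulVec, ← Matrix.mulVec_mulVec, State.gi_mulVec_ELow hg,
      Matrix.mulVec_mulVec]
  rw [dotProduct_add, hlower, State.ERate_eq hg hF]
  simp only [add_dotProduct, sub_dotProduct, smul_dotProduct, dotProduct_smul, hθ, smul_eq_mul,
    dotProduct_comm (v t).u, show (v t).E ⬝ᵥ (v t).ELow = (v t).ESq from rfl]
  ring

theorem normSq_F_deriv (hF : ∀ t, 0 ≤ t → (v t).Fᵀ = -(v t).F) :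
    HasDerivWithinAt (fun r => (v r).normSq (v r).F)
      (-4 * ((v t).gi * (v t).k * ((v t).gi * (v t).F * ((v t).gi * (v t).F))).trace
        - 2 * ((fun i => (bracketMatrix C i * ((v t).gi * (v t).F * (v t).gi)).trace)
          ⬝ᵥ (v t).ELow)) (Set.Ici 0) t := by
  have hM := h.mixed_deriv ht (h.F_deriv ht)
  refine ((hasDerivWithinAt_matrix_trace (hasDerivWithinAt_matrix_mul hM hM)).neg.congr_of_mem
    (fun r hr => State.normSq_F_eq (h.g_posDef r hr) (hF r hr)) ht).congr_deriv ?_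
  have hbracket : ((v t).gi * (∑ k, (v t).ELow k • bracketMatrix C k)
      * ((v t).gi * (v t).F)).trace
      = (fun i => (bracketMatrix C i * ((v t).gi * (v t).F * (v t).gi)).trace) ⬝ᵥ (v t).ELow := by
    rw [Matrix.mul_assoc, Matrix.trace_mul_comm, Matrix.mul_assoc, Matrix.sum_mul,
      Matrix.trace_sum]
    simp only [Matrix.smul_mul, Matrix.trace_smul, smul_eq_mul, dotProduct, mul_comm]
  rw [Matrix.trace_add, Matrix.trace_mul_comm _ ((2 : ℝ) • _ + _), Matrix.add_mul,
    Matrix.trace_add, hbracket, Matrix.smul_mul, Matrix.trace_smul, smul_eq_mul, Matrix.mul_assoc]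
  ring

include hC

theorem energyDensity_deriv (hF : ∀ t, 0 ≤ t → (v t).Fᵀ = -(v t).F) :
    HasDerivWithinAt (fun r => (v r).energyDensity)
      ((v t).H * (v t).energyDensity + ((v t).stress * ((v t).gi * (v t).k)).trace
        - traceForm C ⬝ᵥ (v t).gi *ᵥ (v t).momentumDensity) (Set.Ici 0) t := by
  have hg := h.g_posDef t ht
  have hu0 := (State.u0_pos hg).ne'
  have hρ := h.ρ_ne_zero t ht
  have hfield := ((h.ESq_deriv ht (hF t ht)).const_mul (1 / 2)).add
    ((h.normSq_F_deriv ht hF).const_mul (1 / 4))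
  have hdust := (h.rho_mul_u0_deriv ht hC.skew (hF t ht)).mul (h.u0_deriv ht hC.skew (hF t ht))
  refine ((hfield.add hdust).congr_of_mem (fun r _ => ?_) ht).congr_deriv ?_
  · simp only [State.energyDensity, State.τ00, Pi.add_apply, Pi.mul_apply]
    ring
  · rw [State.trace_stress_mul hg (hF t ht), State.momentumDensity_eq, Matrix.mulVec_add,
      Matrix.mulVec_smul, State.gi_mulVec_uLow hg, dotProduct_add, dotProduct_smul, smul_eq_mul,
      State.energyDensity, State.τ00]
    field_simp
    ring

theorem momentumDefect_deriv (hF : (v t).Fᵀ = -(v t).F)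
    (hmag : ∀ i j k, (v t).magneticDefect C i j k = 0) (hel : (v t).gaussDefect C = 0) :
    HasDerivWithinAt (fun r => (v r).momentumDefect C) ((v t).H • (v t).momentumDefect C)
      (Set.Ici 0) t := by
  refine ((hasDerivWithinAt_divMixed (h.kMixed_deriv ht hC.skew)).sub
    ((h.momentumDensity_deriv ht hC hF hmag hel).const_smul (8 * Real.pi))).congr_deriv ?_
  simp only [State.momentumDefect, sub_eq_add_neg, ← neg_smul, divMixed_add, divMixed_smul,
    divMixed_one hC.skew]
  rw [State.gi, divMixed_inv_mul_ricciMatrix hC (h.g_posDef t ht)]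
  module

theorem normSq_k_deriv : HasDerivWithinAt (fun r => (v r).normSq (v r).k)
    (2 * (((v t).gi * ricciMatrix C (v t).g * ((v t).gi * (v t).k)).trace
      + (v t).H * (v t).normSq (v t).k
      - 8 * Real.pi * ((v t).stress * ((v t).gi * (v t).k)).trace
      - (4 * Real.pi * (m ^ 2 * (v t).Φ ^ 2 + (v t).ρ) + Λ) * (v t).H)) (Set.Ici 0) t := by
  have hg := h.g_posDef t ht
  have hK := h.kMixed_deriv ht hC.skew
  refine ((hasDerivWithinAt_matrix_trace (hasDerivWithinAt_matrix_mul hK hK)).congr_of_mem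
    (fun r hr => State.normSq_k_eq (h.g_posDef r hr) (h.k_symm hr)) ht).congr_deriv ?_
  rw [Matrix.trace_add, Matrix.trace_mul_comm ((v t).gi * (v t).k), ← two_mul,
    State.normSq_k_eq hg (h.k_symm ht), State.H_eq hg]
  simp only [Matrix.sub_mul, Matrix.add_mul, Matrix.smul_mul, Matrix.one_mul, Matrix.trace_sub,
    Matrix.trace_add, Matrix.trace_smul, smul_eq_mul]

theorem R_deriv : HasDerivWithinAt (fun r => (v r).R C)
    (2 * ((v t).gi * ricciMatrix C (v t).g * ((v t).gi * (v t).k)).trace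
      - 2 * (traceForm C ⬝ᵥ (v t).gi *ᵥ divMixed C ((v t).gi * (v t).k))) (Set.Ici 0) t :=
  (hasDerivWithinAt_scalarCurv hC.skew (h.k_symm ht) (h.g_deriv ht)
    (h.g_posDef t ht)).congr_of_mem (fun r hr => State.R_eq (h.g_posDef r hr) hC.skew) ht

theorem hamiltonianDefect_deriv (hF : ∀ t, 0 ≤ t → (v t).Fᵀ = -(v t).F) :
    HasDerivWithinAt (fun r => (v r).hamiltonianDefect C m Λ)
      (2 * (v t).H * (v t).hamiltonianDefect C m Λ
        - 2 * (traceForm C ⬝ᵥ (v t).gi *ᵥ (v t).momentumDefect C)) (Set.Ici 0) t := by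
  have hmatter := ((h.T00_deriv ht).add (h.energyDensity_deriv ht hC hF)).const_mul
    (16 * Real.pi)
  refine (((((h.R_deriv ht hC).sub (h.normSq_k_deriv ht hC)).add
    ((h.H_deriv ht hC.skew (hF t ht)).pow 2)).sub hmatter).sub_const (2 * Λ)).congr_deriv ?_
  simp only [State.hamiltonianDefect, State.momentumDefect, Matrix.mulVec_sub, Matrix.mulVec_smul,
    dotProduct_sub, dotProduct_smul, smul_eq_mul, State.T00]
  push_cast
  ring

omit ht in
theorem H_continuousOn (hF : ∀ t, 0 ≤ t → (v t).Fᵀ = -(v t).F) :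
    ContinuousOn (fun r => (v r).H) (Set.Ici 0) :=
  fun t ht => (h.H_deriv ht hC.skew (hF t ht)).continuousWithinAt

theorem constraints (hF : ∀ t, 0 ≤ t → (v t).Fᵀ = -(v t).F)
    (h0 : (v 0).Constraints C m Λ) : (v t).Constraints C m Λ := by
  have hiff {r : ℝ} (hr : 0 ≤ r) :=
    State.constraints_iff (m := m) (Λ := Λ) (h.g_posDef r hr) hC.skew (h.k_symm hr)
  obtain ⟨hham₀, hmom₀, hmag₀, hgauss₀⟩ := (hiff le_rfl).1 h0
  have hH := h.H_continuousOn hC hF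
  have hmag (r : ℝ) (hr : 0 ≤ r) (i j k : Fin 3) : (v r).magneticDefect C i j k = 0 :=
    (eq_initial_of_deriv_zero (fun q hq => h.magneticDefect_deriv hq hC i j k) hr).trans
      (hmag₀ i j k)
  have hgauss (r : ℝ) (hr : 0 ≤ r) : (v r).gaussDefect C = 0 :=
    eq_zero_of_linear_ode hH (fun q hq => h.gaussDefect_deriv hq hC (hF q hq)) hgauss₀ hr
  have hmom (r : ℝ) (hr : 0 ≤ r) : (v r).momentumDefect C = 0 :=
    eq_zero_of_linear_ode hH
      (fun q hq => h.momentumDefect_deriv hq hC (hF q hq) (hmag q hq) (hgauss q hq)) hmom₀ hr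
  have hham : (v t).hamiltonianDefect C m Λ = 0 :=
    eq_zero_of_linear_ode (y := fun r => (v r).hamiltonianDefect C m Λ)
      (hH.const_smul (2 : ℝ)) (fun q hq => by
        have hderiv := h.hamiltonianDefect_deriv hq hC hF
        rwa [hmom q hq, Matrix.mulVec_zero, dotProduct_zero, mul_zero, sub_zero] at hderiv)
      hham₀ ht
  exact (hiff ht).2 ⟨hham, hmom t ht, hmag t ht, hgauss t ht⟩

end IsGlobalSolution

section

variable {ι : Type*} [Fintype ι]

theorem sum_sq_eq_trace_mul_transpose (A : Matrix ι ι ℝ) :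
    ∑ i, ∑ j, A i j ^ 2 = (A * Aᵀ).trace := by
  simp only [Matrix.trace, Matrix.diag, Matrix.mul_apply, Matrix.transpose_apply, sq]

theorem sq_dotProduct_mulVec_le_sum_sq (A : Matrix ι ι ℝ) (x y : ι → ℝ) :
    (x ⬝ᵥ A *ᵥ y) ^ 2 ≤ (∑ i, ∑ j, A i j ^ 2) * ((x ⬝ᵥ x) * (y ⬝ᵥ y)) := by
  have hself (z : ι → ℝ) : z ⬝ᵥ z = ∑ i, z i ^ 2 := by simp only [dotProduct, sq]
  have hrows : ∑ i, (A *ᵥ y) i ^ 2 ≤ (∑ i, ∑ j, A i j ^ 2) * (y ⬝ᵥ y) := by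
    rw [Finset.sum_mul, hself]
    exact Finset.sum_le_sum fun i _ => Finset.sum_mul_sq_le_sq_mul_sq _ _ _
  calc (x ⬝ᵥ A *ᵥ y) ^ 2 ≤ (x ⬝ᵥ x) * ∑ i, (A *ᵥ y) i ^ 2 := by
        rw [hself]
        exact Finset.sum_mul_sq_le_sq_mul_sq _ _ _
    _ ≤ (x ⬝ᵥ x) * ((∑ i, ∑ j, A i j ^ 2) * (y ⬝ᵥ y)) :=
        mul_le_mul_of_nonneg_left hrows (by
          rw [hself]
          exact Finset.sum_nonneg fun i _ => sq_nonneg _)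
    _ = _ := by ring

theorem dotProduct_mulVec_self_nonneg {A : Matrix ι ι ℝ} (hA : A.PosSemidef) (x : ι → ℝ) :
    0 ≤ x ⬝ᵥ A *ᵥ x := by
  simpa using hA.dotProduct_mulVec_nonneg x

theorem apply_self_le_trace {A : Matrix ι ι ℝ} (hA : A.PosSemidef) (i : ι) : A i i ≤ A.trace :=
  Finset.single_le_sum (f := fun l => A l l) (fun _ _ => hA.diag_nonneg) (Finset.mem_univ i)

theorem apply_self_mul_le_sq_trace {A : Matrix ι ι ℝ} (hA : A.PosSemidef) (i j : ι) :
    A i i * A j j ≤ A.trace ^ 2 := by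
  rw [sq]
  exact mul_le_mul (apply_self_le_trace hA i) (apply_self_le_trace hA j) hA.diag_nonneg
    hA.trace_nonneg

variable [DecidableEq ι]

/-- The squared norm `g^{ik} g^{jl} A_{ij} A_{kl}` of a tensor with respect to a metric. -/
def tensorNormSq (g A : Matrix ι ι ℝ) : ℝ := (g⁻¹ * A * (g⁻¹ * Aᵀ)).trace

theorem dotProduct_mulVec_self_le_norm (A : Matrix ι ι ℝ) (x : EuclideanSpace ℝ ι) :
    x.ofLp ⬝ᵥ A *ᵥ x.ofLp ≤ ‖Matrix.toEuclideanCLM (n := ι) (𝕜 := ℝ) A‖ * ‖x‖ ^ 2 := by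
  rw [← Matrix.inner_toEuclideanCLM]
  calc _ ≤ ‖x‖ * (‖Matrix.toEuclideanCLM (n := ι) (𝕜 := ℝ) A‖ * ‖x‖) :=
        (real_inner_le_norm _ _).trans
          (mul_le_mul_of_nonneg_left (ContinuousLinearMap.le_opNorm _ _) (norm_nonneg _))
    _ = _ := by ring

namespace IsOrthonormalFrame

variable {g P Q : Matrix ι ι ℝ} (hf : IsOrthonormalFrame g P Q)
include hf

theorem dotProduct_mulVec_eq (A : Matrix ι ι ℝ) (x y : ι → ℝ) :
    x ⬝ᵥ A *ᵥ y = (Q *ᵥ x) ⬝ᵥ (Pᵀ * A * P) *ᵥ (Q *ᵥ y) := by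
  have hA : Qᵀ * (Pᵀ * A * P * Q) = A := by
    rw [Matrix.mul_assoc, hf.mul_eq_one, Matrix.mul_one, ← Matrix.mul_assoc,
      transpose_mul_transpose_eq_one hf.mul_eq_one, Matrix.one_mul]
  conv_lhs => rw [← hA]
  rw [Matrix.mulVec_mulVec, ← Matrix.mulVec_mulVec, Matrix.dotProduct_mulVec,
    Matrix.vecMul_transpose]

theorem dotProduct_metric_mulVec_eq (x y : ι → ℝ) :
    x ⬝ᵥ g *ᵥ y = (Q *ᵥ x) ⬝ᵥ (Q *ᵥ y) := by
  rw [hf.dotProduct_mulVec_eq, hf.conj_eq_one, Matrix.one_mulVec]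

theorem tensorNormSq_eq (A : Matrix ι ι ℝ) :
    tensorNormSq g A = ∑ a, ∑ b, (Pᵀ * A * P) a b ^ 2 := by
  rw [sum_sq_eq_trace_mul_transpose, tensorNormSq, hf.inv_eq,
    show P * Pᵀ * A * (P * Pᵀ * Aᵀ) = P * (Pᵀ * A * P * (Pᵀ * Aᵀ)) by
      simp only [Matrix.mul_assoc], Matrix.trace_mul_comm]
  simp only [Matrix.transpose_mul, Matrix.transpose_transpose, Matrix.mul_assoc]

end IsOrthonormalFrame

section Metric

variable {g : Matrix ι ι ℝ} (hg : g.PosDef)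
include hg

theorem tensorNormSq_nonneg (A : Matrix ι ι ℝ) : 0 ≤ tensorNormSq g A := by
  obtain ⟨P, Q, hf⟩ := exists_isOrthonormalFrame hg
  rw [hf.tensorNormSq_eq]
  exact Finset.sum_nonneg fun a _ => Finset.sum_nonneg fun b _ => sq_nonneg _

theorem sq_dotProduct_mulVec_le_tensorNormSq (A : Matrix ι ι ℝ) (x y : ι → ℝ) :
    (x ⬝ᵥ A *ᵥ y) ^ 2 ≤ tensorNormSq g A * ((x ⬝ᵥ g *ᵥ x) * (y ⬝ᵥ g *ᵥ y)) := by
  obtain ⟨P, Q, hf⟩ := exists_isOrthonormalFrame hg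
  rw [hf.dotProduct_mulVec_eq, hf.dotProduct_metric_mulVec_eq, hf.dotProduct_metric_mulVec_eq,
    hf.tensorNormSq_eq]
  exact sq_dotProduct_mulVec_le_sum_sq _ _ _

omit [DecidableEq ι] in
theorem sq_dotProduct_metric_mulVec_le (x y : ι → ℝ) :
    (x ⬝ᵥ g *ᵥ y) ^ 2 ≤ (x ⬝ᵥ g *ᵥ x) * (y ⬝ᵥ g *ᵥ y) := by
  classical
  obtain ⟨P, Q, hf⟩ := exists_isOrthonormalFrame hg
  simp only [hf.dotProduct_metric_mulVec_eq]
  simp only [dotProduct, ← sq]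
  exact Finset.sum_mul_sq_le_sq_mul_sq _ _ _

theorem metric_mulVec_inv_col (i : ι) : g *ᵥ g⁻¹ *ᵥ Pi.single i 1 = Pi.single i 1 := by
  rw [Matrix.mulVec_mulVec, mul_eq_one_comm.1 (inv_mul_of_posDef hg), Matrix.one_mulVec]

theorem inv_col_dotProduct (i : ι) (x : ι → ℝ) : (g⁻¹ *ᵥ Pi.single i 1) ⬝ᵥ x = (g⁻¹ *ᵥ x) i := by
  rw [← Matrix.vecMul_transpose, (inv_isSymm hg).eq, ← Matrix.dotProduct_mulVec,
    single_one_dotProduct]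

theorem sq_apply_le_inv_mul (x : ι → ℝ) (i : ι) : x i ^ 2 ≤ g⁻¹ i i * (x ⬝ᵥ g *ᵥ x) := by
  have h := sq_dotProduct_metric_mulVec_le hg (g⁻¹ *ᵥ Pi.single i 1) x
  rw [metric_mulVec_inv_col hg, inv_col_dotProduct hg, inv_col_dotProduct hg, Matrix.mulVec_mulVec,
    inv_mul_of_posDef hg, Matrix.one_mulVec, Matrix.mulVec_single_one] at h
  exact h

theorem abs_apply_le_sqrt_tensorNormSq_mul_trace (A : Matrix ι ι ℝ) (i j : ι) :
    |A i j| ≤ √(tensorNormSq g A) * g.trace := by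
  refine abs_le_of_sq_le_sq ?_ (mul_nonneg (Real.sqrt_nonneg _) hg.posSemidef.trace_nonneg)
  have h := sq_dotProduct_mulVec_le_tensorNormSq hg A (Pi.single i 1) (Pi.single j 1)
  simp only [Matrix.mulVec_single_one, single_one_dotProduct, Matrix.col_apply] at h
  rw [mul_pow, Real.sq_sqrt (tensorNormSq_nonneg hg A)]
  exact h.trans (mul_le_mul_of_nonneg_left (apply_self_mul_le_sq_trace hg.posSemidef i j)
    (tensorNormSq_nonneg hg A))

theorem tensorNormSq_inv (A : Matrix ι ι ℝ) :
    tensorNormSq g⁻¹ (g⁻¹ * A * g⁻¹) = tensorNormSq g A := by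
  have hgg := inv_mul_of_posDef hg
  rw [tensorNormSq, tensorNormSq, Matrix.nonsing_inv_nonsing_inv _ hg.det_pos.ne'.isUnit,
    Matrix.transpose_mul, Matrix.transpose_mul, (inv_isSymm hg).eq, Matrix.trace_mul_comm,
    show g * (g⁻¹ * (Aᵀ * g⁻¹)) * (g * (g⁻¹ * A * g⁻¹))
        = (g * g⁻¹) * Aᵀ * (g⁻¹ * g) * (g⁻¹ * A * g⁻¹)
      by simp only [Matrix.mul_assoc], hgg, mul_eq_one_comm.1 hgg, Matrix.one_mul, Matrix.mul_one,
    ← Matrix.mul_assoc, Matrix.trace_mul_comm _ g⁻¹, Matrix.trace_mul_comm (g⁻¹ * A)]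
  simp only [Matrix.mul_assoc]

theorem norm_toEuclideanCLM_le (A : Matrix ι ι ℝ) :
    ‖Matrix.toEuclideanCLM (n := ι) (𝕜 := ℝ) A‖
      ≤ √(tensorNormSq g A) * ‖Matrix.toEuclideanCLM (n := ι) (𝕜 := ℝ) g‖ := by
  refine ContinuousLinearMap.opNorm_le_of_re_inner_le (by positivity) fun x y hx hy => ?_
  rw [real_inner_comm, Matrix.inner_toEuclideanCLM]
  set b := ‖Matrix.toEuclideanCLM (n := ι) (𝕜 := ℝ) g‖
  have hgx : x.ofLp ⬝ᵥ g *ᵥ x.ofLp ≤ b := by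
    simpa only [hx, one_pow, mul_one] using dotProduct_mulVec_self_le_norm g x
  have hgy : y.ofLp ⬝ᵥ g *ᵥ y.ofLp ≤ b := by
    simpa only [hy, one_pow, mul_one] using dotProduct_mulVec_self_le_norm g y
  have hx0 := dotProduct_mulVec_self_nonneg hg.posSemidef x.ofLp
  have hA0 := tensorNormSq_nonneg hg A
  refine (le_abs_self _).trans (abs_le_of_sq_le_sq ?_ (by positivity))
  calc (y.ofLp ⬝ᵥ A *ᵥ x.ofLp) ^ 2
      ≤ tensorNormSq g A * ((y.ofLp ⬝ᵥ g *ᵥ y.ofLp) * (x.ofLp ⬝ᵥ g *ᵥ x.ofLp)) :=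
        sq_dotProduct_mulVec_le_tensorNormSq hg A _ _
    _ ≤ tensorNormSq g A * (b * b) := by gcongr
    _ = (√(tensorNormSq g A) * b) ^ 2 := by rw [mul_pow, Real.sq_sqrt hA0, sq b]

end Metric

end

section

theorem hasDerivWithinAt_exp_mul (c t : ℝ) (S : Set ℝ) :
    HasDerivWithinAt (fun r => Real.exp (c * r)) (c * Real.exp (c * t)) S t :=
  (((hasDerivAt_id t).const_mul c).exp.congr_deriv (by simp [mul_comm])).hasDerivWithinAt

theorem exp_mul_mul_exp_neg_mul (c t : ℝ) : Real.exp (c * t) * Real.exp (-c * t) = 1 := by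
  rw [← Real.exp_add, neg_mul, add_neg_cancel, Real.exp_zero]

theorem tendsto_exp_neg_mul {γ : ℝ} (hγ : 0 < γ) :
    Tendsto (fun t => Real.exp (-γ * t)) atTop (𝓝 0) :=
  Real.tendsto_exp_atBot.comp (tendsto_id.const_mul_atTop_of_neg (neg_neg_of_pos hγ))

theorem isBigO_exp_mul_of_le {a b : ℝ} (hab : a ≤ b) :
    (fun t => Real.exp (a * t)) =O[𝓟 (Set.Ici 0)] fun t => Real.exp (b * t) :=
  isBigO_principal.2 ⟨1, fun t ht => by
    rw [one_mul, Real.norm_of_nonneg (Real.exp_pos _).le, Real.norm_of_nonneg (Real.exp_pos _).le]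
    exact Real.exp_le_exp.2 (mul_le_mul_of_nonneg_right hab ht)⟩

theorem isBigO_exp_mul_one {c : ℝ} (hc : c ≤ 0) :
    (fun t => Real.exp (c * t)) =O[𝓟 (Set.Ici 0)] fun _ => (1 : ℝ) :=
  (isBigO_exp_mul_of_le hc).congr_right fun t => by rw [zero_mul, Real.exp_zero]

theorem isBigO_principal_Ici_of_isBigO_atTop {E F : Type*} [NormedAddCommGroup E]
    [NormedAddCommGroup F] {f : ℝ → E} {w : ℝ → F} {a : ℝ} (hf : ContinuousOn f (Set.Ici a))
    (hw : ContinuousOn w (Set.Ici a)) (hw0 : ∀ t, a ≤ t → w t ≠ 0) (h : f =O[atTop] w) :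
    f =O[𝓟 (Set.Ici a)] w := by
  obtain ⟨c, hc⟩ := h.bound
  obtain ⟨T, hT⟩ := eventually_atTop.1 hc
  have hcompact : f =O[𝓟 (Set.Icc a T)] w :=
    ((hf.mono Set.Icc_subset_Ici_self).isBigO_principal isCompact_Icc (c := (1 : ℝ))
      (by simp)).trans ((hw.mono Set.Icc_subset_Ici_self).isBigO_rev_principal isCompact_Icc
        (fun t ht => hw0 t ht.1) 1)
  refine (hcompact.sup (isBigO_principal.2 ⟨c, hT⟩ : f =O[𝓟 (Set.Ici T)] w)).mono ?_
  rw [sup_principal, principal_mono]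
  exact fun t ht => (le_total t T).imp (fun htT => ⟨ht, htT⟩) id

theorem pos_of_ne_zero {f : ℝ → ℝ} {a t : ℝ} (hf : ContinuousOn f (Set.Ici a))
    (hne : ∀ t, a ≤ t → f t ≠ 0) (ha : 0 < f a) (ht : a ≤ t) : 0 < f t := by
  by_contra! hle
  obtain ⟨s, hs, hs0⟩ := intermediate_value_Icc' ht (hf.mono Set.Icc_subset_Ici_self) ⟨hle, ha.le⟩
  exact hne s hs.1 hs0

theorem le_of_deriv_nonpos {f f' : ℝ → ℝ} {c a b : ℝ} (ha : c ≤ a) (hab : a ≤ b)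
    (hf : ∀ t, c ≤ t → HasDerivWithinAt f (f' t) (Set.Ici c) t) (h : ∀ t, a ≤ t → f' t ≤ 0) :
    f b ≤ f a :=
  antitoneOn_of_hasDerivWithinAt_nonpos (f' := f') (convex_Ici a)
    (fun t ht => (hf t (ha.trans ht)).continuousWithinAt.mono (Set.Ici_subset_Ici.2 ha))
    (fun t ht => (hf t (ha.trans (interior_subset ht))).mono
      (interior_subset.trans (Set.Ici_subset_Ici.2 ha)))
    (fun t ht => h t (interior_subset ht)) Set.self_mem_Ici hab hab

theorem le_mul_exp_of_deriv_le {y y' : ℝ → ℝ} {c a b κ : ℝ} (ha : c ≤ a) (hab : a ≤ b)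
    (hy : ∀ t, c ≤ t → HasDerivWithinAt y (y' t) (Set.Ici c) t)
    (h : ∀ t, a ≤ t → y' t ≤ κ * y t) : y b ≤ y a * Real.exp (-κ * a) * Real.exp (κ * b) := by
  have hle : y b * Real.exp (-κ * b) ≤ y a * Real.exp (-κ * a) := by
    refine le_of_deriv_nonpos ha hab
      (fun t ht => (hy t ht).mul (hasDerivWithinAt_exp_mul (-κ) t _)) fun t ht => ?_
    have := mul_le_mul_of_nonneg_right (h t ht) (Real.exp_pos (-κ * t)).le
    linarith
  calc y b = y b * Real.exp (-κ * b) * Real.exp (κ * b) := by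
        rw [mul_assoc, mul_comm (Real.exp _), exp_mul_mul_exp_neg_mul, mul_one]
    _ ≤ _ := mul_le_mul_of_nonneg_right hle (Real.exp_pos _).le

end

section

variable {E : Type*} [NormedAddCommGroup E] [NormedSpace ℝ E] {X X' : ℝ → E} {K γ : ℝ}

theorem exists_limit_of_norm_deriv_le [CompleteSpace E] (hγ : 0 < γ)
    (hX : ∀ t, 0 ≤ t → HasDerivWithinAt X (X' t) (Set.Ici 0) t)
    (h : ∀ t, 0 ≤ t → ‖X' t‖ ≤ K * Real.exp (-γ * t)) :
    ∃ l, ∀ t, 0 ≤ t → ‖X t - l‖ ≤ K / γ * Real.exp (-γ * t) := by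
  have hK : 0 ≤ K := by simpa using (norm_nonneg _).trans (h 0 le_rfl)
  have hdist (s t : ℝ) (hs : 0 ≤ s) (hst : s ≤ t) :
      ‖X t - X s‖ ≤ K / γ * Real.exp (-γ * s) := by
    have hbound := image_norm_le_of_norm_deriv_right_le_deriv_boundary (f := fun r => X r - X s)
      (B := fun r => K / γ * (Real.exp (-γ * s) - Real.exp (-γ * r)))
      (B' := fun r => K * Real.exp (-γ * r))
      (fun r hr => ((hX r (hs.trans hr.1)).continuousWithinAt.sub continuousWithinAt_const).mono
        (Set.Icc_subset_Ici_self.trans (Set.Ici_subset_Ici.2 hs)))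
      (fun r hr => ((hX r (hs.trans hr.1)).mono
        (Set.Ici_subset_Ici.2 (hs.trans hr.1))).sub_const _)
      (by simp)
      (fun r => (((((hasDerivWithinAt_exp_mul (-γ) r Set.univ).const_sub _).const_mul
        (K / γ)).congr_deriv (by field_simp)).hasDerivAt univ_mem))
      (fun r hr => h r (hs.trans hr.1)) ⟨hst, le_rfl⟩
    refine hbound.trans (mul_le_mul_of_nonneg_left ?_ (by positivity))
    linarith [Real.exp_pos (-γ * t)]
  have hcauchy : CauchySeq fun n : ℕ => X n := by
    refine cauchySeq_of_le_tendsto_0' (fun n : ℕ => K / γ * Real.exp (-γ * n))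
      (fun n k hnk => ?_) ?_
    · rw [dist_comm, dist_eq_norm]
      exact hdist n k n.cast_nonneg (Nat.cast_le.2 hnk)
    · simpa using ((tendsto_exp_neg_mul hγ).comp tendsto_natCast_atTop_atTop).const_mul (K / γ)
  obtain ⟨l, hl⟩ := cauchySeq_tendsto_of_complete hcauchy
  refine ⟨l, fun t ht => le_of_tendsto (tendsto_const_nhds.sub hl).norm ?_⟩
  filter_upwards [tendsto_natCast_atTop_atTop.eventually_ge_atTop t] with n hn
  rw [norm_sub_rev]
  exact hdist t n ht hn

theorem norm_le_of_relative_deriv_le (hγ : 0 < γ) (hK : 0 ≤ K)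
    (hX : ∀ t, 0 ≤ t → HasDerivWithinAt X (X' t) (Set.Ici 0) t)
    (h : ∀ t, 0 ≤ t → ‖X' t‖ ≤ K * Real.exp (-γ * t) * ‖X t‖) {t : ℝ} (ht : 0 ≤ t) :
    ‖X t‖ ≤ (‖X 0‖ + 1) * Real.exp ((K + 1) / γ) := by
  -- `B' = (K + 1) e^{-γt} B`, strictly faster than the growth allowed to `‖X‖`.
  set B := fun r => (‖X 0‖ + 1) * Real.exp ((K + 1) / γ * (1 - Real.exp (-γ * r))) with hB
  have hB_pos (r : ℝ) : 0 < B r := by positivity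
  have hB_deriv (r : ℝ) : HasDerivAt B ((K + 1) * Real.exp (-γ * r) * B r) r := by
    have h1 := (((hasDerivWithinAt_exp_mul (-γ) r Set.univ).const_sub 1).const_mul
      ((K + 1) / γ)).exp.const_mul (‖X 0‖ + 1)
    refine (h1.congr_deriv ?_).hasDerivAt univ_mem
    simp only [hB]
    field_simp
  have hle : ‖X t‖ ≤ B t := image_norm_le_of_norm_deriv_right_lt_deriv_boundary
    (fun r hr => (hX r hr.1).continuousWithinAt.mono Set.Icc_subset_Ici_self)
    (fun r hr => (hX r hr.1).mono (Set.Ici_subset_Ici.2 hr.1)) (by simp [hB]) hB_deriv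
    (fun r hr hrB => by
      refine (h r hr.1).trans_lt ?_
      rw [hrB]
      have := hB_pos r
      gcongr
      linarith) ⟨ht, le_rfl⟩
  refine hle.trans (mul_le_mul_of_nonneg_left (Real.exp_le_exp.2 ?_) (by positivity))
  exact mul_le_of_le_one_right (by positivity) (by linarith [Real.exp_pos (-γ * t)])

theorem exists_limit_of_relative_deriv_le [CompleteSpace E] (hγ : 0 < γ) (hK : 0 ≤ K)
    (hX : ∀ t, 0 ≤ t → HasDerivWithinAt X (X' t) (Set.Ici 0) t)
    (h : ∀ t, 0 ≤ t → ‖X' t‖ ≤ K * Real.exp (-γ * t) * ‖X t‖) :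
    ∃ l, (fun t => X t - l) =O[𝓟 (Set.Ici 0)] fun t => Real.exp (-γ * t) := by
  set M := (‖X 0‖ + 1) * Real.exp ((K + 1) / γ)
  obtain ⟨l, hl⟩ := exists_limit_of_norm_deriv_le (K := K * M) hγ hX fun t ht =>
    calc ‖X' t‖ ≤ K * Real.exp (-γ * t) * ‖X t‖ := h t ht
      _ ≤ K * Real.exp (-γ * t) * M := by
          gcongr
          exact norm_le_of_relative_deriv_le hγ hK hX h ht
      _ = K * M * Real.exp (-γ * t) := by ring
  refine ⟨l, isBigO_principal.2 ⟨K * M / γ, fun t ht => ?_⟩⟩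
  rw [Real.norm_of_nonneg (Real.exp_pos _).le]
  exact hl t ht

end

namespace State

variable {C : Fin 3 → Fin 3 → Fin 3 → ℝ} {m Λ : ℝ} {s : State}

theorem H_sq_eq : s.H ^ 2 = s.Q m Λ + 24 * Real.pi * s.U
    + 3 * (Λ + 4 * Real.pi * m ^ 2 * s.Φ ^ 2) := by
  rw [Q, T00]
  ring

variable (hg : s.g.PosDef)
include hg

theorem normSq_nonneg (a : Mat3) : 0 ≤ s.normSq a := by
  rw [normSq_eq hg]
  exact tensorNormSq_nonneg hg a

theorem ESq_nonneg : 0 ≤ s.ESq := hg.posSemidef.dotProduct_mulVec_nonneg s.E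

theorem τ00_nonneg : 0 ≤ s.τ00 := by
  have hE := ESq_nonneg hg
  have hF := normSq_nonneg hg s.F
  rw [τ00]
  positivity

theorem normSq_σ (hk : s.k.IsSymm) : s.normSq s.σ = s.normSq s.k - s.H ^ 2 / 3 := by
  have hσ : s.gi * s.σ = s.gi * s.k - (s.H / 3) • 1 := by
    rw [σ, Matrix.mul_sub, Matrix.mul_smul, gi_mul_g hg]
  have hσt : s.σᵀ = s.σ := by
    rw [σ, Matrix.transpose_sub, Matrix.transpose_smul, hk.eq, (g_isSymm hg).eq]
  rw [normSq_eq hg, hσt, hσ, normSq_k_eq hg hk]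
  simp only [Matrix.sub_mul, Matrix.mul_sub, Matrix.smul_mul, Matrix.mul_smul, Matrix.one_mul,
    Matrix.mul_one, Matrix.trace_sub, Matrix.trace_smul, ← H_eq hg, Matrix.trace_one,
    Fintype.card_fin, smul_eq_mul]
  push_cast
  ring

theorem Constraints.Q_eq (hk : s.k.IsSymm) (hc : s.Constraints C m Λ) :
    s.Q m Λ = 24 * Real.pi * s.energyDensity + 3 / 2 * s.normSq s.σ - 3 / 2 * s.R C := by
  rw [normSq_σ hg hk, Q, energyDensity]
  linarith [hc.hamiltonian]

end State

theorem IsGlobalSolution.Q_deriv {C : Fin 3 → Fin 3 → Fin 3 → ℝ} {m Λ : ℝ} {v : ℝ → State}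
    (h : IsGlobalSolution C m Λ v) {t : ℝ} (ht : 0 ≤ t) (hC : ∀ k i j, C k i j = -C k j i)
    (hF : (v t).Fᵀ = -(v t).F) (hc : (v t).Constraints C m Λ) :
    HasDerivWithinAt (fun r => (v r).Q m Λ) (2 * (v t).H * ((v t).Q m Λ / 3
      + (v t).normSq (v t).σ + 8 * Real.pi * (v t).τ00
      + 4 * Real.pi * (v t).ρ * ((v t).u0 ^ 2 + (v t).u ⬝ᵥ (v t).uLow))) (Set.Ici 0) t := by
  have hg := h.g_posDef t ht
  have hQ := hc.Q_eq hg (h.k_symm ht)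
  have hH := State.H_sq_eq (s := v t) (m := m) (Λ := Λ)
  refine ((((h.H_deriv ht hC hF).pow 2).sub ((h.T00_deriv ht).const_mul (24 * Real.pi))).sub_const
    (3 * Λ)).congr_deriv ?_
  rw [State.energyDensity, State.u0_sq hg] at *
  push_cast
  linear_combination (2 * (v t).H) * (2 / 3 * hQ + hH)

/-- An initially expanding global solution whose data satisfy the constraints and whose spatial
sections have nonpositive scalar curvature, with `3 γ² = Λ + 4π m² Φ(0)²`. -/
structure IsExpanding (C : Fin 3 → Fin 3 → Fin 3 → ℝ) (m Λ γ : ℝ) (v : ℝ → State) : Prop where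
  isLieConstants : IsLieConstants C
  sol : IsGlobalSolution C m Λ v
  F_antisymm_zero : (v 0).Fᵀ = -(v 0).F
  constraints_zero : (v 0).Constraints C m Λ
  R_nonpos : ∀ t, 0 ≤ t → (v t).R C ≤ 0
  m_ne_zero : m ≠ 0
  γ_pos : 0 < γ
  γ_sq : 3 * γ ^ 2 = Λ + 4 * Real.pi * m ^ 2 * (v 0).Φ ^ 2
  Φ_zero_pos : 0 < (v 0).Φ
  ρ_zero_pos : 0 < (v 0).ρ
  H_zero_neg : (v 0).H < 0

namespace IsExpanding

variable {C : Fin 3 → Fin 3 → Fin 3 → ℝ} {m Λ γ : ℝ} {v : ℝ → State}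
  (h : IsExpanding C m Λ γ v)
include h

section Pointwise

variable {t : ℝ} (ht : 0 ≤ t)
include ht

theorem g_posDef : (v t).g.PosDef := h.sol.g_posDef t ht

theorem F_antisymm : (v t).Fᵀ = -(v t).F :=
  h.sol.F_antisymm h.isLieConstants.skew h.F_antisymm_zero ht

theorem constraints : (v t).Constraints C m Λ :=
  h.sol.constraints ht h.isLieConstants (fun _ hr => h.F_antisymm hr) h.constraints_zero

theorem Q_eq : (v t).Q m Λ = 24 * Real.pi * (v t).energyDensity
    + 3 / 2 * (v t).normSq (v t).σ - 3 / 2 * (v t).R C :=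
  (h.constraints ht).Q_eq (h.g_posDef ht) (h.sol.k_symm ht)

theorem ρ_pos : 0 < (v t).ρ :=
  pos_of_ne_zero (fun r hr => (h.sol.ρ_eq r hr).continuousWithinAt) h.sol.ρ_ne_zero h.ρ_zero_pos ht

theorem τ00_nonneg : 0 ≤ (v t).τ00 := State.τ00_nonneg (h.g_posDef ht)

theorem normSq_σ_nonneg : 0 ≤ (v t).normSq (v t).σ := State.normSq_nonneg (h.g_posDef ht) _

theorem ρ_le_ρ_mul_u0_sq : (v t).ρ ≤ (v t).ρ * (v t).u0 ^ 2 := by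
  refine le_mul_of_one_le_right (h.ρ_pos ht).le ?_
  rw [State.u0_sq (h.g_posDef ht)]
  exact le_add_of_nonneg_right (State.u_dotProduct_uLow_nonneg (h.g_posDef ht))

theorem energyDensity_nonneg : 0 ≤ (v t).energyDensity :=
  add_nonneg (h.τ00_nonneg ht) ((h.ρ_pos ht).le.trans (h.ρ_le_ρ_mul_u0_sq ht))

theorem energyDensity_le_Q : (v t).energyDensity ≤ (v t).Q m Λ := by
  rw [h.Q_eq ht]
  nlinarith [h.energyDensity_nonneg ht, h.normSq_σ_nonneg ht, h.R_nonpos t ht, Real.pi_gt_three]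

theorem τ00_le_Q : (v t).τ00 ≤ (v t).Q m Λ :=
  (le_add_of_nonneg_right ((h.ρ_pos ht).le.trans (h.ρ_le_ρ_mul_u0_sq ht))).trans
    (h.energyDensity_le_Q ht)

theorem ρ_le_Q : (v t).ρ ≤ (v t).Q m Λ :=
  (h.ρ_le_ρ_mul_u0_sq ht).trans
    ((le_add_of_nonneg_left (h.τ00_nonneg ht)).trans (h.energyDensity_le_Q ht))

theorem Q_nonneg : 0 ≤ (v t).Q m Λ := (h.ρ_pos ht).le.trans (h.ρ_le_Q ht)

theorem normSq_σ_le_Q : (v t).normSq (v t).σ ≤ (v t).Q m Λ := by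
  have hε := mul_nonneg Real.pi_pos.le (h.energyDensity_nonneg ht)
  linarith [h.Q_eq ht, h.normSq_σ_nonneg ht, h.R_nonpos t ht]

theorem abs_R_le_Q : |(v t).R C| ≤ (v t).Q m Λ := by
  have hε := mul_nonneg Real.pi_pos.le (h.energyDensity_nonneg ht)
  rw [abs_of_nonpos (h.R_nonpos t ht)]
  linarith [h.Q_eq ht, h.normSq_σ_nonneg ht, h.R_nonpos t ht]

end Pointwise

theorem Φ_mono {a b : ℝ} (ha : 0 ≤ a) (hab : a ≤ b) : (v a).Φ ≤ (v b).Φ := by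
  have hle := le_of_deriv_nonpos ha hab (fun r hr => (h.sol.Φ_eq r hr).neg)
    fun _ _ => neg_nonpos.2 (Real.sqrt_nonneg _)
  exact neg_le_neg_iff.1 hle

theorem Φ_sq_mono {a b : ℝ} (ha : 0 ≤ a) (hab : a ≤ b) : (v a).Φ ^ 2 ≤ (v b).Φ ^ 2 :=
  pow_le_pow_left₀ (h.Φ_zero_pos.trans_le (h.Φ_mono le_rfl ha)).le (h.Φ_mono ha hab) 2

theorem sq_three_mul_γ_le_H_sq {t : ℝ} (ht : 0 ≤ t) : (3 * γ) ^ 2 ≤ (v t).H ^ 2 := by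
  have hU := mul_nonneg Real.pi_pos.le (h.sol.U_nonneg t ht)
  have hΦ := mul_le_mul_of_nonneg_left (h.Φ_sq_mono le_rfl ht)
    (mul_nonneg Real.pi_pos.le (sq_nonneg m))
  linarith [State.H_sq_eq (s := v t) (m := m) (Λ := Λ), h.Q_nonneg ht, h.γ_sq]

theorem H_continuousOn : ContinuousOn (fun r => (v r).H) (Set.Ici 0) :=
  h.sol.H_continuousOn h.isLieConstants fun _ ht => h.F_antisymm ht

theorem H_neg {t : ℝ} (ht : 0 ≤ t) : (v t).H < 0 := by
  refine neg_pos.1 (pos_of_ne_zero (f := fun r => -(v r).H) h.H_continuousOn.neg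
    (fun r hr h0 => ?_) (neg_pos.2 h.H_zero_neg) ht)
  have hle := h.sq_three_mul_γ_le_H_sq hr
  rw [neg_eq_zero.1 h0] at hle
  nlinarith [h.γ_pos]

theorem H_le {t : ℝ} (ht : 0 ≤ t) : (v t).H ≤ -3 * γ := by
  have hle : (3 * γ) ^ 2 ≤ (-(v t).H) ^ 2 := by
    rw [neg_sq]
    exact h.sq_three_mul_γ_le_H_sq ht
  linarith [(abs_le_of_sq_le_sq' hle (neg_nonneg.2 (h.H_neg ht).le)).2]

theorem Q_rate_le {t c : ℝ} (ht : 0 ≤ t) (hc : (v t).H ≤ -3 * c) :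
    2 * (v t).H * ((v t).Q m Λ / 3 + (v t).normSq (v t).σ + 8 * Real.pi * (v t).τ00
      + 4 * Real.pi * (v t).ρ * ((v t).u0 ^ 2 + (v t).u ⬝ᵥ (v t).uLow))
        ≤ -2 * c * (v t).Q m Λ := by
  have hmatter : 0 ≤ (v t).normSq (v t).σ + 8 * Real.pi * (v t).τ00
      + 4 * Real.pi * (v t).ρ * ((v t).u0 ^ 2 + (v t).u ⬝ᵥ (v t).uLow) := by
    have := h.normSq_σ_nonneg ht
    have := h.τ00_nonneg ht
    have := State.u_dotProduct_uLow_nonneg (h.g_posDef ht)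
    have := h.ρ_pos ht
    positivity
  linarith [mul_nonneg (neg_nonneg.2 (h.H_neg ht).le) hmatter,
    mul_le_mul_of_nonneg_right hc (h.Q_nonneg ht)]

theorem Q_isBigO_of_H_le {T c : ℝ} (hT : 0 ≤ T) (hc : ∀ t, T ≤ t → (v t).H ≤ -3 * c) :
    (fun t => (v t).Q m Λ) =O[𝓟 (Set.Ici T)] fun t => Real.exp (-2 * c * t) :=
  isBigO_principal.2 ⟨_, fun t ht => by
    rw [Real.norm_of_nonneg (h.Q_nonneg (hT.trans ht)), Real.norm_of_nonneg (Real.exp_pos _).le]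
    exact le_mul_exp_of_deriv_le hT ht
      (fun r hr => h.sol.Q_deriv hr h.isLieConstants.skew (h.F_antisymm hr) (h.constraints hr))
      fun r hr => h.Q_rate_le (hT.trans hr) (hc r hr)⟩

theorem Q_isBigO : (fun t => (v t).Q m Λ) =O[𝓟 (Set.Ici 0)] fun t => Real.exp (-2 * γ * t) :=
  h.Q_isBigO_of_H_le le_rfl fun _ ht => h.H_le ht

theorem isBigO_of_abs_le_Q {f : ℝ → ℝ} {c : ℝ} (hf : ∀ t, 0 ≤ t → |f t| ≤ c * (v t).Q m Λ) :
    f =O[𝓟 (Set.Ici 0)] fun t => Real.exp (-2 * γ * t) :=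
  (isBigO_principal.2 ⟨c, fun t ht => by
    rw [Real.norm_of_nonneg (h.Q_nonneg ht)]
    exact hf t ht⟩ : f =O[𝓟 (Set.Ici 0)] fun t => (v t).Q m Λ).trans h.Q_isBigO

theorem U_rate_le {t : ℝ} (ht : 0 ≤ t) :
    (v t).URate m ≤ -(m ^ 2 * (v 0).Φ) * √(2 * (v t).U) := by
  rw [State.URate]
  linarith [mul_nonneg (neg_nonneg.2 (h.H_neg ht).le) (h.sol.U_nonneg t ht),
    mul_le_mul_of_nonneg_left (h.Φ_mono le_rfl ht)
      (mul_nonneg (sq_nonneg m) (Real.sqrt_nonneg (2 * (v t).U)))]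

theorem U_anti {a b : ℝ} (ha : 0 ≤ a) (hab : a ≤ b) : (v b).U ≤ (v a).U := by
  refine le_of_deriv_nonpos ha hab h.sol.U_eq fun t ht => (h.U_rate_le (ha.trans ht)).trans ?_
  rw [neg_mul]
  exact neg_nonpos.2 (mul_nonneg (mul_nonneg (sq_nonneg m) h.Φ_zero_pos.le) (Real.sqrt_nonneg _))

-- As long as `U > 0`, the function `√(2U) + m² Φ(0) t` is nonincreasing, so `√(2U)` would be
-- negative at the time chosen below.
theorem exists_U_eq_zero : ∃ T, 0 ≤ T ∧ (v T).U = 0 := by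
  by_contra! hne
  have hU (t : ℝ) (ht : 0 ≤ t) : 0 < (v t).U := (h.sol.U_nonneg t ht).lt_of_ne' (hne t ht)
  set c := m ^ 2 * (v 0).Φ
  have hc : 0 < c := mul_pos (sq_pos_iff.2 h.m_ne_zero) h.Φ_zero_pos
  set T := (√(2 * (v 0).U) + 1) / c with hT
  have hT_nonneg : 0 ≤ T := by positivity
  have hderiv (t : ℝ) (ht : 0 ≤ t) : HasDerivWithinAt (fun r => √(2 * (v r).U) + c * r)
      (2 * (v t).URate m / (2 * √(2 * (v t).U)) + c * 1) (Set.Ici 0) t :=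
    (((h.sol.U_eq t ht).const_mul 2).sqrt (mul_pos two_pos (hU t ht)).ne').add
      ((hasDerivWithinAt_id t _).const_mul c)
  have hle := le_of_deriv_nonpos le_rfl hT_nonneg hderiv fun t ht => by
    have hsqrt : 0 < √(2 * (v t).U) := Real.sqrt_pos.2 (mul_pos two_pos (hU t ht))
    have hrate : 2 * (v t).URate m / (2 * √(2 * (v t).U)) ≤ -c := by
      rw [div_le_iff₀ (by positivity)]
      linarith [h.U_rate_le ht]
    linarith
  have hcT : c * T = √(2 * (v 0).U) + 1 := by rw [hT, mul_div_cancel₀ _ hc.ne']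
  simp only [mul_zero, add_zero] at hle
  linarith [Real.sqrt_nonneg (2 * (v T).U)]

theorem exists_scalarField_eq : ∃ T, 0 ≤ T ∧ ∀ t, T ≤ t → (v t).U = 0 ∧ (v t).Φ = (v T).Φ := by
  obtain ⟨T, hT, hUT⟩ := h.exists_U_eq_zero
  have hU (t : ℝ) (ht : T ≤ t) : (v t).U = 0 :=
    le_antisymm (hUT ▸ h.U_anti hT ht) (h.sol.U_nonneg t (hT.trans ht))
  refine ⟨T, hT, fun t ht => ⟨hU t ht, le_antisymm ?_ (h.Φ_mono hT ht)⟩⟩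
  exact le_of_deriv_nonpos hT ht h.sol.Φ_eq fun r hr => by simp [hU r hr]

theorem H_add_isBigO {T δ : ℝ} (hT : 0 ≤ T) (hδ : 0 < δ)
    (hsq : ∀ t, T ≤ t → (v t).H ^ 2 = (v t).Q m Λ + (3 * δ) ^ 2) :
    (fun t => (v t).H + 3 * δ) =O[𝓟 (Set.Ici 0)] fun t => Real.exp (-2 * δ * t) := by
  have hH (t : ℝ) (ht : T ≤ t) : (v t).H ≤ -3 * δ := by
    have hle : (3 * δ) ^ 2 ≤ (-(v t).H) ^ 2 := by
      rw [neg_sq, hsq t ht]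
      exact le_add_of_nonneg_left (h.Q_nonneg (hT.trans ht))
    linarith [(abs_le_of_sq_le_sq' hle (neg_nonneg.2 (h.H_neg (hT.trans ht)).le)).2]
  have hQ : (fun t => (v t).H + 3 * δ) =O[𝓟 (Set.Ici T)] fun t => (v t).Q m Λ := by
    refine isBigO_principal.2 ⟨(6 * δ)⁻¹, fun t ht => ?_⟩
    -- `Q = (-H - 3δ)(-H + 3δ)`, and the second factor is at least `6δ`.
    rw [Real.norm_of_nonneg (h.Q_nonneg (hT.trans ht)), inv_mul_eq_div, le_div_iff₀ (by positivity),
      Real.norm_of_nonpos (by linarith [hH t ht])]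
    nlinarith [hsq t ht, hH t ht]
  refine isBigO_principal_Ici_of_isBigO_atTop (h.H_continuousOn.add continuousOn_const)
    (by fun_prop) (fun t _ => (Real.exp_pos _).ne') ?_
  exact (hQ.trans (h.Q_isBigO_of_H_le hT hH)).mono (le_principal_iff.2 (Ici_mem_atTop T))

end IsExpanding

theorem sqrt_isBigO_exp_mul {l : Filter ℝ} {f : ℝ → ℝ} {c : ℝ}
    (hf : f =O[l] fun t => Real.exp (2 * c * t)) :
    (fun t => √(f t)) =O[l] fun t => Real.exp (c * t) := by
  refine (hf.sqrt (Eventually.of_forall fun t => (Real.exp_pos _).le)).congr_right fun t => ?_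
  rw [← Real.exp_half, mul_assoc, mul_div_cancel_left₀ _ two_ne_zero]

theorem isBigO_exp_add_mul {E F : Type*} [SeminormedAddCommGroup E] [SeminormedAddCommGroup F]
    {X : ℝ → E} {Y : ℝ → F} {n : ℝ → ℝ} {K a b : ℝ}
    (hle : ∀ t, 0 ≤ t → ‖X t‖ ≤ K * n t * ‖Y t‖)
    (hn : n =O[𝓟 (Set.Ici 0)] fun t => Real.exp (a * t))
    (hY : Y =O[𝓟 (Set.Ici 0)] fun t => Real.exp (b * t)) :
    X =O[𝓟 (Set.Ici 0)] fun t => Real.exp ((a + b) * t) := by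
  have hX : X =O[𝓟 (Set.Ici 0)] fun t => K * n t * ‖Y t‖ := isBigO_principal.2 ⟨1, fun t ht => by
    rw [one_mul]
    exact (hle t ht).trans (le_abs_self _)⟩
  exact (hX.trans ((hn.const_mul_left K).mul hY.norm_left)).congr_right fun t => by
    rw [add_mul, Real.exp_add]

section ExponentialGrowth

variable {E : Type*} [NormedAddCommGroup E] [NormedSpace ℝ E] {g A : ℝ → E} {a b : ℝ → ℝ}
  {c γ : ℝ}

theorem exists_limit_exp_smul_of_deriv [CompleteSpace E] (hγ : 0 < γ)
    (hg : ∀ t, 0 ≤ t → HasDerivWithinAt g (A t + (c + b t) • g t) (Set.Ici 0) t)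
    (hA : ∀ t, 0 ≤ t → ‖A t‖ ≤ a t * ‖g t‖)
    (ha : a =O[𝓟 (Set.Ici 0)] fun t => Real.exp (-γ * t))
    (hb : b =O[𝓟 (Set.Ici 0)] fun t => Real.exp (-γ * t)) :
    ∃ G, (fun t => Real.exp (-c * t) • g t - G) =O[𝓟 (Set.Ici 0)] fun t => Real.exp (-γ * t) := by
  obtain ⟨K, hK, hbound⟩ := (ha.norm_left.add hb.norm_left).exists_nonneg
  refine exists_limit_of_relative_deriv_le hγ hK
    (X' := fun t => Real.exp (-c * t) • (A t + b t • g t))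
    (fun t ht => ((hasDerivWithinAt_exp_mul (-c) t _).smul (hg t ht)).congr_deriv (by module))
    fun t ht => ?_
  have hab : ‖a t‖ + ‖b t‖ ≤ K * Real.exp (-γ * t) := by
    have := isBigOWith_principal.1 hbound t ht
    rwa [Real.norm_of_nonneg (by positivity), Real.norm_of_nonneg (Real.exp_pos _).le] at this
  have hsum : ‖A t + b t • g t‖ ≤ K * Real.exp (-γ * t) * ‖g t‖ :=
    calc ‖A t + b t • g t‖ ≤ ‖A t‖ + ‖b t‖ * ‖g t‖ := norm_smul (b t) (g t) ▸ norm_add_le _ _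
      _ ≤ (‖a t‖ + ‖b t‖) * ‖g t‖ := by
        rw [add_mul]
        gcongr
        exact (hA t ht).trans (mul_le_mul_of_nonneg_right (le_abs_self _) (norm_nonneg _))
      _ ≤ K * Real.exp (-γ * t) * ‖g t‖ := mul_le_mul_of_nonneg_right hab (norm_nonneg _)
  rw [norm_smul, norm_smul, mul_left_comm]
  exact mul_le_mul_of_nonneg_left hsum (norm_nonneg _)

theorem isBigO_exp_of_exp_smul_sub {G : E} (hγ : 0 ≤ γ)
    (hG : (fun t => Real.exp (-c * t) • g t - G) =O[𝓟 (Set.Ici 0)] fun t => Real.exp (-γ * t)) :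
    g =O[𝓟 (Set.Ici 0)] fun t => Real.exp (c * t) := by
  have hG' : (fun t => Real.exp (-c * t) • g t) =O[𝓟 (Set.Ici 0)] fun _ => (1 : ℝ) :=
    ((hG.trans (isBigO_exp_mul_one (neg_nonpos.2 hγ))).add
      (isBigO_const_const G one_ne_zero _)).congr_left fun t => sub_add_cancel _ _
  refine ((isBigO_refl (fun t => Real.exp (c * t)) _).smul hG').congr (fun t => ?_) fun t => ?_
  · rw [smul_smul, exp_mul_mul_exp_neg_mul, one_smul]
  · rw [smul_eq_mul, mul_one]

theorem tendsto_exp_smul (hγ : 0 < γ) {G : E}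
    (hG : (fun t => Real.exp (-c * t) • g t - G) =O[𝓟 (Set.Ici 0)] fun t => Real.exp (-γ * t)) :
    Tendsto (fun t => Real.exp (-c * t) • g t) atTop (𝓝 G) :=
  tendsto_sub_nhds_zero_iff.1 ((hG.mono (le_principal_iff.2 (Ici_mem_atTop 0))).trans_tendsto
    (tendsto_exp_neg_mul hγ))

end ExponentialGrowth

section Componentwise

variable {c : ℝ}

theorem exists_pos_norm_le_exp {E : Type*} [NormedAddCommGroup E] {f : ℝ → E}
    (hf : f =O[𝓟 (Set.Ici 0)] fun t => Real.exp (c * t)) :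
    ∃ K > 0, ∀ t, 0 ≤ t → ‖f t‖ ≤ K * Real.exp (c * t) := by
  obtain ⟨K, hK, hf⟩ := hf.exists_pos
  refine ⟨K, hK, fun t ht => (isBigOWith_principal.1 hf t ht).trans_eq ?_⟩
  rw [Real.norm_of_nonneg (Real.exp_pos _).le]

variable {ι κ : Type*} [Fintype ι] [Fintype κ]

theorem exists_pos_abs_apply_le_exp {f : ℝ → ι → ℝ}
    (hf : f =O[𝓟 (Set.Ici 0)] fun t => Real.exp (c * t)) :
    ∃ K > 0, ∀ t, 0 ≤ t → ∀ i, |f t i| ≤ K * Real.exp (c * t) := by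
  obtain ⟨K, hK, hf⟩ := exists_pos_norm_le_exp hf
  exact ⟨K, hK, fun t ht i => (norm_le_pi_norm (f t) i).trans (hf t ht)⟩

open scoped Matrix.Norms.Elementwise

variable {A : ℝ → Matrix ι κ ℝ} {G : Matrix ι κ ℝ}

theorem exists_pos_abs_entry_le_exp (hA : A =O[𝓟 (Set.Ici 0)] fun t => Real.exp (c * t)) :
    ∃ K > 0, ∀ t, 0 ≤ t → ∀ i j, |A t i j| ≤ K * Real.exp (c * t) := by
  obtain ⟨K, hK, hA⟩ := exists_pos_norm_le_exp hA
  exact ⟨K, hK, fun t ht i j => (Matrix.norm_entry_le_entrywise_sup_norm _).trans (hA t ht)⟩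

theorem exists_pos_abs_exp_mul_entry_le (hA : A =O[𝓟 (Set.Ici 0)] fun t => Real.exp (c * t)) :
    ∃ K > 0, ∀ t, 0 ≤ t → ∀ i j, |Real.exp (-c * t) * A t i j| ≤ K := by
  obtain ⟨K, hK, hA⟩ := exists_pos_abs_entry_le_exp hA
  refine ⟨K, hK, fun t ht i j => ?_⟩
  rw [abs_mul, Real.abs_exp, neg_mul, Real.exp_neg, inv_mul_le_iff₀ (Real.exp_pos _), mul_comm _ K]
  exact hA t ht i j

theorem exists_entry_eq_exp_mul_add {γ : ℝ}
    (hA : (fun t => Real.exp (-c * t) • A t - G) =O[𝓟 (Set.Ici 0)] fun t => Real.exp (-γ * t))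
    (i : ι) (j : κ) : ∃ r : ℝ → ℝ, (r =O[atTop] fun t => Real.exp (-γ * t)) ∧
      ∀ t, 0 ≤ t → A t i j = Real.exp (c * t) * (G i j + r t) := by
  refine ⟨fun t => Real.exp (-c * t) * A t i j - G i j, (IsBigO.of_norm_le fun t =>
    Matrix.norm_entry_le_entrywise_sup_norm (Real.exp (-c * t) • A t - G)).trans
      (hA.mono (le_principal_iff.2 (Ici_mem_atTop 0))).norm_left, fun t _ => ?_⟩
  rw [add_sub_cancel, ← mul_assoc, exp_mul_mul_exp_neg_mul, one_mul]

end Componentwise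

section LimitMetric

open scoped Matrix.Norms.Elementwise

variable {ι : Type*} [Fintype ι] [DecidableEq ι]

theorem norm_le_sqrt_tensorNormSq_mul_norm {g : Matrix ι ι ℝ} (hg : g.PosDef) (A : Matrix ι ι ℝ) :
    ‖A‖ ≤ Fintype.card ι * √(tensorNormSq g A) * ‖g‖ := by
  have htrace : g.trace ≤ Fintype.card ι * ‖g‖ := by
    refine (Finset.sum_le_card_nsmul _ _ ‖g‖ fun i _ => ?_).trans_eq (nsmul_eq_mul _ _)
    exact (le_abs_self _).trans (Matrix.norm_entry_le_entrywise_sup_norm g)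
  refine (Matrix.norm_le_iff (by positivity)).2 fun i j =>
    (abs_apply_le_sqrt_tensorNormSq_mul_trace hg A i j).trans ?_
  rw [mul_comm (Fintype.card ι : ℝ), mul_assoc]
  exact mul_le_mul_of_nonneg_left htrace (Real.sqrt_nonneg _)

theorem norm_inv_mul_mul_inv_le {g : Matrix ι ι ℝ} (hg : g.PosDef) (A : Matrix ι ι ℝ) :
    ‖g⁻¹ * A * g⁻¹‖ ≤ Fintype.card ι * √(tensorNormSq g A) * ‖g⁻¹‖ := by
  rw [← tensorNormSq_inv hg]
  exact norm_le_sqrt_tensorNormSq_mul_norm hg.inv _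

theorem posDef_of_tendsto {α : Type*} {l : Filter α} [l.NeBot] {X Y : α → Matrix ι ι ℝ}
    {G G' : Matrix ι ι ℝ} (hX : ∀ᶠ t in l, (X t).PosDef) (hXY : ∀ᶠ t in l, X t * Y t = 1)
    (hG : Tendsto X l (𝓝 G)) (hG' : Tendsto Y l (𝓝 G')) : G.PosDef ∧ G⁻¹ = G' := by
  have hmul : G * G' = 1 :=
    tendsto_nhds_unique (hG.mul hG') (tendsto_const_nhds.congr' (hXY.mono fun t ht => ht.symm))
  have hherm : G.IsHermitian := by
    refine tendsto_nhds_unique ((continuous_id.matrix_conjTranspose.tendsto G).comp hG)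
      (hG.congr' (hX.mono fun t ht => ?_))
    exact ht.isHermitian.symm
  have hpsd : G.PosSemidef := by
    refine Matrix.PosSemidef.of_dotProduct_mulVec_nonneg hherm fun x => ?_
    have hc : Continuous fun A : Matrix ι ι ℝ => star x ⬝ᵥ A *ᵥ x := by fun_prop
    exact ge_of_tendsto ((hc.tendsto G).comp hG)
      (hX.mono fun t ht => ht.posSemidef.dotProduct_mulVec_nonneg x)
  exact ⟨hpsd.posDef_iff_isUnit.2 (IsUnit.of_mul_eq_one G' hmul), Matrix.inv_eq_right_inv hmul⟩

end LimitMetric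

namespace State

theorem k_eq_σ_add (s : State) : s.k = s.σ + (s.H / 3) • s.g := (sub_add_cancel _ _).symm

theorem tendsto_T00 {v : ℝ → State} {m L : ℝ} (hU : ∀ᶠ t in atTop, (v t).U = 0)
    (hΦ : ∀ᶠ t in atTop, (v t).Φ ^ 2 = L) :
    Tendsto (fun t => (v t).T00 m) atTop (𝓝 (m ^ 2 / 2 * L)) := by
  refine tendsto_nhds_of_eventually_eq ?_
  filter_upwards [hU, hΦ] with t hUt hΦt
  rw [State.T00, hUt, hΦt, zero_add, one_div_mul_eq_div]

variable {s : State} (hg : s.g.PosDef)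
include hg

theorem gi_mul_k_mul_gi : s.gi * s.k * s.gi = s.gi * s.σ * s.gi + (s.H / 3) • s.gi := by
  rw [k_eq_σ_add, Matrix.mul_add, Matrix.add_mul, Matrix.mul_smul, gi_mul_g hg, Matrix.smul_mul,
    Matrix.one_mul]

theorem ESq_le : s.ESq ≤ 2 * s.τ00 := by
  rw [τ00]
  linarith [normSq_nonneg hg s.F]

theorem normSq_F_le : s.normSq s.F ≤ 4 * s.τ00 := by
  rw [τ00]
  linarith [ESq_nonneg hg]

open scoped Matrix.Norms.Elementwise

theorem norm_le_sqrt_normSq_mul_norm (a : Mat3) : ‖a‖ ≤ 3 * √(s.normSq a) * ‖s.g‖ := by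
  rw [normSq_eq hg]
  exact norm_le_sqrt_tensorNormSq_mul_norm hg a

theorem norm_gi_mul_mul_gi_le (a : Mat3) : ‖s.gi * a * s.gi‖ ≤ 3 * √(s.normSq a) * ‖s.gi‖ := by
  rw [normSq_eq hg]
  exact norm_inv_mul_mul_inv_le hg a

end State

namespace IsExpanding

open scoped Matrix.Norms.Elementwise

variable {C : Fin 3 → Fin 3 → Fin 3 → ℝ} {m Λ γ : ℝ} {v : ℝ → State}
  (h : IsExpanding C m Λ γ v)
include h

theorem normSq_σ_isBigO :
    (fun t => (v t).normSq (v t).σ) =O[𝓟 (Set.Ici 0)] fun t => Real.exp (-2 * γ * t) :=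
  h.isBigO_of_abs_le_Q (c := 1) fun t ht => by
    rw [abs_of_nonneg (h.normSq_σ_nonneg ht), one_mul]
    exact h.normSq_σ_le_Q ht

theorem R_isBigO : (fun t => |(v t).R C|) =O[𝓟 (Set.Ici 0)] fun t => Real.exp (-2 * γ * t) :=
  h.isBigO_of_abs_le_Q (c := 1) fun t ht => by
    rw [abs_abs, one_mul]
    exact h.abs_R_le_Q ht

theorem τ00_isBigO : (fun t => (v t).τ00) =O[𝓟 (Set.Ici 0)] fun t => Real.exp (-2 * γ * t) :=
  h.isBigO_of_abs_le_Q (c := 1) fun t ht => by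
    rw [abs_of_nonneg (h.τ00_nonneg ht), one_mul]
    exact h.τ00_le_Q ht

theorem ρ_isBigO : (fun t => (v t).ρ) =O[𝓟 (Set.Ici 0)] fun t => Real.exp (-2 * γ * t) :=
  h.isBigO_of_abs_le_Q (c := 1) fun t ht => by
    rw [abs_of_pos (h.ρ_pos ht), one_mul]
    exact h.ρ_le_Q ht

theorem normSq_F_isBigO :
    (fun t => (v t).normSq (v t).F) =O[𝓟 (Set.Ici 0)] fun t => Real.exp (-2 * γ * t) :=
  h.isBigO_of_abs_le_Q (c := 4) fun t ht => by
    rw [abs_of_nonneg (State.normSq_nonneg (h.g_posDef ht) _)]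
    linarith [State.normSq_F_le (h.g_posDef ht), h.τ00_le_Q ht]

theorem ESq_isBigO : (fun t => (v t).ESq) =O[𝓟 (Set.Ici 0)] fun t => Real.exp (-2 * γ * t) :=
  h.isBigO_of_abs_le_Q (c := 2) fun t ht => by
    rw [abs_of_nonneg (State.ESq_nonneg (h.g_posDef ht))]
    linarith [State.ESq_le (h.g_posDef ht), h.τ00_le_Q ht]

theorem sqrt_normSq_σ_isBigO :
    (fun t => √((v t).normSq (v t).σ)) =O[𝓟 (Set.Ici 0)] fun t => Real.exp (-γ * t) :=
  sqrt_isBigO_exp_mul <| h.normSq_σ_isBigO.congr_right fun t => by rw [neg_mul_comm]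

theorem sqrt_normSq_F_isBigO :
    (fun t => √((v t).normSq (v t).F)) =O[𝓟 (Set.Ici 0)] fun t => Real.exp (-γ * t) :=
  sqrt_isBigO_exp_mul <| h.normSq_F_isBigO.congr_right fun t => by rw [neg_mul_comm]

theorem deriv_Φ_sq_isBigO (hU : ∀ᶠ t in atTop, (v t).U = 0) :
    (fun t => deriv (fun r => (v r).Φ) t ^ 2) =O[atTop] fun t => Real.exp (-2 * γ * t) := by
  refine (isBigO_zero _ _).congr' (f₁ := fun _ => (0 : ℝ)) ?_ EventuallyEq.rfl
  filter_upwards [eventually_gt_atTop 0, hU] with t ht hUt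
  rw [((h.sol.Φ_eq t ht.le).hasDerivAt (Ici_mem_nhds ht)).deriv, hUt, mul_zero, Real.sqrt_zero,
    zero_pow two_ne_zero]

theorem exists_limit_rate : ∃ L δ, 0 < L ∧ γ ≤ δ ∧ δ = √((Λ + 4 * Real.pi * m ^ 2 * L) / 3) ∧
    (∀ᶠ t in atTop, (v t).U = 0) ∧ (∀ᶠ t in atTop, (v t).Φ ^ 2 = L) ∧
    (fun t => (v t).H + 3 * δ) =O[𝓟 (Set.Ici 0)] fun t => Real.exp (-2 * δ * t) := by
  obtain ⟨T, hT, hconst⟩ := h.exists_scalarField_eq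
  set L := (v T).Φ ^ 2
  have hL : 3 * γ ^ 2 ≤ Λ + 4 * Real.pi * m ^ 2 * L := by
    rw [h.γ_sq]
    have := h.Φ_sq_mono le_rfl hT
    gcongr
  set δ := √((Λ + 4 * Real.pi * m ^ 2 * L) / 3)
  have hγδ : γ ≤ δ := Real.le_sqrt_of_sq_le (by linarith)
  have hδ_sq : 3 * δ ^ 2 = Λ + 4 * Real.pi * m ^ 2 * L := by
    rw [Real.sq_sqrt (by linarith [sq_nonneg γ]), mul_div_cancel₀ _ three_ne_zero]
  refine ⟨L, δ, pow_pos (h.Φ_zero_pos.trans_le (h.Φ_mono le_rfl hT)) 2, hγδ, rfl,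
    eventually_atTop.2 ⟨T, fun t ht => (hconst t ht).1⟩,
    eventually_atTop.2 ⟨T, fun t ht => by rw [(hconst t ht).2]⟩,
    h.H_add_isBigO hT (h.γ_pos.trans_le hγδ) fun t ht => ?_⟩
  rw [State.H_sq_eq (m := m) (Λ := Λ), (hconst t ht).1, (hconst t ht).2, ← hδ_sq]
  ring

section Rates

variable {δ : ℝ} (hγδ : γ ≤ δ)
  (hH : (fun t => (v t).H + 3 * δ) =O[𝓟 (Set.Ici 0)] fun t => Real.exp (-2 * δ * t))
include hγδ hH

theorem const_mul_H_add_isBigO (c : ℝ) :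
    (fun t => c * ((v t).H + 3 * δ)) =O[𝓟 (Set.Ici 0)] fun t => Real.exp (-γ * t) :=
  (hH.trans (isBigO_exp_mul_of_le (by linarith [h.γ_pos]))).const_mul_left c

theorem exists_limit_g : ∃ G, (fun t => Real.exp (-(2 * δ) * t) • (v t).g - G)
    =O[𝓟 (Set.Ici 0)] fun t => Real.exp (-γ * t) := by
  refine exists_limit_exp_smul_of_deriv h.γ_pos (A := fun t => (-2 : ℝ) • (v t).σ)
    (fun t ht => ?_) (fun t ht => ?_) (h.sqrt_normSq_σ_isBigO.const_mul_left (2 * 3))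
    (h.const_mul_H_add_isBigO hγδ hH (-2 / 3))
  · refine (h.sol.g_deriv ht).congr_deriv ?_
    rw [State.k_eq_σ_add]
    module
  · rw [norm_smul, Real.norm_eq_abs, abs_neg, abs_two, mul_assoc 2, mul_assoc 2]
    exact mul_le_mul_of_nonneg_left (State.norm_le_sqrt_normSq_mul_norm (h.g_posDef ht) _)
      zero_le_two

theorem exists_limit_gi : ∃ G, (fun t => Real.exp (-(-2 * δ) * t) • (v t).gi - G)
    =O[𝓟 (Set.Ici 0)] fun t => Real.exp (-γ * t) := by
  refine exists_limit_exp_smul_of_deriv h.γ_pos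
    (A := fun t => (2 : ℝ) • ((v t).gi * (v t).σ * (v t).gi))
    (fun t ht => ?_) (fun t ht => ?_) (h.sqrt_normSq_σ_isBigO.const_mul_left (2 * 3))
    (h.const_mul_H_add_isBigO hγδ hH (2 / 3))
  · refine (h.sol.gi_deriv ht).congr_deriv ?_
    rw [State.gi_mul_k_mul_gi (h.g_posDef ht)]
    module
  · rw [norm_smul, Real.norm_eq_abs, abs_two, mul_assoc 2, mul_assoc 2]
    exact mul_le_mul_of_nonneg_left (State.norm_gi_mul_mul_gi_le (h.g_posDef ht) _)
      zero_le_two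

theorem exists_limit_metric : ∃ G : Mat3, G.PosDef ∧
    (fun t => Real.exp (-(2 * δ) * t) • (v t).g - G) =O[𝓟 (Set.Ici 0)]
      (fun t => Real.exp (-γ * t)) ∧
    (fun t => Real.exp (-(-2 * δ) * t) • (v t).gi - G⁻¹) =O[𝓟 (Set.Ici 0)]
      (fun t => Real.exp (-γ * t)) ∧
    (fun t => (v t).g) =O[𝓟 (Set.Ici 0)] (fun t => Real.exp (2 * δ * t)) ∧
    (fun t => (v t).gi) =O[𝓟 (Set.Ici 0)] fun t => Real.exp (-2 * δ * t) := by
  obtain ⟨G, hG⟩ := h.exists_limit_g hγδ hH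
  obtain ⟨G', hG'⟩ := h.exists_limit_gi hγδ hH
  obtain ⟨hpos, hinv⟩ := posDef_of_tendsto
    ((eventually_ge_atTop 0).mono fun t ht => (h.g_posDef ht).smul (Real.exp_pos _))
    ((eventually_ge_atTop 0).mono fun t ht => by
      rw [Matrix.smul_mul, Matrix.mul_smul, State.g_mul_gi (h.g_posDef ht), smul_smul, neg_mul 2 δ,
        mul_comm, neg_neg, exp_mul_mul_exp_neg_mul, one_smul])
    (tendsto_exp_smul h.γ_pos hG) (tendsto_exp_smul h.γ_pos hG')
  exact ⟨G, hpos, hG, hinv ▸ hG', isBigO_exp_of_exp_smul_sub h.γ_pos.le hG,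
    isBigO_exp_of_exp_smul_sub h.γ_pos.le hG'⟩

end Rates

section Components

variable {δ : ℝ}

theorem k_isBigO (hγδ : γ ≤ δ)
    (hH : (fun t => (v t).H + 3 * δ) =O[𝓟 (Set.Ici 0)] fun t => Real.exp (-2 * δ * t))
    (hg : (fun t => (v t).g) =O[𝓟 (Set.Ici 0)] fun t => Real.exp (2 * δ * t)) :
    (fun t => (v t).k) =O[𝓟 (Set.Ici 0)] fun t => Real.exp (2 * δ * t) := by
  have hσ : (fun t => (v t).σ) =O[𝓟 (Set.Ici 0)] fun t => Real.exp ((-γ + 2 * δ) * t) :=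
    isBigO_exp_add_mul (fun _ ht => State.norm_le_sqrt_normSq_mul_norm (h.g_posDef ht) _)
      h.sqrt_normSq_σ_isBigO hg
  have hH3 : (fun t => (v t).H / 3) =O[𝓟 (Set.Ici 0)] fun _ => (1 : ℝ) := by
    have hsum := (hH.trans (isBigO_exp_mul_one (by linarith [h.γ_pos]))).sub
      (isBigO_const_const (3 * δ) one_ne_zero _)
    simpa only [add_sub_cancel_right, div_eq_inv_mul] using hsum.const_mul_left 3⁻¹
  refine ((hσ.trans (isBigO_exp_mul_of_le (by linarith [h.γ_pos]))).add
    ((hH3.smul hg).congr_right fun t => by rw [one_smul])).congr_left fun t => ?_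
  exact (State.k_eq_σ_add _).symm

theorem F_isBigO (hg : (fun t => (v t).g) =O[𝓟 (Set.Ici 0)] fun t => Real.exp (2 * δ * t)) :
    (fun t => (v t).F) =O[𝓟 (Set.Ici 0)] fun t => Real.exp ((-γ + 2 * δ) * t) :=
  isBigO_exp_add_mul (fun _ ht => State.norm_le_sqrt_normSq_mul_norm (h.g_posDef ht) _)
    h.sqrt_normSq_F_isBigO hg

section

variable (hgi : (fun t => (v t).gi) =O[𝓟 (Set.Ici 0)] fun t => Real.exp (-2 * δ * t))
include hgi

theorem raise_F_isBigO : (fun t => Matrix.of ((v t).raise (v t).F)) =O[𝓟 (Set.Ici 0)]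
    fun t => Real.exp ((-γ + -2 * δ) * t) :=
  isBigO_exp_add_mul (fun _ ht => by
    rw [State.raise_eq (h.g_posDef ht)]
    exact State.norm_gi_mul_mul_gi_le (h.g_posDef ht) _) h.sqrt_normSq_F_isBigO hgi

theorem E_isBigO : (fun t => (v t).E) =O[𝓟 (Set.Ici 0)] fun t => Real.exp (-(δ + γ) * t) := by
  have hsqrt : (fun t => √(‖(v t).gi‖ * (v t).ESq)) =O[𝓟 (Set.Ici 0)]
      fun t => Real.exp (-(δ + γ) * t) :=
    sqrt_isBigO_exp_mul <| (hgi.norm_left.mul h.ESq_isBigO).congr_right fun t => by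
      rw [← Real.exp_add]
      ring_nf
  refine (isBigO_principal.2 ⟨1, fun t ht => ?_⟩ : _ =O[_] _).trans hsqrt
  rw [one_mul, Real.norm_of_nonneg (Real.sqrt_nonneg _)]
  refine (pi_norm_le_iff_of_nonneg (Real.sqrt_nonneg _)).2 fun i => Real.abs_le_sqrt ?_
  refine (sq_apply_le_inv_mul (h.g_posDef ht) (v t).E i).trans ?_
  exact mul_le_mul_of_nonneg_right
    ((le_abs_self _).trans (Matrix.norm_entry_le_entrywise_sup_norm (v t).gi))
    (State.ESq_nonneg (h.g_posDef ht))

end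

theorem e_div_ρ_eq {t : ℝ} (ht : 0 ≤ t) : (v t).e / (v t).ρ = (v 0).e / (v 0).ρ := by
  refine eq_initial_of_deriv_zero (y := fun r => (v r).e / (v r).ρ) (fun r hr => ?_) ht
  have hρ := h.sol.ρ_ne_zero r hr
  refine ((h.sol.e_eq r hr).div (h.sol.ρ_eq r hr) hρ).congr_deriv ?_
  rw [State.eRate, State.ρRate]
  field_simp
  ring

theorem e_isBigO : (fun t => (v t).e) =O[𝓟 (Set.Ici 0)] fun t => Real.exp (-2 * γ * t) := by
  refine (h.ρ_isBigO.const_mul_left ((v 0).e / (v 0).ρ)).congr' ?_ EventuallyEq.rfl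
  refine eventually_principal.2 fun t ht => ?_
  change (v 0).e / (v 0).ρ * (v t).ρ = (v t).e
  rw [← h.e_div_ρ_eq ht, div_mul_cancel₀ _ (h.sol.ρ_ne_zero t ht)]

end Components

theorem exists_opNorm_σ_le : ∃ K > 0, ∀ t, 0 ≤ t →
    opNorm (v t).σ ≤ K * Real.exp (-γ * t) * opNorm (v t).g := by
  obtain ⟨K, hK, hσ⟩ := exists_pos_norm_le_exp h.sqrt_normSq_σ_isBigO
  refine ⟨K, hK, fun t ht => ?_⟩
  rw [opNorm, opNorm]
  refine (norm_toEuclideanCLM_le (h.g_posDef ht) _).trans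
    (mul_le_mul_of_nonneg_right ?_ (norm_nonneg _))
  rw [tensorNormSq, ← State.gi, ← State.normSq_eq (h.g_posDef ht)]
  exact (le_abs_self _).trans (hσ t ht)

end IsExpanding

theorem isExpanding_of_not_isBianchiIX {L : Type*} [LieRing L] [LieAlgebra ℝ L]
    {b : Module.Basis (Fin 3) ℝ L} (hL : ¬ IsBianchiIX L) {m Λ γ : ℝ} {v : ℝ → State} (hm : m ≠ 0)
    (h_data : (v 0).IsInitialData (structureConstants b) m Λ)
    (hΛ : -(4 * Real.pi * m ^ 2 * (v 0).Φ ^ 2) < Λ) (hH : (v 0).H < 0)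
    (h_sol : IsGlobalSolution (structureConstants b) m Λ v)
    (hγ : γ = √((Λ + 4 * Real.pi * m ^ 2 * (v 0).Φ ^ 2) / 3)) :
    IsExpanding (structureConstants b) m Λ γ v where
  isLieConstants := isLieConstants_structureConstants b
  sol := h_sol
  F_antisymm_zero := h_data.F_antisymm
  constraints_zero := h_data.constraints
  R_nonpos t ht := by
    rw [State.R_eq (h_sol.g_posDef t ht) (isLieConstants_structureConstants b).skew]
    exact scalarCurv_structureConstants_nonpos b hL (h_sol.g_posDef t ht)
  m_ne_zero := hm
  γ_pos := hγ ▸ Real.sqrt_pos.2 (by linarith)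
  γ_sq := by rw [hγ, Real.sq_sqrt (by linarith), mul_div_cancel₀ _ three_ne_zero]
  Φ_zero_pos := h_data.Φ_pos
  ρ_zero_pos := h_data.ρ_pos
  H_zero_neg := hH

theorem sqrt_three_mul (x : ℝ) : √(3 * x) = 3 * √(x / 3) := by
  rw [show 3 * x = 3 ^ 2 * (x / 3) by ring, Real.sqrt_mul (by positivity),
    Real.sqrt_sq zero_le_three]

end EMSF

end

open EMSF in
open scoped Matrix.Norms.Elementwise in
theorem theorem4_general {C : Fin 3 → Fin 3 → Fin 3 → ℝ} {m Λ γ : ℝ} {v : ℝ → State}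
    (h : IsExpanding C m Λ γ v) :
    ∃ (L C₀ δ ν : ℝ) (G : Mat3),
      0 < L ∧
      C₀ = Λ + 4 * Real.pi * m ^ 2 * L ∧
      δ = √((Λ + 4 * Real.pi * m ^ 2 * L) / 3) ∧
      ν = 3 * δ - γ ∧
      G.PosDef ∧
      ((fun t => (v t).Q m Λ) =O[atTop] fun t => Real.exp (-2 * γ * t)) ∧
      ((fun t => (v t).normSq (v t).σ) =O[atTop] fun t => Real.exp (-2 * γ * t)) ∧
      ((fun t => |(v t).R C|) =O[atTop] fun t => Real.exp (-2 * γ * t)) ∧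
      ((fun t => (v t).τ00) =O[atTop] fun t => Real.exp (-2 * γ * t)) ∧
      ((fun t => (v t).ρ) =O[atTop] fun t => Real.exp (-2 * γ * t)) ∧
      ((fun t => deriv (fun r => (v r).Φ) t ^ 2) =O[atTop] fun t => Real.exp (-2 * γ * t)) ∧
      ((fun t => (v t).normSq (v t).F) =O[atTop] fun t => Real.exp (-2 * γ * t)) ∧
      ((fun t => (v t).ESq) =O[atTop] fun t => Real.exp (-2 * γ * t)) ∧
      (∃ C > 0, ∀ t, 0 ≤ t → opNorm (v t).σ ≤ C * Real.exp (-γ * t) * opNorm (v t).g) ∧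
      Tendsto (fun t => (v t).Φ ^ 2) atTop (𝓝 L) ∧
      Tendsto (fun t => (v t).T00 m) atTop (𝓝 (m ^ 2 / 2 * L)) ∧
      ((fun t => (v t).H - (-√(3 * C₀))) =O[atTop] fun t => Real.exp (-2 * δ * t)) ∧
      (∃ C > 0, ∀ t, 0 ≤ t → ∀ i j, |Real.exp (-2 * δ * t) * (v t).g i j| ≤ C) ∧
      (∃ C > 0, ∀ t, 0 ≤ t → ∀ i j, |Real.exp (2 * δ * t) * (v t).gi i j| ≤ C) ∧
      (∀ i j, ∃ r : ℝ → ℝ, (r =O[atTop] fun t => Real.exp (-γ * t)) ∧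
        ∀ t, 0 ≤ t → (v t).g i j = Real.exp (2 * δ * t) * (G i j + r t)) ∧
      (∀ i j, ∃ r : ℝ → ℝ, (r =O[atTop] fun t => Real.exp (-γ * t)) ∧
        ∀ t, 0 ≤ t → (v t).gi i j = Real.exp (-2 * δ * t) * (G⁻¹ i j + r t)) ∧
      (∃ C > 0, ∀ t, 0 ≤ t → ∀ i j, |(v t).k i j| ≤ C * Real.exp (2 * δ * t)) ∧
      (∃ C > 0, ∀ t, 0 ≤ t → ∀ i, |(v t).E i| ≤ C * Real.exp (ν * t)) ∧
      (∃ C > 0, ∀ t, 0 ≤ t → ∀ i j, |(v t).F i j| ≤ C * Real.exp ((2 * δ + ν) * t)) ∧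
      (∃ C > 0, ∀ t, 0 ≤ t → ∀ i j,
        |(v t).raise (v t).F i j| ≤ C * Real.exp ((δ - γ) * t)) ∧
      (∃ C > 0, ∀ t, 0 ≤ t → |(v t).e| ≤ C * Real.exp (ν * t)) := by
  obtain ⟨L, δ, hL, hγδ, hδ, hU, hΦ, hH⟩ := h.exists_limit_rate
  obtain ⟨G, hG, hg_lim, hgi_lim, hg, hgi⟩ := h.exists_limit_metric hγδ hH
  have hγ : 0 < γ := h.γ_pos
  have hle : atTop ≤ 𝓟 (Set.Ici (0 : ℝ)) := le_principal_iff.2 (Ici_mem_atTop 0)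
  refine ⟨L, _, δ, _, G, hL, rfl, hδ, rfl, hG, h.Q_isBigO.mono hle, h.normSq_σ_isBigO.mono hle,
    h.R_isBigO.mono hle, h.τ00_isBigO.mono hle, h.ρ_isBigO.mono hle, h.deriv_Φ_sq_isBigO hU,
    h.normSq_F_isBigO.mono hle, h.ESq_isBigO.mono hle, h.exists_opNorm_σ_le,
    tendsto_nhds_of_eventually_eq hΦ, State.tendsto_T00 hU hΦ, ?_,
    by simpa only [neg_mul] using exists_pos_abs_exp_mul_entry_le hg,
    by simpa only [neg_mul, neg_neg] using exists_pos_abs_exp_mul_entry_le hgi,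
    exists_entry_eq_exp_mul_add hg_lim, exists_entry_eq_exp_mul_add hgi_lim,
    exists_pos_abs_entry_le_exp (h.k_isBigO hγδ hH hg),
    exists_pos_abs_apply_le_exp ((h.E_isBigO hgi).trans (isBigO_exp_mul_of_le (by linarith))),
    exists_pos_abs_entry_le_exp ((h.F_isBigO hg).trans (isBigO_exp_mul_of_le (by linarith))),
    exists_pos_abs_entry_le_exp
      ((h.raise_F_isBigO hgi).trans (isBigO_exp_mul_of_le (by linarith))),
    exists_pos_norm_le_exp (h.e_isBigO.trans (isBigO_exp_mul_of_le (by linarith)))⟩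
  simpa only [sqrt_three_mul, ← hδ, sub_neg_eq_add] using hH.mono hle

theorem theorem4 {𝔤 : Type*} [LieRing 𝔤] [LieAlgebra ℝ 𝔤] (b : Module.Basis (Fin 3) ℝ 𝔤)
    (h_type : ¬ EMSF.IsBianchiIX 𝔤)
    (m Λ : ℝ) (hm : 0 < m)
    (v : ℝ → EMSF.State)
    (h_data : (v 0).IsInitialData (EMSF.structureConstants b) m Λ)
    (hΛ : -(4 * Real.pi * m ^ 2 * (v 0).Φ ^ 2) < Λ)
    (hH : (v 0).H < 0)
    (h_sol : EMSF.IsGlobalSolution (EMSF.structureConstants b) m Λ v)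
    (γ : ℝ) (hγ : γ = √((Λ + 4 * Real.pi * m ^ 2 * (v 0).Φ ^ 2) / 3)) :
    ∃ (L C₀ δ ν : ℝ) (G : EMSF.Mat3),
      0 < L ∧
      C₀ = Λ + 4 * Real.pi * m ^ 2 * L ∧
      δ = √((Λ + 4 * Real.pi * m ^ 2 * L) / 3) ∧
      ν = 3 * δ - γ ∧
      G.PosDef ∧
      ((fun t => (v t).Q m Λ) =O[atTop] fun t => Real.exp (-2 * γ * t)) ∧
      ((fun t => (v t).normSq (v t).σ) =O[atTop] fun t => Real.exp (-2 * γ * t)) ∧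
      ((fun t => |(v t).R (EMSF.structureConstants b)|)
        =O[atTop] fun t => Real.exp (-2 * γ * t)) ∧
      ((fun t => (v t).τ00) =O[atTop] fun t => Real.exp (-2 * γ * t)) ∧
      ((fun t => (v t).ρ) =O[atTop] fun t => Real.exp (-2 * γ * t)) ∧
      ((fun t => deriv (fun r => (v r).Φ) t ^ 2) =O[atTop] fun t => Real.exp (-2 * γ * t)) ∧
      ((fun t => (v t).normSq (v t).F) =O[atTop] fun t => Real.exp (-2 * γ * t)) ∧
      ((fun t => (v t).ESq) =O[atTop] fun t => Real.exp (-2 * γ * t)) ∧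
      (∃ C > 0, ∀ t, 0 ≤ t →
        EMSF.opNorm (v t).σ ≤ C * Real.exp (-γ * t) * EMSF.opNorm (v t).g) ∧
      Tendsto (fun t => (v t).Φ ^ 2) atTop (𝓝 L) ∧
      Tendsto (fun t => (v t).T00 m) atTop (𝓝 (m ^ 2 / 2 * L)) ∧
      ((fun t => (v t).H - (-√(3 * C₀))) =O[atTop] fun t => Real.exp (-2 * δ * t)) ∧
      (∃ C > 0, ∀ t, 0 ≤ t → ∀ i j, |Real.exp (-2 * δ * t) * (v t).g i j| ≤ C) ∧
      (∃ C > 0, ∀ t, 0 ≤ t → ∀ i j, |Real.exp (2 * δ * t) * (v t).gi i j| ≤ C) ∧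
      (∀ i j, ∃ r : ℝ → ℝ, (r =O[atTop] fun t => Real.exp (-γ * t)) ∧
        ∀ t, 0 ≤ t → (v t).g i j = Real.exp (2 * δ * t) * (G i j + r t)) ∧
      (∀ i j, ∃ r : ℝ → ℝ, (r =O[atTop] fun t => Real.exp (-γ * t)) ∧
        ∀ t, 0 ≤ t → (v t).gi i j = Real.exp (-2 * δ * t) * (G⁻¹ i j + r t)) ∧
      (∃ C > 0, ∀ t, 0 ≤ t → ∀ i j, |(v t).k i j| ≤ C * Real.exp (2 * δ * t)) ∧
      (∃ C > 0, ∀ t, 0 ≤ t → ∀ i, |(v t).E i| ≤ C * Real.exp (ν * t)) ∧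
      (∃ C > 0, ∀ t, 0 ≤ t → ∀ i j, |(v t).F i j| ≤ C * Real.exp ((2 * δ + ν) * t)) ∧
      (∃ C > 0, ∀ t, 0 ≤ t → ∀ i j,
        |(v t).raise (v t).F i j| ≤ C * Real.exp ((δ - γ) * t)) ∧
      (∃ C > 0, ∀ t, 0 ≤ t → |(v t).e| ≤ C * Real.exp (ν * t)) :=
  theorem4_general (EMSF.isExpanding_of_not_isBianchiIX h_type hm.ne' h_data hΛ hH h_sol hγ)
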